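/- A series-parallel network is a single resistor (resistance $R\ge 0$), inductor (inductance $L>0$) or capacitor (capacitance $C>0$), with impedance $R$, $Ls$, $\tfrac{1}{Cs}$ respectively, or a series or parallel connection of two series-parallel networks with impedances $Z_1,Z_2$; the impedance $Z$ of the connection satisfies $Z=Z_1+Z_2$ (series) or $\tfrac1Z=\tfrac1{Z_1}+\tfrac1{Z_2}$ (parallel; $Z=0$ if a branch is a short circuit). Let $\mathcal{Z}_{m,n}\subset\mathbb{R}(s)$ be the set of impedances of series-parallel networks containing at most $m$ capacitors and at most $n$ inductors (and finitely many resistors). A $Z\in\mathbb{R}(s)$ is biquadratic if its McMillan degree is two. Real numbers are said to have the same sign if either all are non-negative or all are non-positive. For $a(s)=a_2s^2+a_1s+a_0$ and $b(s)=b_2s^2+b_1s+b_0$ in $\mathbb{R}[s]$, let $$R_0(a,b)=\begin{vmatrix} b_2&b_1&b_0&0\\ a_2&a_1&a_0&0\\ 0&b_2&b_1&b_0\\ 0&a_2&a_1&a_0\end{vmatrix},$$ and let $\mathcal{B}(a,b)$ be the $2\times 2$ Bezoutian matrix given by $$\frac{a(z)b(w)-b(z)a(w)}{z-w}=\sum_{i=1}^{2}\sum_{j=1}^{2}\mathcal{B}_{ij}z^{i-1}w^{j-1}.$$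 For $c(s)=c_2s^2+c_1s+c_0$ and $d(s)=d_2s^2+d_1s+d_0$ let $\alpha_1=c_1d_0-c_0d_1$, $\alpha_2=c_2d_0-c_0d_2$, $\alpha_3=c_2d_1-c_1d_2$, $\lambda_1=d_1\alpha_1-d_0\alpha_2$, $\lambda_2=c_1\alpha_3-c_2\alpha_2$, $\lambda_3=d_2\alpha_2-d_1\alpha_3$, $\lambda_4=c_0\alpha_2-c_1\alpha_1$. Given $a,b$ and real $x,z$, define the following two sets of quantities. (A) $\tilde a=a(-x)$, $\tilde b=b(-x)$, $[f_0\ f_1]=[1\ {-x}]\,\mathcal{B}(a,b)$; $c_2=f_1$, $c_1=f_0+xf_1$, $c_0=xf_0$; $h_2=b_2$, $h_1=b_1-zf_1$, $h_0=b_0-zf_0$; $d_i=\tilde b h_i$ $(i=0,1,2)$; $\tilde h=h_2x^2-h_1x+h_0$. (B) $\tilde a=a_0x^2-a_1x+a_2$, $\tilde b=b_0x^2-b_1x+b_2$, $[f_0\ f_1]=-[{-x}\ \ 1]\,\mathcal{B}(a,b)$; $c_2=xf_1$, $c_1=xf_0+f_1$, $c_0=f_0$; $h_2=b_2-zf_1$,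 $h_1=b_1-zf_0$, $h_0=b_0$; $d_i=\tilde b h_i$ $(i=0,1,2)$; $\tilde h=h_0x^2-h_1x+h_2$. Consider the following conditions, each of which also includes the requirements that $a_i,b_i\ge 0$ for $i=0,1,2$, that $\tilde h\neq 0$, and that $R_0(a,b)\ne 0$: (I) with (A): $\tilde a,\tilde b,z,d_0,d_1,d_2,f_0,f_1,\lambda_1$ have the same sign; $\alpha_2\ge 0$ and $-\tilde b\tilde hR_0(a,b)\ge 0$. (II) with (A): $\tilde a,\tilde b,z,d_0,d_1,d_2,f_0,f_1,\lambda_3$ have the same sign; $\alpha_2\le 0$ and $\tilde b\tilde hR_0(a,b)\le 0$. (III) with (A): $\tilde a,\tilde b,z,d_0,d_1,d_2,f_0,f_1,\lambda_4$ have the same sign; $\alpha_2\le 0$ and $\tilde b\tilde hR_0(a,b)\le 0$. (IV) with (A): $\tilde a,\tilde b,z,d_0,d_1,d_2,f_0,f_1,\lambda_2$ have the same sign; $\alpha_2\ge 0$ and $-\tilde b\tilde hR_0(a,b)\ge 0$. (V) with (B): $\tilde a,\tilde b,z,d_0,d_1,d_2,f_0,f_1,\lambda_1$ have the same sign; $\alpha_2\ge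 0$ and $\tilde b\tilde hR_0(a,b)\ge 0$. Theorem. Let $Z\in\mathbb{R}(s)$ be biquadratic. Then $Z\in\mathcal{Z}_{1,2}$ if and only if either (a) $Z\in\mathcal{Z}_{1,1}$; or (b) $Z\in\mathcal{Z}_{0,2}$; or (c) there exist $x\ge 0$, $z\ne 0$ and real $a_0,a_1,a_2,b_0,b_1,b_2$ such that $$Z(s)=\frac{a_2s^2+a_1s+a_0}{b_2s^2+b_1s+b_0}\quad\text{or}\quad Z(s)=\frac{b_0s^2+b_1s+b_2}{a_0s^2+a_1s+a_2},$$ and at least one of the following holds: (1) condition (I) and $\lambda_1=0$; (2) condition (II) and $\lambda_3=0$; (3) condition (III) and either $\lambda_4=0$ or $d_0=0$; (4) condition (IV) and either $\lambda_2=0$ or $d_2=0$; (5) condition (V) and $d_2=0$. -/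

import Mathlib

/-- A series-parallel network: a single resistor, inductor or capacitor (a resistor of resistance
`0` is a short circuit), or the series or parallel connection of two series-parallel networks. -/
inductive SPNetwork : Type
  | resistor (R : ℝ) (hR : 0 ≤ R) : SPNetwork
  | inductor (L : ℝ) (hL : 0 < L) : SPNetwork
  | capacitor (C : ℝ) (hC : 0 < C) : SPNetwork
  | series (N₁ N₂ : SPNetwork) : SPNetwork
  | parallel (N₁ N₂ : SPNetwork) : SPNetwork

namespace SPNetwork

/-- The impedance, as a real rational function of `s`. The parallel connection is written as
`Z₁ Z₂ / (Z₁ + Z₂)`: this is `1 / Z = 1 / Z₁ + 1 / Z₂` when neither branch is a short circuit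
(see `inv_impedance_parallel`), and it is `0` when one of the branches is a short circuit. -/
noncomputable def impedance : SPNetwork → RatFunc ℝ
  | resistor R _ => RatFunc.C R
  | inductor L _ => RatFunc.C L * RatFunc.X
  | capacitor C _ => 1 / (RatFunc.C C * RatFunc.X)
  | series N₁ N₂ => N₁.impedance + N₂.impedance
  | parallel N₁ N₂ =>
      N₁.impedance * N₂.impedance / (N₁.impedance + N₂.impedance)

/-- The number of capacitors of a network. -/
def numCapacitors : SPNetwork → ℕ
  | resistor _ _ => 0
  | inductor _ _ => 0
  | capacitor _ _ => 1
  | series N₁ N₂ => N₁.numCapacitors + N₂.numCapacitors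
  | parallel N₁ N₂ => N₁.numCapacitors + N₂.numCapacitors

/-- The number of inductors of a network. -/
def numInductors : SPNetwork → ℕ
  | resistor _ _ => 0
  | inductor _ _ => 1
  | capacitor _ _ => 0
  | series N₁ N₂ => N₁.numInductors + N₂.numInductors
  | parallel N₁ N₂ => N₁.numInductors + N₂.numInductors

theorem inv_impedance_parallel (N₁ N₂ : SPNetwork)
    (h₁ : N₁.impedance ≠ 0) (h₂ : N₂.impedance ≠ 0) :
    (parallel N₁ N₂).impedance⁻¹ = N₁.impedance⁻¹ + N₂.impedance⁻¹ := by
  simp only [impedance]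
  rw [inv_div]
  field_simp
  ring

end SPNetwork

/-- `𝒵_{m,n}`: the impedances of the series-parallel networks that contain at most `m` capacitors
and at most `n` inductors (and any number of resistors). -/
def impedanceSet (m n : ℕ) : Set (RatFunc ℝ) :=
  {Z | ∃ N : SPNetwork, N.numCapacitors ≤ m ∧ N.numInductors ≤ n ∧ N.impedance = Z}

/-- A biquadratic function: a real rational function of McMillan degree two. -/
def IsBiquadratic (Z : RatFunc ℝ) : Prop :=
  max Z.num.natDegree Z.denom.natDegree = 2

/-- A real polynomial `c₂ s² + c₁ s + c₀` of degree at most two, by its coefficients. -/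
structure Quad where
  c₂ : ℝ
  c₁ : ℝ
  c₀ : ℝ

namespace Quad

/-- The value of `c₂ s² + c₁ s + c₀` at a real point. -/
def eval (p : Quad) (s : ℝ) : ℝ := p.c₂ * s ^ 2 + p.c₁ * s + p.c₀

/-- `p` as an element of `ℝ(s)`. -/
noncomputable def toRatFunc (p : Quad) : RatFunc ℝ :=
  RatFunc.C p.c₂ * RatFunc.X ^ 2 + RatFunc.C p.c₁ * RatFunc.X + RatFunc.C p.c₀

/-- The reversed polynomial `c₀ s² + c₁ s + c₂`. -/
def reverse (p : Quad) : Quad := ⟨p.c₀, p.c₁, p.c₂⟩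

/-- All three coefficients are non-negative. -/
def Nonneg (p : Quad) : Prop := 0 ≤ p.c₀ ∧ 0 ≤ p.c₁ ∧ 0 ≤ p.c₂

end Quad

/-- `R₀(p, q)`, the determinant of the Sylvester matrix `𝒮₀(p, q)`. -/
noncomputable def sylvesterR0 (p q : Quad) : ℝ :=
  Matrix.det !![q.c₂, q.c₁, q.c₀, 0;
                p.c₂, p.c₁, p.c₀, 0;
                0, q.c₂, q.c₁, q.c₀;
                0, p.c₂, p.c₁, p.c₀]

/-- The Bezoutian matrix `ℬ(q, p)`. -/
def bezoutian (q p : Quad) : Matrix (Fin 2) (Fin 2) ℝ :=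
  !![q.c₁ * p.c₀ - q.c₀ * p.c₁, q.c₂ * p.c₀ - q.c₀ * p.c₂;
     q.c₂ * p.c₀ - q.c₀ * p.c₂, q.c₂ * p.c₁ - q.c₁ * p.c₂]

/-- The defining identity of the Bezoutian,
`(q(z) p(w) - p(z) q(w)) / (z - w) = ∑ᵢ ∑ⱼ ℬᵢⱼ zⁱ wʲ` (indices from `0`). -/
theorem bezoutian_spec (q p : Quad) (z w : ℝ) :
    q.eval z * p.eval w - p.eval z * q.eval w =
      (z - w) * ∑ i : Fin 2, ∑ j : Fin 2, bezoutian q p i j * z ^ (i : ℕ) * w ^ (j : ℕ) := by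
  simp [Fin.sum_univ_two, bezoutian, Quad.eval]
  ring

/-- A list of real numbers has the same sign if either all of them are non-negative or all of them
are non-positive. -/
def SameSign (l : List ℝ) : Prop := (∀ t ∈ l, 0 ≤ t) ∨ (∀ t ∈ l, t ≤ 0)

def alpha₁ (c d : Quad) : ℝ := c.c₁ * d.c₀ - c.c₀ * d.c₁
def alpha₂ (c d : Quad) : ℝ := c.c₂ * d.c₀ - c.c₀ * d.c₂
def alpha₃ (c d : Quad) : ℝ := c.c₂ * d.c₁ - c.c₁ * d.c₂
def lambda₁ (c d : Quad) : ℝ := d.c₁ * alpha₁ c d - d.c₀ * alpha₂ c d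
def lambda₂ (c d : Quad) : ℝ := c.c₁ * alpha₃ c d - c.c₂ * alpha₂ c d
def lambda₃ (c d : Quad) : ℝ := d.c₂ * alpha₂ c d - d.c₁ * alpha₃ c d
def lambda₄ (c d : Quad) : ℝ := c.c₀ * alpha₂ c d - c.c₁ * alpha₁ c d

/-- The quantities `ã, b̃, h̃, f₀, f₁, c(s), d(s)` that are built from `a, b, x, z`. -/
structure DerivedData where
  ta : ℝ
  tb : ℝ
  th : ℝ
  f₀ : ℝ
  f₁ : ℝ
  c : Quad
  d : Quad

/-- The quantities used in the conditions (I)-(IV):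
`ã = a(-x)`, `b̃ = b(-x)`, `[f₀ f₁] = [1 -x] ℬ(a, b)`, `c(s) = (f₁ s + f₀)(s + x)`,
`h(s) = b(s) - z (f₁ s + f₀)`, `d = b̃ h` and `h̃ = h(-x)`. -/
noncomputable def derivedA (a b : Quad) (x z : ℝ) : DerivedData :=
  let ta := a.eval (-x)
  let tb := b.eval (-x)
  let f := Matrix.vecMul ![1, -x] (bezoutian a b)
  let h : Quad := ⟨b.c₂, b.c₁ - z * f 1, b.c₀ - z * f 0⟩
  { ta := ta
    tb := tb
    th := h.eval (-x)
    f₀ := f 0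
    f₁ := f 1
    c := ⟨f 1, f 0 + x * f 1, x * f 0⟩
    d := ⟨tb * h.c₂, tb * h.c₁, tb * h.c₀⟩ }

/-- The quantities used in the condition (V):
`ã = a₀x² - a₁x + a₂`, `b̃ = b₀x² - b₁x + b₂`, `[f₀ f₁] = -[-x 1] ℬ(a, b)`,
`c(s) = (f₁ s + f₀)(x s + 1)`, `h(s) = b(s) - z s (f₁ s + f₀)`, `d = b̃ h` and
`h̃ = h₀x² - h₁x + h₂`. -/
noncomputable def derivedB (a b : Quad) (x z : ℝ) : DerivedData :=
  let ta := a.c₀ * x ^ 2 - a.c₁ * x + a.c₂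
  let tb := b.c₀ * x ^ 2 - b.c₁ * x + b.c₂
  let f := -Matrix.vecMul ![-x, 1] (bezoutian a b)
  let h : Quad := ⟨b.c₂ - z * f 1, b.c₁ - z * f 0, b.c₀⟩
  { ta := ta
    tb := tb
    th := h.c₀ * x ^ 2 - h.c₁ * x + h.c₂
    f₀ := f 0
    f₁ := f 1
    c := ⟨x * f 1, x * f 0 + f 1, f 0⟩
    d := ⟨tb * h.c₂, tb * h.c₁, tb * h.c₀⟩ }

/-- The part common to (I)-(V), where `l` is the relevant one of `λ₁, λ₂, λ₃, λ₄`. -/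
def CommonCond (a b : Quad) (z : ℝ) (D : DerivedData) (l : ℝ) : Prop :=
  a.Nonneg ∧ b.Nonneg ∧
    SameSign [D.ta, D.tb, z, D.d.c₀, D.d.c₁, D.d.c₂, D.f₀, D.f₁, l] ∧
    D.th ≠ 0 ∧ sylvesterR0 a b ≠ 0

/-- Condition (I): `λ₁` has the same sign as the other quantities, and `α₂ ≥ 0`, `-b̃ h̃ R₀(a, b) ≥ 0`. -/
def CondI (a b : Quad) (x z : ℝ) : Prop :=
  let D := derivedA a b x z
  CommonCond a b z D (lambda₁ D.c D.d) ∧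
    0 ≤ alpha₂ D.c D.d ∧ 0 ≤ -(D.tb * D.th * sylvesterR0 a b)

/-- Condition (II): `λ₃` has the same sign as the other quantities, and `α₂ ≤ 0`, `b̃ h̃ R₀(a, b) ≤ 0`. -/
def CondII (a b : Quad) (x z : ℝ) : Prop :=
  let D := derivedA a b x z
  CommonCond a b z D (lambda₃ D.c D.d) ∧
    alpha₂ D.c D.d ≤ 0 ∧ D.tb * D.th * sylvesterR0 a b ≤ 0

/-- Condition (III): `λ₄` has the same sign as the other quantities, and `α₂ ≤ 0`, `b̃ h̃ R₀(a, b) ≤ 0`. -/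
def CondIII (a b : Quad) (x z : ℝ) : Prop :=
  let D := derivedA a b x z
  CommonCond a b z D (lambda₄ D.c D.d) ∧
    alpha₂ D.c D.d ≤ 0 ∧ D.tb * D.th * sylvesterR0 a b ≤ 0

/-- Condition (IV): `λ₂` has the same sign as the other quantities, and `α₂ ≥ 0`, `-b̃ h̃ R₀(a, b) ≥ 0`. -/
def CondIV (a b : Quad) (x z : ℝ) : Prop :=
  let D := derivedA a b x z
  CommonCond a b z D (lambda₂ D.c D.d) ∧
    0 ≤ alpha₂ D.c D.d ∧ 0 ≤ -(D.tb * D.th * sylvesterR0 a b)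

/-- Condition (V): `λ₁` has the same sign as the other quantities (of `derivedB`), and `α₂ ≥ 0`, `b̃ h̃ R₀(a, b) ≥ 0`. -/
def CondV (a b : Quad) (x z : ℝ) : Prop :=
  let D := derivedB a b x z
  CommonCond a b z D (lambda₁ D.c D.d) ∧
    0 ≤ alpha₂ D.c D.d ∧ 0 ≤ D.tb * D.th * sylvesterR0 a b

/-- At least one of (I)-(V) holds together with one of the boundary equalities that go with
it. -/
def BoundaryCond (a b : Quad) (x z : ℝ) : Prop :=
  let A := derivedA a b x z
  let B := derivedB a b x z
  (CondI a b x z ∧ lambda₁ A.c A.d = 0) ∨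
  (CondII a b x z ∧ lambda₃ A.c A.d = 0) ∨
  (CondIII a b x z ∧ (lambda₄ A.c A.d = 0 ∨ A.d.c₀ = 0)) ∨
  (CondIV a b x z ∧ (lambda₂ A.c A.d = 0 ∨ A.d.c₂ = 0)) ∨
  (CondV a b x z ∧ B.d.c₂ = 0)

/-! The dual `1 / Z(1 / s)` preserves both element counts and exchanges series with parallel
connections. Hence a member of `𝒵_{1,2}` either needs fewer reactive elements or, up to duality, is
a resistor `r` in series with two parallel networks that share the elements
(`isReducible_of_mem_impedanceSet`). One of these two holds at most a single inductor or a single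
capacitor.

Suppose it is inductive. Its shunt conductance is moved into the other network, so `Z = r + (k / (s
+ x) + d / c)⁻¹` with `c / d ∈ 𝒵_{1,1}`. As `Z` has degree two and not three, the poles must be
shared: `c = (s + x) F` with `F = f₁ s + f₀` (`eval_eq_zero_of_isDegreeTwo`). Then `Z = r + c / (d +
k F)`, and replacing `d` by `d + t F` and `k` by `k - t` does not change `Z`. This freedom is why
equalities may be imposed: `t` is moved until a sign condition becomes an equality, or until an
element is saved by a cancellation or by absorbing the whole branch (`IsRegularPair.deform`). A
capacitive branch becomes inductive under `s ↦ 1 / s`, next to two capacitors, and the same freedom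
is used (`IsInductivePair.deform`).

The sign conditions come from two-element networks. Extracting a resistor and then an inductor at `s
= 0` leaves a bilinear function, which is capacitive or inductive according to the sign of the
resultant (`lambda₁_expansion`); the cases of the other `λᵢ` follow by frequency inversion and
duality. Conversely, explicit coefficients show that every such network satisfies one of these
conditions (`isRegularPair_of_parallel`, `IsParallelSplit.exists_inductive`).

The data built from `a, b, x, z` encode exactly this decomposition. Reading them as a network gives
sufficiency (`mem_of_derivedA`); `derivedA_of_addLin` recovers them from `r, k, x, F, d` and gives
necessity. -/

/-! ### Non-negative coefficients and non-vanishing of impedances -/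

/-- A rational function that is a quotient of two nonzero polynomials with non-negative
coefficients. -/
def IsPosRat (Z : RatFunc ℝ) : Prop :=
  ∃ p q : Polynomial ℝ, p ≠ 0 ∧ q ≠ 0 ∧ (∀ i, 0 ≤ p.coeff i) ∧ (∀ i, 0 ≤ q.coeff i) ∧
    Z = algebraMap _ (RatFunc ℝ) p / algebraMap _ (RatFunc ℝ) q

theorem Polynomial.mul_coeff_nonneg {p q : Polynomial ℝ} (hp : ∀ i, 0 ≤ p.coeff i)
    (hq : ∀ i, 0 ≤ q.coeff i) (i : ℕ) : 0 ≤ (p * q).coeff i := by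
  rw [Polynomial.coeff_mul]
  exact Finset.sum_nonneg fun x _ => mul_nonneg (hp _) (hq _)

theorem Polynomial.add_ne_zero_of_coeff_nonneg {p q : Polynomial ℝ} (hp0 : p ≠ 0)
    (hp : ∀ i, 0 ≤ p.coeff i) (hq : ∀ i, 0 ≤ q.coeff i) : p + q ≠ 0 := by
  intro h
  apply hp0
  ext i
  have h1 : p.coeff i + q.coeff i = 0 := by rw [← Polynomial.coeff_add, h]; simp
  have := hp i
  have := hq i
  simp only [Polynomial.coeff_zero]
  linarith

namespace IsPosRat

theorem ne_zero {Z : RatFunc ℝ} (h : IsPosRat Z) : Z ≠ 0 := by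
  obtain ⟨p, q, hp, hq, -, -, rfl⟩ := h
  exact div_ne_zero (RatFunc.algebraMap_ne_zero hp) (RatFunc.algebraMap_ne_zero hq)

theorem mul {Y Z : RatFunc ℝ} (hY : IsPosRat Y) (hZ : IsPosRat Z) : IsPosRat (Y * Z) := by
  obtain ⟨p, q, hp, hq, hp', hq', rfl⟩ := hY
  obtain ⟨u, v, hu, hv, hu', hv', rfl⟩ := hZ
  refine ⟨p * u, q * v, mul_ne_zero hp hu, mul_ne_zero hq hv,
    Polynomial.mul_coeff_nonneg hp' hu', Polynomial.mul_coeff_nonneg hq' hv', ?_⟩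
  rw [map_mul, map_mul, div_mul_div_comm]

theorem inv {Z : RatFunc ℝ} (hZ : IsPosRat Z) : IsPosRat Z⁻¹ := by
  obtain ⟨p, q, hp, hq, hp', hq', rfl⟩ := hZ
  exact ⟨q, p, hq, hp, hq', hp', by rw [inv_div]⟩

theorem add {Y Z : RatFunc ℝ} (hY : IsPosRat Y) (hZ : IsPosRat Z) : IsPosRat (Y + Z) := by
  obtain ⟨p, q, hp, hq, hp', hq', rfl⟩ := hY
  obtain ⟨u, v, hu, hv, hu', hv', rfl⟩ := hZ
  have h1 := Polynomial.mul_coeff_nonneg hp' hv'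
  have h2 := Polynomial.mul_coeff_nonneg hq' hu'
  refine ⟨p * v + q * u, q * v,
    Polynomial.add_ne_zero_of_coeff_nonneg (mul_ne_zero hp hv) h1 h2, mul_ne_zero hq hv, ?_,
    Polynomial.mul_coeff_nonneg hq' hv', ?_⟩
  · intro i
    rw [Polynomial.coeff_add]
    exact add_nonneg (h1 i) (h2 i)
  · rw [map_add, map_mul, map_mul, map_mul, div_add_div _ _ (RatFunc.algebraMap_ne_zero hq)
      (RatFunc.algebraMap_ne_zero hv)]

theorem C {r : ℝ} (hr : 0 < r) : IsPosRat (RatFunc.C r) := by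
  refine ⟨Polynomial.C r, 1, by simpa using hr.ne', one_ne_zero, ?_, ?_, ?_⟩
  · intro i
    rw [Polynomial.coeff_C]
    split_ifs <;> linarith
  · intro i
    rw [Polynomial.coeff_one]
    split_ifs <;> norm_num
  · simp

theorem X : IsPosRat (RatFunc.X : RatFunc ℝ) := by
  refine ⟨Polynomial.X, 1, Polynomial.X_ne_zero, one_ne_zero, ?_, ?_, ?_⟩
  · intro i
    rw [Polynomial.coeff_X]
    split_ifs <;> norm_num
  · intro i
    rw [Polynomial.coeff_one]
    split_ifs <;> norm_num
  · simp

end IsPosRat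

/-- Zero, or a quotient of two nonzero polynomials with non-negative coefficients. -/
def IsNonnegRat (Z : RatFunc ℝ) : Prop := Z = 0 ∨ IsPosRat Z

namespace IsNonnegRat

theorem pos {Z : RatFunc ℝ} (h : IsNonnegRat Z) (h0 : Z ≠ 0) : IsPosRat Z :=
  h.resolve_left h0

theorem add_pos {Y Z : RatFunc ℝ} (hY : IsNonnegRat Y) (hZ : IsPosRat Z) : IsPosRat (Y + Z) := by
  rcases hY with rfl | hY
  · rwa [zero_add]
  · exact hY.add hZ

theorem add {Y Z : RatFunc ℝ} (hY : IsNonnegRat Y) (hZ : IsNonnegRat Z) :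
    IsNonnegRat (Y + Z) := by
  rcases hZ with rfl | hZ
  · rwa [add_zero]
  · exact Or.inr (hY.add_pos hZ)

theorem mul {Y Z : RatFunc ℝ} (hY : IsNonnegRat Y) (hZ : IsNonnegRat Z) :
    IsNonnegRat (Y * Z) := by
  rcases hZ with rfl | hZ
  · exact Or.inl (mul_zero _)
  · rcases hY with rfl | hY
    · exact Or.inl (zero_mul _)
    · exact Or.inr (hY.mul hZ)

theorem inv {Z : RatFunc ℝ} (hZ : IsNonnegRat Z) : IsNonnegRat Z⁻¹ := by
  rcases hZ with rfl | hZ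
  · exact Or.inl inv_zero
  · exact Or.inr hZ.inv

theorem C {r : ℝ} (hr : 0 ≤ r) : IsNonnegRat (RatFunc.C r) := by
  rcases hr.eq_or_lt with rfl | hr
  · exact Or.inl (map_zero _)
  · exact Or.inr (IsPosRat.C hr)

end IsNonnegRat

/-- Non-negative coefficients exclude cancellation, so a sum of nonzero impedances or admittances is
nonzero. Later divisions by such sums rest on this. -/
theorem SPNetwork.isNonnegRat_impedance (N : SPNetwork) : IsNonnegRat N.impedance := by
  induction N with
  | resistor R hR => exact IsNonnegRat.C hR
  | inductor L hL => exact Or.inr ((IsPosRat.C hL).mul IsPosRat.X)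
  | capacitor C hC =>
    refine Or.inr ?_
    simp only [impedance, one_div]
    exact ((IsPosRat.C hC).mul IsPosRat.X).inv
  | series N₁ N₂ h₁ h₂ => exact h₁.add h₂
  | parallel N₁ N₂ h₁ h₂ =>
    simp only [impedance, div_eq_mul_inv]
    exact (h₁.mul h₂).mul (h₁.add h₂).inv

theorem isNonnegRat_of_mem_impedanceSet {m n : ℕ} {Z : RatFunc ℝ} (h : Z ∈ impedanceSet m n) :
    IsNonnegRat Z := by
  obtain ⟨N, -, -, rfl⟩ := h
  exact N.isNonnegRat_impedance

theorem isPosRat_of_mem_impedanceSet {m n : ℕ} {Z : RatFunc ℝ} (h : Z ∈ impedanceSet m n)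
    (h0 : Z ≠ 0) : IsPosRat Z :=
  (isNonnegRat_of_mem_impedanceSet h).pos h0

/-! ### Frequency inversion and duality -/

/-- The substitution `s ↦ 1 / s` on rational functions. -/
noncomputable def frequencyInversion : RatFunc ℝ →ₐ[ℝ] RatFunc ℝ :=
  RatFunc.liftAlgHom (Polynomial.aeval (RatFunc.X : RatFunc ℝ)⁻¹) <| by
    intro p hp
    rw [Submonoid.mem_comap, mem_nonZeroDivisors_iff_ne_zero]
    intro h
    refine RatFunc.transcendental_X (K := ℝ) (IsAlgebraic.inv_iff.1 ⟨p, ?_, h⟩)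
    exact nonZeroDivisors.ne_zero hp

theorem frequencyInversion_algebraMap (p : Polynomial ℝ) :
    frequencyInversion (algebraMap _ _ p) = Polynomial.aeval (RatFunc.X : RatFunc ℝ)⁻¹ p := by
  have := RatFunc.liftAlgHom_apply_div (L := RatFunc ℝ) (S := ℝ)
    (Polynomial.aeval (RatFunc.X : RatFunc ℝ)⁻¹) (by
    intro p hp
    rw [Submonoid.mem_comap, mem_nonZeroDivisors_iff_ne_zero]
    intro h
    refine RatFunc.transcendental_X (K := ℝ) (IsAlgebraic.inv_iff.1 ⟨p, ?_, h⟩)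
    exact nonZeroDivisors.ne_zero hp) p 1
  rw [map_one, map_one, div_one, div_one] at this
  exact this

@[simp]
theorem frequencyInversion_C (r : ℝ) : frequencyInversion (RatFunc.C r) = RatFunc.C r := by
  rw [← RatFunc.algebraMap_eq_C]
  exact frequencyInversion.commutes r

@[simp]
theorem frequencyInversion_X : frequencyInversion RatFunc.X = (RatFunc.X : RatFunc ℝ)⁻¹ := by
  rw [← RatFunc.algebraMap_X, frequencyInversion_algebraMap, Polynomial.aeval_X,
    RatFunc.algebraMap_X]

@[simp]
theorem frequencyInversion_frequencyInversion (Z : RatFunc ℝ) :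
    frequencyInversion (frequencyInversion Z) = Z := by
  have key : ∀ p : Polynomial ℝ, frequencyInversion (frequencyInversion (algebraMap _ _ p)) =
      algebraMap _ (RatFunc ℝ) p := by
    intro p
    induction p using Polynomial.induction_on' with
    | add p q hp hq => simp only [map_add, hp, hq]
    | monomial n a =>
      rw [← Polynomial.C_mul_X_pow_eq_monomial]
      simp
  rw [← RatFunc.num_div_denom Z, map_div₀, map_div₀, key, key]

theorem frequencyInversion_ne_zero {Z : RatFunc ℝ} (hZ : Z ≠ 0) : frequencyInversion Z ≠ 0 :=
  (map_ne_zero _).2 hZ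

/-- The dual `1 / Z(1 / s)` of a rational function `Z(s)`. -/
noncomputable def dualRat (Z : RatFunc ℝ) : RatFunc ℝ := (frequencyInversion Z)⁻¹

@[simp]
theorem dualRat_dualRat (Z : RatFunc ℝ) : dualRat (dualRat Z) = Z := by
  simp [dualRat]

@[simp]
theorem dualRat_zero : dualRat 0 = 0 := by
  simp [dualRat]

theorem dualRat_ne_zero {Z : RatFunc ℝ} (hZ : Z ≠ 0) : dualRat Z ≠ 0 :=
  inv_ne_zero (frequencyInversion_ne_zero hZ)

/-! ### Closure properties of the sets `𝒵_{m,n}` -/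

theorem impedanceSet_mono {m n m' n' : ℕ} (hm : m ≤ m') (hn : n ≤ n') :
    impedanceSet m n ⊆ impedanceSet m' n' := by
  rintro Z ⟨N, h₁, h₂, rfl⟩
  exact ⟨N, h₁.trans hm, h₂.trans hn, rfl⟩

theorem C_mem_impedanceSet {r : ℝ} (hr : 0 ≤ r) (m n : ℕ) : RatFunc.C r ∈ impedanceSet m n :=
  ⟨.resistor r hr, Nat.zero_le _, Nat.zero_le _, rfl⟩

theorem zero_mem_impedanceSet (m n : ℕ) : (0 : RatFunc ℝ) ∈ impedanceSet m n := by
  simpa using C_mem_impedanceSet le_rfl m n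

theorem add_mem_impedanceSet {m₁ n₁ m₂ n₂ : ℕ} {Y Z : RatFunc ℝ} (hY : Y ∈ impedanceSet m₁ n₁)
    (hZ : Z ∈ impedanceSet m₂ n₂) : Y + Z ∈ impedanceSet (m₁ + m₂) (n₁ + n₂) := by
  obtain ⟨N, h₁, h₂, rfl⟩ := hY
  obtain ⟨M, h₃, h₄, rfl⟩ := hZ
  exact ⟨.series N M, add_le_add h₁ h₃, add_le_add h₂ h₄, rfl⟩

theorem mul_div_add_eq_inv_add_inv {K : Type*} [Field K] {y z : K} (hy : y ≠ 0) (hz : z ≠ 0) :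
    y * z / (y + z) = (y⁻¹ + z⁻¹)⁻¹ := by
  rw [inv_add_inv hy hz, inv_div]

theorem parallel_mem_impedanceSet {m₁ n₁ m₂ n₂ : ℕ} {Y Z : RatFunc ℝ}
    (hY : Y ∈ impedanceSet m₁ n₁) (hZ : Z ∈ impedanceSet m₂ n₂) (hY0 : Y ≠ 0) (hZ0 : Z ≠ 0) :
    (Y⁻¹ + Z⁻¹)⁻¹ ∈ impedanceSet (m₁ + m₂) (n₁ + n₂) := by
  obtain ⟨N, h₁, h₂, rfl⟩ := hY
  obtain ⟨M, h₃, h₄, rfl⟩ := hZ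
  exact ⟨.parallel N M, add_le_add h₁ h₃, add_le_add h₂ h₄,
    mul_div_add_eq_inv_add_inv hY0 hZ0⟩

theorem C_add_mem_impedanceSet {m n : ℕ} {Z : RatFunc ℝ} (hZ : Z ∈ impedanceSet m n) {r : ℝ}
    (hr : 0 ≤ r) : RatFunc.C r + Z ∈ impedanceSet m n := by
  simpa using add_mem_impedanceSet (C_mem_impedanceSet hr 0 0) hZ

theorem RatFunc.C_ne_zero {r : ℝ} (hr : r ≠ 0) : (RatFunc.C r : RatFunc ℝ) ≠ 0 :=
  (map_ne_zero _).2 hr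

theorem parallel_C_mem_impedanceSet {m n : ℕ} {Z : RatFunc ℝ} (hZ : Z ∈ impedanceSet m n)
    (hZ0 : Z ≠ 0) {g : ℝ} (hg : 0 ≤ g) : (Z⁻¹ + RatFunc.C g)⁻¹ ∈ impedanceSet m n := by
  rcases hg.eq_or_lt with rfl | hg
  · simpa using hZ
  · have := parallel_mem_impedanceSet hZ (C_mem_impedanceSet (inv_nonneg.2 hg.le) 0 0) hZ0
      (RatFunc.C_ne_zero (inv_ne_zero hg.ne'))
    simpa using this

theorem C_mul_mem_impedanceSet {m n : ℕ} {Z : RatFunc ℝ} (hZ : Z ∈ impedanceSet m n) {t : ℝ}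
    (ht : 0 < t) : RatFunc.C t * Z ∈ impedanceSet m n := by
  have ht0 := RatFunc.C_ne_zero ht.ne'
  obtain ⟨N, h₁, h₂, rfl⟩ := hZ
  suffices h : ∃ M : SPNetwork, M.numCapacitors = N.numCapacitors ∧
      M.numInductors = N.numInductors ∧ M.impedance = RatFunc.C t * N.impedance by
    obtain ⟨M, h₃, h₄, h₅⟩ := h
    exact ⟨M, h₃.trans_le h₁, h₄.trans_le h₂, h₅⟩
  clear h₁ h₂
  induction N with
  | resistor R hR => exact ⟨.resistor (t * R) (mul_nonneg ht.le hR), rfl, rfl, map_mul _ _ _⟩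
  | inductor L hL =>
    exact ⟨.inductor (t * L) (mul_pos ht hL), rfl, rfl, by
      simp only [SPNetwork.impedance, map_mul, mul_assoc]⟩
  | capacitor C hC =>
    refine ⟨.capacitor (C / t) (div_pos hC ht), rfl, rfl, ?_⟩
    have hC0 := RatFunc.C_ne_zero hC.ne'
    have hX := RatFunc.X_ne_zero (K := ℝ)
    simp only [SPNetwork.impedance, map_div₀]
    field_simp
  | series N₁ N₂ ih₁ ih₂ =>
    obtain ⟨M₁, h₁, h₂, h₃⟩ := ih₁
    obtain ⟨M₂, h₄, h₅, h₆⟩ := ih₂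
    refine ⟨.series M₁ M₂, ?_, ?_, ?_⟩ <;>
      simp only [SPNetwork.numCapacitors, SPNetwork.numInductors, SPNetwork.impedance, *, mul_add]
  | parallel N₁ N₂ ih₁ ih₂ =>
    obtain ⟨M₁, h₁, h₂, h₃⟩ := ih₁
    obtain ⟨M₂, h₄, h₅, h₆⟩ := ih₂
    refine ⟨.parallel M₁ M₂, ?_, ?_, ?_⟩
    · simp only [SPNetwork.numCapacitors, *]
    · simp only [SPNetwork.numInductors, *]
    · simp only [SPNetwork.impedance, *]
      rw [← mul_add, mul_mul_mul_comm, mul_assoc, mul_div_mul_left _ _ ht0, mul_div_assoc]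

theorem frequencyInversion_mem_impedanceSet {m n : ℕ} {Z : RatFunc ℝ}
    (hZ : Z ∈ impedanceSet m n) : frequencyInversion Z ∈ impedanceSet n m := by
  obtain ⟨N, h₁, h₂, rfl⟩ := hZ
  suffices h : ∃ M : SPNetwork, M.numCapacitors = N.numInductors ∧
      M.numInductors = N.numCapacitors ∧ M.impedance = frequencyInversion N.impedance by
    obtain ⟨M, h₃, h₄, h₅⟩ := h
    exact ⟨M, h₃.trans_le h₂, h₄.trans_le h₁, h₅⟩
  clear h₁ h₂
  induction N with
  | resistor R hR => exact ⟨.resistor R hR, rfl, rfl, by simp [SPNetwork.impedance]⟩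
  | inductor L hL =>
    exact ⟨.capacitor L⁻¹ (inv_pos.2 hL), rfl, rfl, by simp [SPNetwork.impedance, mul_comm]⟩
  | capacitor C hC =>
    exact ⟨.inductor C⁻¹ (inv_pos.2 hC), rfl, rfl, by simp [SPNetwork.impedance, mul_comm]⟩
  | series N₁ N₂ ih₁ ih₂ =>
    obtain ⟨M₁, h₁, h₂, h₃⟩ := ih₁
    obtain ⟨M₂, h₄, h₅, h₆⟩ := ih₂
    refine ⟨.series M₁ M₂, ?_, ?_, ?_⟩ <;>
      simp only [SPNetwork.numCapacitors, SPNetwork.numInductors, SPNetwork.impedance, *, map_add]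
  | parallel N₁ N₂ ih₁ ih₂ =>
    obtain ⟨M₁, h₁, h₂, h₃⟩ := ih₁
    obtain ⟨M₂, h₄, h₅, h₆⟩ := ih₂
    refine ⟨.parallel M₁ M₂, ?_, ?_, ?_⟩ <;>
      simp only [SPNetwork.numCapacitors, SPNetwork.numInductors, SPNetwork.impedance, *, map_add,
        map_mul, map_div₀]

/-- Inversion exchanges series with parallel and inductors with capacitors. The counts in the inner
claim are only inequalities because a short circuit in a series connection has no dual branch and is
dropped. -/
theorem inv_mem_impedanceSet {m n : ℕ} {Z : RatFunc ℝ} (hZ : Z ∈ impedanceSet m n) (hZ0 : Z ≠ 0) :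
    Z⁻¹ ∈ impedanceSet n m := by
  obtain ⟨N, h₁, h₂, rfl⟩ := hZ
  suffices h : ∃ M : SPNetwork, M.numCapacitors ≤ N.numInductors ∧
      M.numInductors ≤ N.numCapacitors ∧ M.impedance = N.impedance⁻¹ by
    obtain ⟨M, h₃, h₄, h₅⟩ := h
    exact ⟨M, h₃.trans h₂, h₄.trans h₁, h₅⟩
  clear h₁ h₂
  induction N with
  | resistor R hR => exact ⟨.resistor R⁻¹ (inv_nonneg.2 hR), le_rfl, le_rfl, map_inv₀ _ _⟩
  | inductor L hL => exact ⟨.capacitor L hL, le_rfl, le_rfl, by simp [SPNetwork.impedance]⟩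
  | capacitor C hC => exact ⟨.inductor C hC, le_rfl, le_rfl, by simp [SPNetwork.impedance]⟩
  | series N₁ N₂ ih₁ ih₂ =>
    simp only [SPNetwork.impedance, SPNetwork.numCapacitors, SPNetwork.numInductors] at hZ0 ⊢
    by_cases h0₁ : N₁.impedance = 0
    · rw [h0₁, zero_add] at hZ0 ⊢
      obtain ⟨M₂, h₄, h₅, h₆⟩ := ih₂ hZ0
      exact ⟨M₂, h₄.trans (Nat.le_add_left _ _), h₅.trans (Nat.le_add_left _ _), h₆⟩
    by_cases h0₂ : N₂.impedance = 0
    · rw [h0₂, add_zero] at hZ0 ⊢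
      obtain ⟨M₁, h₄, h₅, h₆⟩ := ih₁ hZ0
      exact ⟨M₁, h₄.trans (Nat.le_add_right _ _), h₅.trans (Nat.le_add_right _ _), h₆⟩
    obtain ⟨M₁, h₁, h₂, h₃⟩ := ih₁ h0₁
    obtain ⟨M₂, h₄, h₅, h₆⟩ := ih₂ h0₂
    refine ⟨.parallel M₁ M₂, add_le_add h₁ h₄, add_le_add h₂ h₅, ?_⟩
    simp only [SPNetwork.impedance, h₃, h₆]
    rw [mul_div_add_eq_inv_add_inv (inv_ne_zero h0₁) (inv_ne_zero h0₂), inv_inv, inv_inv]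
  | parallel N₁ N₂ ih₁ ih₂ =>
    simp only [SPNetwork.impedance, SPNetwork.numCapacitors, SPNetwork.numInductors] at hZ0 ⊢
    have h0₁ : N₁.impedance ≠ 0 := by
      rintro h
      simp [h] at hZ0
    have h0₂ : N₂.impedance ≠ 0 := by
      rintro h
      simp [h] at hZ0
    obtain ⟨M₁, h₁, h₂, h₃⟩ := ih₁ h0₁
    obtain ⟨M₂, h₄, h₅, h₆⟩ := ih₂ h0₂
    refine ⟨.series M₁ M₂, add_le_add h₁ h₄, add_le_add h₂ h₅, ?_⟩
    simp only [SPNetwork.impedance, h₃, h₆]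
    rw [mul_div_add_eq_inv_add_inv h0₁ h0₂, inv_inv]

/-- Inversion and frequency inversion each swap the two kinds of reactive element, so their
composite preserves both counts. -/
theorem dualRat_mem_impedanceSet {m n : ℕ} {Z : RatFunc ℝ} (hZ : Z ∈ impedanceSet m n) :
    dualRat Z ∈ impedanceSet m n := by
  by_cases hZ0 : Z = 0
  · rw [hZ0, dualRat_zero]
    exact zero_mem_impedanceSet _ _
  · exact inv_mem_impedanceSet (frequencyInversion_mem_impedanceSet hZ)
      (frequencyInversion_ne_zero hZ0)

theorem dualRat_mem_impedanceSet_iff {m n : ℕ} {Z : RatFunc ℝ} :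
    dualRat Z ∈ impedanceSet m n ↔ Z ∈ impedanceSet m n :=
  ⟨fun h => by simpa using dualRat_mem_impedanceSet h, dualRat_mem_impedanceSet⟩

theorem frequencyInversion_mem_impedanceSet_iff {m n : ℕ} {Z : RatFunc ℝ} :
    frequencyInversion Z ∈ impedanceSet m n ↔ Z ∈ impedanceSet n m :=
  ⟨fun h => by simpa using frequencyInversion_mem_impedanceSet h,
    frequencyInversion_mem_impedanceSet⟩

theorem dualRat_C_add (r : ℝ) (Z : RatFunc ℝ) :
    dualRat (RatFunc.C r + Z) = ((dualRat Z)⁻¹ + RatFunc.C r)⁻¹ := by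
  simp [dualRat, add_comm]

/-! ### Splitting a network at its outermost reactive connection -/

/-- `Z` is realized with at most `m` capacitors and `n` inductors, but fewer than `m + n` of
them in total. -/
def IsLower (m n : ℕ) (Z : RatFunc ℝ) : Prop :=
  ∃ m' n' : ℕ, m' ≤ m ∧ n' ≤ n ∧ m' + n' < m + n ∧ Z ∈ impedanceSet m' n'

/-- `Z` is the impedance of a resistor in series with a parallel connection of two networks that
share `m` capacitors and `n` inductors, at least one each. -/
def IsParallelSplit (m n : ℕ) (Z : RatFunc ℝ) : Prop :=
  ∃ (m₁ n₁ m₂ n₂ : ℕ) (r : ℝ) (Z₁ Z₂ : RatFunc ℝ), m₁ + m₂ ≤ m ∧ n₁ + n₂ ≤ n ∧ 1 ≤ m₁ + n₁ ∧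
    1 ≤ m₂ + n₂ ∧ 0 ≤ r ∧ Z₁ ∈ impedanceSet m₁ n₁ ∧ Z₂ ∈ impedanceSet m₂ n₂ ∧ Z₁ ≠ 0 ∧ Z₂ ≠ 0 ∧
    Z = RatFunc.C r + (Z₁⁻¹ + Z₂⁻¹)⁻¹

theorem IsParallelSplit.C_add {m n : ℕ} {Z : RatFunc ℝ} (h : IsParallelSplit m n Z) {r : ℝ}
    (hr : 0 ≤ r) : IsParallelSplit m n (RatFunc.C r + Z) := by
  obtain ⟨m₁, n₁, m₂, n₂, r', Z₁, Z₂, h₁, h₂, h₃, h₄, h₅, h₆, h₇, h₈, h₉, rfl⟩ := h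
  exact ⟨m₁, n₁, m₂, n₂, r + r', Z₁, Z₂, h₁, h₂, h₃, h₄, add_nonneg hr h₅, h₆, h₇, h₈, h₉, by
    rw [map_add, add_assoc]⟩

/-- A conductance across a resistor in series with an admittance is traded for another series
resistor, a rescaled admittance and a conductance parallel to it. This keeps the shape of a split
when a resistor is connected in parallel. -/
theorem resistive_termination {K : Type*} [Field K] {r g Y : K} (hY : Y ≠ 0) (h₁ : 1 + g * r ≠ 0)
    (h₂ : 1 + r * Y ≠ 0) (h₃ : g + (1 + g * r) * Y ≠ 0) :
    ((r + Y⁻¹)⁻¹ + g)⁻¹ = r / (1 + g * r) + ((1 + g * r) ^ 2 * Y + g * (1 + g * r))⁻¹ := by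
  have e₁ : r + Y⁻¹ = (1 + r * Y) / Y := by field_simp; ring
  have e₂ : (r + Y⁻¹)⁻¹ + g = (g + (1 + g * r) * Y) / (1 + r * Y) := by
    rw [e₁]
    field_simp
    ring
  have e₃ : (1 + g * r) ^ 2 * Y + g * (1 + g * r) = (1 + g * r) * (g + (1 + g * r) * Y) := by ring
  rw [e₂, e₃]
  field_simp
  ring

theorem IsParallelSplit.parallel_C {m n : ℕ} {Z : RatFunc ℝ} (h : IsParallelSplit m n Z) {g : ℝ}
    (hg : 0 ≤ g) : IsParallelSplit m n (Z⁻¹ + RatFunc.C g)⁻¹ := by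
  obtain ⟨m₁, n₁, m₂, n₂, r, Z₁, Z₂, h₁, h₂, h₃, h₄, hr, h₆, h₇, h₈, h₉, rfl⟩ := h
  have ht : 0 < 1 + g * r := by positivity
  have hp₁ := isPosRat_of_mem_impedanceSet h₆ h₈
  have hp₂ := isPosRat_of_mem_impedanceSet h₇ h₉
  have hY := hp₁.inv.add hp₂.inv
  have ht' := IsPosRat.C ht
  have hone : IsPosRat (1 : RatFunc ℝ) := by simpa using IsPosRat.C one_pos
  have et : RatFunc.C (1 + g * r) = (1 + RatFunc.C g * RatFunc.C r : RatFunc ℝ) := by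
    rw [map_add, map_mul, map_one]
  set t := 1 + g * r with ht_def
  have hs : 0 < (t ^ 2)⁻¹ := by positivity
  -- The new admittance is `t² (Y₁ + Y₂) + g t`; the conductance `g t` is given to the first branch.
  refine ⟨m₁, n₁, m₂, n₂, r / t,
    ((RatFunc.C (t ^ 2)⁻¹ * Z₁)⁻¹ + RatFunc.C (g * t))⁻¹, RatFunc.C (t ^ 2)⁻¹ * Z₂,
    h₁, h₂, h₃, h₄, by positivity, ?_, C_mul_mem_impedanceSet h₇ hs, ?_, ?_, ?_⟩
  · exact parallel_C_mem_impedanceSet (C_mul_mem_impedanceSet h₆ hs)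
      ((IsPosRat.C hs).mul hp₁).ne_zero (by positivity)
  · rw [add_comm]
    exact (IsNonnegRat.add_pos (.C (by positivity)) ((IsPosRat.C hs).mul hp₁).inv).inv.ne_zero
  · exact ((IsPosRat.C hs).mul hp₂).ne_zero
  · rw [resistive_termination hY.ne_zero (by rw [← et]; exact ht'.ne_zero), ← et]
    · rw [map_div₀]
      congr 1
      simp only [map_mul, map_inv₀, map_pow, mul_inv, inv_inv]
      congr 1
      ring
    · rw [add_comm]
      exact (((IsNonnegRat.C hr).mul (Or.inr hY)).add_pos hone).ne_zero
    · rw [← et]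
      exact (IsNonnegRat.add_pos (.C hg) (ht'.mul hY)).ne_zero

theorem SPNetwork.exists_impedance_eq_C (N : SPNetwork) (hC : N.numCapacitors = 0)
    (hL : N.numInductors = 0) : ∃ r : ℝ, 0 ≤ r ∧ N.impedance = RatFunc.C r := by
  induction N with
  | resistor R hR => exact ⟨R, hR, rfl⟩
  | inductor L h => simp [numInductors] at hL
  | capacitor C h => simp [numCapacitors] at hC
  | series N₁ N₂ h₁ h₂ =>
    simp only [numCapacitors, numInductors, Nat.add_eq_zero_iff] at hC hL
    obtain ⟨r₁, hr₁, e₁⟩ := h₁ hC.1 hL.1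
    obtain ⟨r₂, hr₂, e₂⟩ := h₂ hC.2 hL.2
    exact ⟨r₁ + r₂, add_nonneg hr₁ hr₂, by simp only [impedance, e₁, e₂, map_add]⟩
  | parallel N₁ N₂ h₁ h₂ =>
    simp only [numCapacitors, numInductors, Nat.add_eq_zero_iff] at hC hL
    obtain ⟨r₁, hr₁, e₁⟩ := h₁ hC.1 hL.1
    obtain ⟨r₂, hr₂, e₂⟩ := h₂ hC.2 hL.2
    exact ⟨r₁ * r₂ / (r₁ + r₂), by positivity, by
      simp only [impedance, e₁, e₂, map_add, map_mul, map_div₀]⟩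

theorem IsLower.C_add {m n : ℕ} {Z : RatFunc ℝ} (h : IsLower m n Z) {r : ℝ} (hr : 0 ≤ r) :
    IsLower m n (RatFunc.C r + Z) := by
  obtain ⟨m', n', h₁, h₂, h₃, h₄⟩ := h
  exact ⟨m', n', h₁, h₂, h₃, C_add_mem_impedanceSet h₄ hr⟩

theorem IsLower.zero {m n : ℕ} (h : 0 < m + n) : IsLower m n 0 :=
  ⟨0, 0, Nat.zero_le _, Nat.zero_le _, h, zero_mem_impedanceSet _ _⟩

theorem IsLower.parallel_C {m n : ℕ} {Z : RatFunc ℝ} (h : IsLower m n Z) (h0 : Z ≠ 0) {g : ℝ}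
    (hg : 0 ≤ g) : IsLower m n (Z⁻¹ + RatFunc.C g)⁻¹ := by
  obtain ⟨m', n', h₁, h₂, h₃, h₄⟩ := h
  exact ⟨m', n', h₁, h₂, h₃, parallel_C_mem_impedanceSet h₄ h0 hg⟩

/-- Either fewer elements suffice for `Z`, or `Z` or its dual is split by a parallel connection. -/
def IsReducible (m n : ℕ) (Z : RatFunc ℝ) : Prop :=
  IsLower m n Z ∨ IsParallelSplit m n Z ∨ IsParallelSplit m n (dualRat Z)

theorem IsReducible.C_add {m n : ℕ} {Z : RatFunc ℝ} (h : IsReducible m n Z) {r : ℝ}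
    (hr : 0 ≤ r) : IsReducible m n (RatFunc.C r + Z) := by
  rcases h with h | h | h
  · exact Or.inl (h.C_add hr)
  · exact Or.inr (Or.inl (h.C_add hr))
  · refine Or.inr (Or.inr ?_)
    rw [dualRat_C_add]
    exact h.parallel_C hr

theorem IsReducible.parallel_C {m n : ℕ} {Z : RatFunc ℝ} (h : IsReducible m n Z) (h0 : Z ≠ 0)
    {g : ℝ} (hg : 0 ≤ g) : IsReducible m n (Z⁻¹ + RatFunc.C g)⁻¹ := by
  rcases h with h | h | h
  · exact Or.inl (h.parallel_C h0 hg)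
  · exact Or.inr (Or.inl (h.parallel_C hg))
  · refine Or.inr (Or.inr ?_)
    have : dualRat (Z⁻¹ + RatFunc.C g)⁻¹ = RatFunc.C g + dualRat Z := by
      simp [dualRat, add_comm]
    rw [this]
    exact h.C_add hg

theorem IsReducible.parallel_resistor {m n : ℕ} {Z : RatFunc ℝ} (h : IsReducible m n Z)
    (hmn : 0 < m + n) {r : ℝ} (hr : 0 ≤ r) :
    IsReducible m n (Z * RatFunc.C r / (Z + RatFunc.C r)) := by
  by_cases h0 : Z = 0
  · rw [h0, zero_mul, zero_div]
    exact Or.inl (IsLower.zero hmn)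
  rcases hr.eq_or_lt with rfl | hr
  · rw [map_zero, mul_zero, zero_div]
    exact Or.inl (IsLower.zero hmn)
  · rw [mul_div_add_eq_inv_add_inv h0 (RatFunc.C_ne_zero hr.ne'), ← map_inv₀]
    exact h.parallel_C h0 (inv_nonneg.2 hr.le)

/-- The dual of a series connection is a parallel connection of the duals, so it is a split with
series resistor `0`. -/
theorem isReducible_series {m₁ n₁ m₂ n₂ : ℕ} {Z₁ Z₂ : RatFunc ℝ} (h₁ : Z₁ ∈ impedanceSet m₁ n₁)
    (h₂ : Z₂ ∈ impedanceSet m₂ n₂) (hmn₁ : 1 ≤ m₁ + n₁) (hmn₂ : 1 ≤ m₂ + n₂) :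
    IsReducible (m₁ + m₂) (n₁ + n₂) (Z₁ + Z₂) := by
  by_cases h0₁ : Z₁ = 0
  · rw [h0₁, zero_add]
    exact Or.inl ⟨m₂, n₂, Nat.le_add_left _ _, Nat.le_add_left _ _, by lia, h₂⟩
  by_cases h0₂ : Z₂ = 0
  · rw [h0₂, add_zero]
    exact Or.inl ⟨m₁, n₁, Nat.le_add_right _ _, Nat.le_add_right _ _, by lia, h₁⟩
  refine Or.inr (Or.inr ⟨m₁, n₁, m₂, n₂, 0, dualRat Z₁, dualRat Z₂, le_rfl, le_rfl, hmn₁, hmn₂,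
    le_rfl, dualRat_mem_impedanceSet h₁, dualRat_mem_impedanceSet h₂, dualRat_ne_zero h0₁,
    dualRat_ne_zero h0₂, ?_⟩)
  simp [dualRat]

theorem isReducible_parallel {m₁ n₁ m₂ n₂ : ℕ} {Z₁ Z₂ : RatFunc ℝ} (h₁ : Z₁ ∈ impedanceSet m₁ n₁)
    (h₂ : Z₂ ∈ impedanceSet m₂ n₂) (hmn₁ : 1 ≤ m₁ + n₁) (hmn₂ : 1 ≤ m₂ + n₂) :
    IsReducible (m₁ + m₂) (n₁ + n₂) (Z₁ * Z₂ / (Z₁ + Z₂)) := by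
  by_cases h0₁ : Z₁ = 0
  · rw [h0₁, zero_mul, zero_div]
    exact Or.inl (IsLower.zero (by lia))
  by_cases h0₂ : Z₂ = 0
  · rw [h0₂, mul_zero, zero_div]
    exact Or.inl (IsLower.zero (by lia))
  refine Or.inr (Or.inl ⟨m₁, n₁, m₂, n₂, 0, Z₁, Z₂, le_rfl, le_rfl, hmn₁, hmn₂,
    le_rfl, h₁, h₂, h0₁, h0₂, ?_⟩)
  rw [mul_div_add_eq_inv_add_inv h0₁ h0₂, map_zero, zero_add]

theorem SPNetwork.impedance_mem (N : SPNetwork) :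
    N.impedance ∈ impedanceSet N.numCapacitors N.numInductors :=
  ⟨N, le_rfl, le_rfl, rfl⟩

theorem SPNetwork.isReducible_impedance (N : SPNetwork)
    (hN : 2 ≤ N.numCapacitors + N.numInductors) :
    IsReducible N.numCapacitors N.numInductors N.impedance := by
  induction N with
  | resistor R hR => simp [numCapacitors, numInductors] at hN
  | inductor L h => simp [numCapacitors, numInductors] at hN
  | capacitor C h => simp [numCapacitors, numInductors] at hN
  | series N₁ N₂ ih₁ ih₂ =>
    simp only [numCapacitors, numInductors, impedance] at hN ⊢
    by_cases h₁ : N₁.numCapacitors + N₁.numInductors = 0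
    · obtain ⟨hC, hL⟩ := Nat.add_eq_zero_iff.1 h₁
      obtain ⟨r, hr, e⟩ := N₁.exists_impedance_eq_C hC hL
      rw [hC, hL, zero_add, zero_add, e]
      exact (ih₂ (by lia)).C_add hr
    by_cases h₂ : N₂.numCapacitors + N₂.numInductors = 0
    · obtain ⟨hC, hL⟩ := Nat.add_eq_zero_iff.1 h₂
      obtain ⟨r, hr, e⟩ := N₂.exists_impedance_eq_C hC hL
      rw [hC, hL, add_zero, add_zero, e, add_comm]
      exact (ih₁ (by lia)).C_add hr
    exact isReducible_series N₁.impedance_mem N₂.impedance_mem (by lia) (by lia)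
  | parallel N₁ N₂ ih₁ ih₂ =>
    simp only [numCapacitors, numInductors, impedance] at hN ⊢
    by_cases h₁ : N₁.numCapacitors + N₁.numInductors = 0
    · obtain ⟨hC, hL⟩ := Nat.add_eq_zero_iff.1 h₁
      obtain ⟨r, hr, e⟩ := N₁.exists_impedance_eq_C hC hL
      rw [hC, hL, zero_add, zero_add, e, mul_comm, add_comm]
      exact (ih₂ (by lia)).parallel_resistor (by lia) hr
    by_cases h₂ : N₂.numCapacitors + N₂.numInductors = 0
    · obtain ⟨hC, hL⟩ := Nat.add_eq_zero_iff.1 h₂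
      obtain ⟨r, hr, e⟩ := N₂.exists_impedance_eq_C hC hL
      rw [hC, hL, add_zero, add_zero, e]
      exact (ih₁ (by lia)).parallel_resistor (by lia) hr
    exact isReducible_parallel N₁.impedance_mem N₂.impedance_mem (by lia) (by lia)

/-- Every member of `𝒵_{m,n}` with `m + n ≥ 2` is reducible. -/
theorem isReducible_of_mem_impedanceSet {m n : ℕ} (hmn : 2 ≤ m + n) {Z : RatFunc ℝ}
    (hZ : Z ∈ impedanceSet m n) : IsReducible m n Z := by
  obtain ⟨N, h₁, h₂, rfl⟩ := hZ
  by_cases h : N.numCapacitors + N.numInductors < m + n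
  · exact Or.inl ⟨_, _, h₁, h₂, h, N.impedance_mem⟩
  · obtain rfl : N.numCapacitors = m := by lia
    obtain rfl : N.numInductors = n := by lia
    exact N.isReducible_impedance hmn

/-! ### Bilinear impedances: one reactive element -/

/-- The polynomial `A s + B` as a rational function. -/
noncomputable def linRat (A B : ℝ) : RatFunc ℝ := RatFunc.C A * RatFunc.X + RatFunc.C B

theorem isPosRat_linRat {A B : ℝ} (hA : 0 ≤ A) (hB : 0 ≤ B) (h : A ≠ 0 ∨ B ≠ 0) :
    IsPosRat (linRat A B) := by
  unfold linRat
  by_cases hB0 : B = 0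
  · rw [hB0, map_zero, add_zero]
    exact (IsPosRat.C (hA.lt_of_ne' (h.resolve_right (not_not.2 hB0)))).mul IsPosRat.X
  · exact ((IsNonnegRat.C hA).mul (Or.inr IsPosRat.X)).add_pos (IsPosRat.C (hB.lt_of_ne' hB0))

theorem linRat_ne_zero {A B : ℝ} (hA : 0 ≤ A) (hB : 0 ≤ B) (h : A ≠ 0 ∨ B ≠ 0) :
    linRat A B ≠ 0 := (isPosRat_linRat hA hB h).ne_zero

theorem frequencyInversion_linRat (A B : ℝ) :
    frequencyInversion (linRat A B) = linRat B A / RatFunc.X := by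
  have := RatFunc.X_ne_zero (K := ℝ)
  simp only [linRat, map_add, map_mul, frequencyInversion_C, frequencyInversion_X]
  field_simp
  ring

theorem frequencyInversion_linRat_div (A B C D : ℝ) :
    frequencyInversion (linRat A B / linRat C D) = linRat B A / linRat D C := by
  rw [map_div₀, frequencyInversion_linRat, frequencyInversion_linRat,
    div_div_div_cancel_right₀ RatFunc.X_ne_zero]

/-- Removing the resistance `B / D` at `s = 0` leaves an inductor shunted by a conductance. The
inductance is a positive multiple of the determinant `A D - B C`, whence the sign condition. -/
theorem linRat_div_mem_zero_one {A B C D : ℝ} (hA : 0 ≤ A) (hB : 0 ≤ B) (hC : 0 ≤ C)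
    (hD : 0 ≤ D) (h : B * C ≤ A * D) : linRat A B / linRat C D ∈ impedanceSet 0 1 := by
  -- For `C = D = 0` the quotient is `0` by convention; for `D = 0 < C` the inequality forces `B =
  -- 0` and the quotient is constant.
  rcases hD.eq_or_lt with rfl | hD
  · rcases hC.eq_or_lt with rfl | hC
    · simpa [linRat] using zero_mem_impedanceSet 0 1
    · obtain rfl : B = 0 := by nlinarith
      have e : linRat A 0 / linRat C 0 = RatFunc.C (A / C) := by
        simp only [linRat, map_zero, add_zero, map_div₀]
        exact mul_div_mul_right _ _ RatFunc.X_ne_zero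
      rw [e]
      exact C_mem_impedanceSet (by positivity) _ _
  have hX := RatFunc.X_ne_zero (K := ℝ)
  have hCD := linRat_ne_zero hC hD.le (Or.inr hD.ne')
  have hD' := RatFunc.C_ne_zero hD.ne'
  rcases h.eq_or_lt with h | h
  · have e : linRat A B / linRat C D = RatFunc.C (B / D) := by
      have h' : RatFunc.C B * RatFunc.C C = (RatFunc.C A * RatFunc.C D : RatFunc ℝ) := by
        rw [← map_mul, ← map_mul, h]
      rw [map_div₀, div_eq_div_iff hCD hD']
      simp only [linRat]
      linear_combination -RatFunc.X * h'
    rw [e]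
    exact C_mem_impedanceSet (by positivity) _ _
  have hE : 0 < A * D - B * C := sub_pos.2 h
  have hL : RatFunc.C ((A * D - B * C) / D ^ 2) * RatFunc.X ∈ impedanceSet 0 1 :=
    ⟨.inductor ((A * D - B * C) / D ^ 2) (by positivity), le_rfl, le_rfl, rfl⟩
  have hE' := RatFunc.C_ne_zero hE.ne'
  have e : linRat A B / linRat C D = RatFunc.C (B / D) +
      ((RatFunc.C ((A * D - B * C) / D ^ 2) * RatFunc.X)⁻¹ +
        RatFunc.C (C * D / (A * D - B * C)))⁻¹ := by
    have e₁ : (RatFunc.C ((A * D - B * C) / D ^ 2) * RatFunc.X)⁻¹ +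
        RatFunc.C (C * D / (A * D - B * C)) =
        RatFunc.C D * linRat C D / (RatFunc.C (A * D - B * C) * RatFunc.X) := by
      simp only [map_div₀, map_mul, map_pow, linRat]
      field_simp
      ring
    rw [e₁, inv_div, map_div₀, div_add_div _ _ hD' (mul_ne_zero hD' hCD),
      div_eq_div_iff hCD (mul_ne_zero hD' (mul_ne_zero hD' hCD))]
    simp only [map_sub, map_mul, linRat]
    ring
  rw [e]
  exact C_add_mem_impedanceSet (parallel_C_mem_impedanceSet hL
    (mul_ne_zero (RatFunc.C_ne_zero (by positivity)) hX) (by positivity)) (by positivity)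

theorem linRat_div_mem_one_zero {A B C D : ℝ} (hA : 0 ≤ A) (hB : 0 ≤ B) (hC : 0 ≤ C)
    (hD : 0 ≤ D) (h : A * D ≤ B * C) : linRat A B / linRat C D ∈ impedanceSet 1 0 := by
  rw [← frequencyInversion_mem_impedanceSet_iff, frequencyInversion_linRat_div]
  exact linRat_div_mem_zero_one hB hA hD hC h

/-- With only one inductor available, one branch of every connection is purely resistive. It
therefore suffices that the form survives a resistor in series or in parallel. -/
theorem exists_linRat_div_of_mem_zero_one {Z : RatFunc ℝ} (hZ : Z ∈ impedanceSet 0 1) :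
    ∃ A B C D : ℝ, 0 ≤ A ∧ 0 ≤ B ∧ 0 ≤ C ∧ 0 ≤ D ∧ (C ≠ 0 ∨ D ≠ 0) ∧ B * C ≤ A * D ∧
      Z = linRat A B / linRat C D := by
  obtain ⟨N, h₁, h₂, rfl⟩ := hZ
  have series_C : ∀ (Z : RatFunc ℝ) (r : ℝ), 0 ≤ r → (∃ A B C D : ℝ, 0 ≤ A ∧ 0 ≤ B ∧ 0 ≤ C ∧
      0 ≤ D ∧ (C ≠ 0 ∨ D ≠ 0) ∧ B * C ≤ A * D ∧ Z = linRat A B / linRat C D) →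
      (∃ A B C D : ℝ, 0 ≤ A ∧ 0 ≤ B ∧ 0 ≤ C ∧ 0 ≤ D ∧ (C ≠ 0 ∨ D ≠ 0) ∧ B * C ≤ A * D ∧
      Z + RatFunc.C r = linRat A B / linRat C D) := by
    rintro Z r hr ⟨A, B, C, D, hA, hB, hC, hD, hCD, h, rfl⟩
    refine ⟨A + r * C, B + r * D, C, D, by positivity, by positivity, hC, hD, hCD, by nlinarith, ?_⟩
    have := linRat_ne_zero hC hD hCD
    rw [div_add' _ _ _ this]
    simp only [linRat, map_add, map_mul]
    ring
  have parallel_C : ∀ (Z : RatFunc ℝ) (r : ℝ), 0 ≤ r → (∃ A B C D : ℝ, 0 ≤ A ∧ 0 ≤ B ∧ 0 ≤ C ∧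
      0 ≤ D ∧ (C ≠ 0 ∨ D ≠ 0) ∧ B * C ≤ A * D ∧ Z = linRat A B / linRat C D) →
      (∃ A B C D : ℝ, 0 ≤ A ∧ 0 ≤ B ∧ 0 ≤ C ∧ 0 ≤ D ∧ (C ≠ 0 ∨ D ≠ 0) ∧ B * C ≤ A * D ∧
      Z * RatFunc.C r / (Z + RatFunc.C r) = linRat A B / linRat C D) := by
    rintro Z r hr ⟨A, B, C, D, hA, hB, hC, hD, hCD, h, rfl⟩
    rcases hr.eq_or_lt with rfl | hr
    · exact ⟨0, 0, 0, 1, le_rfl, le_rfl, le_rfl, zero_le_one, by simp, by simp, by simp [linRat]⟩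
    have hCD' := linRat_ne_zero hC hD hCD
    have hne : A + r * C ≠ 0 ∨ B + r * D ≠ 0 := by
      rcases hCD with h | h
      · exact Or.inl (by positivity)
      · exact Or.inr (by positivity)
    have hne' := linRat_ne_zero (A := A + r * C) (B := B + r * D) (by positivity) (by positivity)
      hne
    refine ⟨r * A, r * B, A + r * C, B + r * D, by positivity, by positivity, by positivity,
      by positivity, hne, by nlinarith [mul_pos hr hr], ?_⟩
    have e : linRat A B / linRat C D + RatFunc.C r =
        linRat (A + r * C) (B + r * D) / linRat C D := by
      rw [div_add' _ _ _ hCD']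
      simp only [linRat, map_add, map_mul]
      ring
    rw [e, div_mul_eq_mul_div, div_div_div_cancel_right₀ hCD']
    simp only [linRat, map_mul]
    ring
  induction N with
  | resistor R hR =>
    exact ⟨0, R, 0, 1, le_rfl, hR, le_rfl, zero_le_one, by simp, by simp,
      by simp [linRat, SPNetwork.impedance]⟩
  | inductor L hL =>
    exact ⟨L, 0, 0, 1, hL.le, le_rfl, le_rfl, zero_le_one, by simp, by simpa using hL.le,
      by simp [linRat, SPNetwork.impedance]⟩
  | capacitor C h => simp [SPNetwork.numCapacitors] at h₁
  | series N₁ N₂ ih₁ ih₂ =>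
    simp only [SPNetwork.numCapacitors, SPNetwork.numInductors] at h₁ h₂
    simp only [SPNetwork.impedance]
    by_cases h : N₂.numInductors = 0
    · obtain ⟨r, hr, e⟩ := N₂.exists_impedance_eq_C (by lia) h
      rw [e]
      exact series_C _ _ hr (ih₁ (by lia) (by lia))
    · obtain ⟨r, hr, e⟩ := N₁.exists_impedance_eq_C (by lia) (by lia)
      rw [e, add_comm]
      exact series_C _ _ hr (ih₂ (by lia) (by lia))
  | parallel N₁ N₂ ih₁ ih₂ =>
    simp only [SPNetwork.numCapacitors, SPNetwork.numInductors] at h₁ h₂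
    simp only [SPNetwork.impedance]
    by_cases h : N₂.numInductors = 0
    · obtain ⟨r, hr, e⟩ := N₂.exists_impedance_eq_C (by lia) h
      rw [e]
      exact parallel_C _ _ hr (ih₁ (by lia) (by lia))
    · obtain ⟨r, hr, e⟩ := N₁.exists_impedance_eq_C (by lia) (by lia)
      rw [e, add_comm, mul_comm]
      exact parallel_C _ _ hr (ih₂ (by lia) (by lia))

/-- The partial fraction of the admittance, with pole at `-B / A`. If `A = 0`, then `B C ≤ 0` forces
`C = 0`, the impedance is constant and `k = 0` serves. -/
theorem inv_eq_of_mem_zero_one {Z : RatFunc ℝ} (hZ : Z ∈ impedanceSet 0 1) (hZ0 : Z ≠ 0) :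
    ∃ g k p : ℝ, 0 ≤ g ∧ 0 ≤ k ∧ 0 ≤ p ∧
      Z⁻¹ = RatFunc.C g + RatFunc.C k / (RatFunc.X + RatFunc.C p) := by
  obtain ⟨A, B, C, D, hA, hB, hC, hD, hCD, h, rfl⟩ := exists_linRat_div_of_mem_zero_one hZ
  rcases hA.eq_or_lt with rfl | hA
  · have hB' : B ≠ 0 := by
      rintro rfl
      simp [linRat] at hZ0
    have hBpos := hB.lt_of_ne' hB'
    obtain rfl : C = 0 := by nlinarith
    refine ⟨D / B, 0, 0, by positivity, le_rfl, le_rfl, ?_⟩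
    simp [linRat]
  · refine ⟨C / A, (A * D - B * C) / A ^ 2, B / A, by positivity,
      div_nonneg (sub_nonneg.2 h) (by positivity), by positivity, ?_⟩
    have hA' := RatFunc.C_ne_zero hA.ne'
    have hAB := linRat_ne_zero hA.le hB (Or.inl hA.ne')
    have e : RatFunc.X + RatFunc.C (B / A) = linRat A B / RatFunc.C A := by
      simp only [linRat, map_div₀]
      field_simp
    rw [e, inv_div]
    simp only [map_div₀, map_sub, map_mul, map_pow]
    field_simp
    simp only [linRat]
    ring

theorem inv_eq_of_mem_one_zero {Z : RatFunc ℝ} (hZ : Z ∈ impedanceSet 1 0) (hZ0 : Z ≠ 0) :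
    ∃ g k p : ℝ, 0 ≤ g ∧ 0 ≤ k ∧ 0 ≤ p ∧
      Z⁻¹ = RatFunc.C g + RatFunc.C k * RatFunc.X / (RatFunc.C p * RatFunc.X + 1) := by
  obtain ⟨g, k, p, hg, hk, hp, e⟩ := inv_eq_of_mem_zero_one
    (frequencyInversion_mem_impedanceSet hZ) (frequencyInversion_ne_zero hZ0)
  refine ⟨g, k, p, hg, hk, hp, ?_⟩
  have e' := congrArg frequencyInversion e
  rw [map_inv₀, frequencyInversion_frequencyInversion] at e'
  have hX := RatFunc.X_ne_zero (K := ℝ)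
  rw [e']
  simp only [map_add, map_div₀, frequencyInversion_C, frequencyInversion_X]
  congr 1
  have h1 : (RatFunc.X⁻¹ + RatFunc.C p : RatFunc ℝ) =
      (RatFunc.C p * RatFunc.X + 1) / RatFunc.X := by
    field_simp
    ring
  rw [h1, div_div_eq_mul_div]

/-! ### Quadratic polynomials, resultants and extraction of an inductor -/

namespace Quad

theorem isPosRat_toRatFunc {p : Quad} (hp : p.Nonneg) (h : p.c₂ ≠ 0 ∨ p.c₁ ≠ 0 ∨ p.c₀ ≠ 0) :
    IsPosRat p.toRatFunc := by
  obtain ⟨h₀, h₁, h₂⟩ := hp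
  unfold toRatFunc
  have hX2 : IsPosRat (RatFunc.X ^ 2 : RatFunc ℝ) := by
    rw [pow_two]
    exact IsPosRat.X.mul IsPosRat.X
  by_cases h2 : p.c₂ = 0
  · rw [h2, map_zero, zero_mul, zero_add]
    exact isPosRat_linRat h₁ h₀ (h.resolve_left (not_not.2 h2))
  · rw [add_assoc, add_comm]
    exact (((IsNonnegRat.C h₁).mul (Or.inr IsPosRat.X)).add (IsNonnegRat.C h₀)).add_pos
      ((IsPosRat.C (h₂.lt_of_ne' h2)).mul hX2)

theorem frequencyInversion_toRatFunc (p : Quad) :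
    frequencyInversion p.toRatFunc = p.reverse.toRatFunc / RatFunc.X ^ 2 := by
  have := RatFunc.X_ne_zero (K := ℝ)
  simp only [toRatFunc, reverse, map_add, map_mul, map_pow, frequencyInversion_C,
    frequencyInversion_X]
  field_simp
  ring

theorem frequencyInversion_toRatFunc_div (p q : Quad) :
    frequencyInversion (p.toRatFunc / q.toRatFunc) =
      p.reverse.toRatFunc / q.reverse.toRatFunc := by
  rw [map_div₀, frequencyInversion_toRatFunc, frequencyInversion_toRatFunc,
    div_div_div_cancel_right₀ (pow_ne_zero 2 RatFunc.X_ne_zero)]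

theorem dualRat_toRatFunc_div (p q : Quad) :
    dualRat (p.toRatFunc / q.toRatFunc) = q.reverse.toRatFunc / p.reverse.toRatFunc := by
  rw [dualRat, frequencyInversion_toRatFunc_div, inv_div]

theorem Nonneg.reverse {p : Quad} (hp : p.Nonneg) : p.reverse.Nonneg :=
  ⟨hp.2.2, hp.2.1, hp.1⟩

@[simp]
theorem reverse_reverse (p : Quad) : p.reverse.reverse = p := rfl

end Quad

/-- `α₂² - α₁ α₃`, up to sign the resultant of `c` and `d`. -/
def quadResultant (c d : Quad) : ℝ := alpha₂ c d ^ 2 - alpha₁ c d * alpha₃ c d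

theorem sylvesterR0_eq (a b : Quad) : sylvesterR0 a b = -quadResultant a b := by
  simp [sylvesterR0, Matrix.det_succ_row_zero, Fin.sum_univ_succ, quadResultant, alpha₁, alpha₂,
    alpha₃, Fin.succAbove, Matrix.submatrix]
  ring

theorem quadResultant_reverse (c d : Quad) :
    quadResultant c.reverse d.reverse = quadResultant c d := by
  simp only [quadResultant, alpha₁, alpha₂, alpha₃, Quad.reverse]
  ring

theorem quadResultant_dual (c d : Quad) :
    quadResultant d.reverse c.reverse = quadResultant c d := by
  simp only [quadResultant, alpha₁, alpha₂, alpha₃, Quad.reverse]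
  ring

theorem left_ne_zero_of_quadResultant {c d : Quad} (h : quadResultant c d ≠ 0) :
    c.c₂ ≠ 0 ∨ c.c₁ ≠ 0 ∨ c.c₀ ≠ 0 := by
  by_contra! h'
  exact h (by simp [quadResultant, alpha₁, alpha₂, alpha₃, h'])

theorem right_ne_zero_of_quadResultant {c d : Quad} (h : quadResultant c d ≠ 0) :
    d.c₂ ≠ 0 ∨ d.c₁ ≠ 0 ∨ d.c₀ ≠ 0 := by
  by_contra! h'
  exact h (by simp [quadResultant, alpha₁, alpha₂, alpha₃, h'])

/-- If `d₀ = 0`, the inequalities annihilate `c₀ d₁` and `c₀ d₂`. If `α₁ ≤ 0`, both terms of `λ₁`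
are non-positive and hence vanish. Either way the resultant would be zero. The two strict signs make
the extracted inductor meaningful. -/
theorem lambda₁_pos_aux {c d : Quad} (hc : c.Nonneg) (hd : d.Nonneg)
    (hR : quadResultant c d ≠ 0) (h₂ : 0 ≤ alpha₂ c d) (hl : 0 ≤ lambda₁ c d) :
    0 < d.c₀ ∧ 0 < alpha₁ c d := by
  obtain ⟨c₂, c₁, c₀⟩ := c
  obtain ⟨d₂, d₁, d₀⟩ := d
  obtain ⟨hc₀, hc₁, hc₂⟩ := hc
  obtain ⟨hd₀, hd₁, hd₂⟩ := hd
  simp only [lambda₁, quadResultant, alpha₁, alpha₂, alpha₃] at *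
  have h0 : 0 < d₀ := by
    rcases hd₀.eq_or_lt with rfl | h
    · exfalso
      apply hR
      have h1 : c₀ * d₂ = 0 := le_antisymm (by linarith) (mul_nonneg hc₀ hd₂)
      have h2 : c₀ * d₁ * d₁ = 0 := le_antisymm (by linarith)
        (mul_nonneg (mul_nonneg hc₀ hd₁) hd₁)
      have h3 : c₀ * d₁ = 0 := by
        rcases mul_eq_zero.1 h2 with h | h
        · exact h
        · rw [h, mul_zero]
      linear_combination (c₀ * d₂) * h1 + (c₂ * d₁ - c₁ * d₂) * h3
    · exact h
  refine ⟨h0, ?_⟩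
  by_contra! ha
  have h1 : d₁ * (c₁ * d₀ - c₀ * d₁) ≤ 0 := mul_nonpos_of_nonneg_of_nonpos hd₁ ha
  have h2 : 0 ≤ d₀ * (c₂ * d₀ - c₀ * d₂) := mul_nonneg h0.le h₂
  have h3 : d₀ * (c₂ * d₀ - c₀ * d₂) = 0 := by linarith
  have h4 : d₁ * (c₁ * d₀ - c₀ * d₁) = 0 := by linarith
  have h5 := (mul_eq_zero.1 h3).resolve_left h0.ne'
  rw [h5] at hR
  rcases mul_eq_zero.1 h4 with h | h
  · subst h
    have : c₁ * d₀ = 0 := le_antisymm (by linarith) (mul_nonneg hc₁ h0.le)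
    apply hR
    rw [mul_zero, this]
    ring
  · rw [h] at hR
    apply hR
    ring

/-- The resistance `c₀ / d₀` at `s = 0` is removed first; the inverse of the rest has a pole at `s =
0`, which is removed as a parallel inductor. What remains is bilinear. -/
theorem lambda₁_expansion {K : Type*} [Field K] {c₂ c₁ c₀ d₂ d₁ d₀ s α₁ α₂ l : K}
    (hα₁ : α₁ = c₁ * d₀ - c₀ * d₁) (hα₂ : α₂ = c₂ * d₀ - c₀ * d₂) (hl : l = d₁ * α₁ - d₀ * α₂)
    (hs : s ≠ 0) (hd₀ : d₀ ≠ 0) (h₁ : α₁ ≠ 0) (hd : d₂ * s ^ 2 + d₁ * s + d₀ ≠ 0)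
    (h₂ : α₂ * s + α₁ ≠ 0) :
    (c₂ * s ^ 2 + c₁ * s + c₀) / (d₂ * s ^ 2 + d₁ * s + d₀) =
      c₀ / d₀ + ((α₁ / d₀ ^ 2 * s)⁻¹ +
        (d₀ * α₁ * d₂ * s + d₀ * l) / (α₁ * α₂ * s + α₁ ^ 2))⁻¹ := by
  have e₀ : α₁ * α₂ * s + α₁ ^ 2 = α₁ * (α₂ * s + α₁) := by ring
  have e₁ : (α₁ / d₀ ^ 2 * s)⁻¹ + (d₀ * α₁ * d₂ * s + d₀ * l) / (α₁ * α₂ * s + α₁ ^ 2) =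
      d₀ * (d₂ * s ^ 2 + d₁ * s + d₀) / (s * (α₂ * s + α₁)) := by
    rw [e₀, hl]
    obtain ⟨u, hu⟩ : ∃ u, u = α₂ * s + α₁ := ⟨_, rfl⟩
    rw [← hu] at h₂ ⊢
    field_simp
    rw [hu]
    ring
  rw [e₁, inv_div, div_add_div _ _ hd₀ (mul_ne_zero hd₀ hd), div_eq_div_iff hd
    (mul_ne_zero hd₀ (mul_ne_zero hd₀ hd)), hα₁, hα₂]
  ring

theorem quad_div_mem_of_lambda₁ {c d : Quad} {m n : ℕ} (hc : c.Nonneg) (hd : d.Nonneg)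
    (hR : quadResultant c d ≠ 0) (h₂ : 0 ≤ alpha₂ c d) (hl : 0 ≤ lambda₁ c d)
    (hmem : linRat (alpha₁ c d * alpha₂ c d) (alpha₁ c d ^ 2) /
      linRat (d.c₀ * alpha₁ c d * d.c₂) (d.c₀ * lambda₁ c d) ∈ impedanceSet m n) :
    c.toRatFunc / d.toRatFunc ∈ impedanceSet m (n + 1) := by
  obtain ⟨hd₀, h₁⟩ := lambda₁_pos_aux hc hd hR h₂ hl
  have hdp := (d.isPosRat_toRatFunc hd (right_ne_zero_of_quadResultant hR)).ne_zero
  have hlin := linRat_ne_zero h₂ h₁.le (Or.inr h₁.ne')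
  have e := lambda₁_expansion (K := RatFunc ℝ) (c₂ := RatFunc.C c.c₂) (c₁ := RatFunc.C c.c₁)
    (c₀ := RatFunc.C c.c₀) (d₂ := RatFunc.C d.c₂) (d₁ := RatFunc.C d.c₁) (d₀ := RatFunc.C d.c₀)
    (s := RatFunc.X) (α₁ := RatFunc.C (alpha₁ c d)) (α₂ := RatFunc.C (alpha₂ c d))
    (l := RatFunc.C (lambda₁ c d)) (by simp [alpha₁]) (by simp [alpha₂]) (by simp [lambda₁])
    RatFunc.X_ne_zero (RatFunc.C_ne_zero hd₀.ne') (RatFunc.C_ne_zero h₁.ne') hdp hlin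
  have hL : RatFunc.C (alpha₁ c d / d.c₀ ^ 2) * RatFunc.X ∈ impedanceSet 0 1 :=
    ⟨.inductor _ (by positivity), le_rfl, le_rfl, rfl⟩
  have hL0 : RatFunc.C (alpha₁ c d / d.c₀ ^ 2) * RatFunc.X ≠ (0 : RatFunc ℝ) :=
    mul_ne_zero (RatFunc.C_ne_zero (by positivity)) RatFunc.X_ne_zero
  have e' : c.toRatFunc / d.toRatFunc = RatFunc.C (c.c₀ / d.c₀) +
      ((RatFunc.C (alpha₁ c d / d.c₀ ^ 2) * RatFunc.X)⁻¹ +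
      (linRat (alpha₁ c d * alpha₂ c d) (alpha₁ c d ^ 2) /
        linRat (d.c₀ * alpha₁ c d * d.c₂) (d.c₀ * lambda₁ c d))⁻¹)⁻¹ := by
    rw [inv_div (linRat (alpha₁ c d * alpha₂ c d) _)]
    simp only [Quad.toRatFunc, linRat, map_div₀, map_mul, map_pow]
    exact e
  rw [e']
  refine C_add_mem_impedanceSet ?_ (div_nonneg hc.1 hd₀.le)
  -- A zero denominator means that the remaining branch is an open circuit, with admittance `0`; the
  -- inductor is then alone.
  by_cases h0 : linRat (d.c₀ * alpha₁ c d * d.c₂) (d.c₀ * lambda₁ c d) = 0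
  · rw [h0, div_zero, inv_zero, add_zero, inv_inv]
    exact impedanceSet_mono (Nat.zero_le _) (Nat.le_add_left _ _) hL
  · have := parallel_mem_impedanceSet hmem hL (div_ne_zero (linRat_ne_zero
      (mul_nonneg h₁.le h₂) (sq_nonneg _) (Or.inr (by positivity))) h0) hL0
    rwa [add_comm (_ ⁻¹)]

/-- The determinant of the bilinear remainder is, up to a positive factor, minus the resultant. A
positive resultant makes the remainder capacitive; a negative one makes it inductive, as used for
`𝒵_{0,2}` below. -/
theorem quad_div_mem_one_one_of_lambda₁ {c d : Quad} (hc : c.Nonneg) (hd : d.Nonneg)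
    (hR : 0 < quadResultant c d) (h₂ : 0 ≤ alpha₂ c d) (hl : 0 ≤ lambda₁ c d) :
    c.toRatFunc / d.toRatFunc ∈ impedanceSet 1 1 := by
  obtain ⟨hd₀, h₁⟩ := lambda₁_pos_aux hc hd hR.ne' h₂ hl
  refine quad_div_mem_of_lambda₁ (n := 0) hc hd hR.ne' h₂ hl (linRat_div_mem_one_zero
    (mul_nonneg h₁.le h₂) (sq_nonneg _) (mul_nonneg (mul_nonneg hd₀.le h₁.le) hd.2.2)
    (mul_nonneg hd₀.le hl) ?_)
  have : alpha₁ c d ^ 2 * (d.c₀ * alpha₁ c d * d.c₂) -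
      alpha₁ c d * alpha₂ c d * (d.c₀ * lambda₁ c d) =
      alpha₁ c d * d.c₀ ^ 2 * quadResultant c d := by
    simp only [quadResultant, lambda₁, alpha₁, alpha₂, alpha₃]
    ring
  have h3 := mul_nonneg (mul_nonneg h₁.le (sq_nonneg d.c₀)) hR.le
  linarith

theorem quad_div_mem_zero_two_of_lambda₁ {c d : Quad} (hc : c.Nonneg) (hd : d.Nonneg)
    (hR : quadResultant c d < 0) (h₂ : 0 ≤ alpha₂ c d) (hl : 0 ≤ lambda₁ c d) :
    c.toRatFunc / d.toRatFunc ∈ impedanceSet 0 2 := by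
  obtain ⟨hd₀, h₁⟩ := lambda₁_pos_aux hc hd hR.ne h₂ hl
  refine quad_div_mem_of_lambda₁ (n := 1) hc hd hR.ne h₂ hl (linRat_div_mem_zero_one
    (mul_nonneg h₁.le h₂) (sq_nonneg _) (mul_nonneg (mul_nonneg hd₀.le h₁.le) hd.2.2)
    (mul_nonneg hd₀.le hl) ?_)
  have : alpha₁ c d ^ 2 * (d.c₀ * alpha₁ c d * d.c₂) -
      alpha₁ c d * alpha₂ c d * (d.c₀ * lambda₁ c d) =
      alpha₁ c d * d.c₀ ^ 2 * quadResultant c d := by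
    simp only [quadResultant, lambda₁, alpha₁, alpha₂, alpha₃]
    ring
  have h3 := mul_nonneg (mul_nonneg h₁.le (sq_nonneg d.c₀)) (neg_nonneg.2 hR.le)
  linarith

/-- The sign conditions that characterize `c / d ∈ 𝒵_{1,1}` for coprime `c` and `d`. -/
def IsRegularPair (c d : Quad) : Prop :=
  0 < quadResultant c d ∧
    ((0 ≤ alpha₂ c d ∧ 0 ≤ lambda₁ c d) ∨ (alpha₂ c d ≤ 0 ∧ 0 ≤ lambda₃ c d) ∨
     (alpha₂ c d ≤ 0 ∧ 0 ≤ lambda₄ c d) ∨ (0 ≤ alpha₂ c d ∧ 0 ≤ lambda₂ c d))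

theorem quad_div_mem_one_one_of_lambda₃ {c d : Quad} (hc : c.Nonneg) (hd : d.Nonneg)
    (hR : 0 < quadResultant c d) (h₂ : alpha₂ c d ≤ 0) (hl : 0 ≤ lambda₃ c d) :
    c.toRatFunc / d.toRatFunc ∈ impedanceSet 1 1 := by
  rw [← frequencyInversion_mem_impedanceSet_iff, Quad.frequencyInversion_toRatFunc_div]
  refine quad_div_mem_one_one_of_lambda₁ hc.reverse hd.reverse
    (by rwa [quadResultant_reverse]) ?_ ?_
  · simp only [alpha₂, Quad.reverse] at *
    linarith
  · simp only [lambda₁, lambda₃, alpha₁, alpha₂, alpha₃, Quad.reverse] at *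
    linarith

/-- Frequency inversion exchanges `λ₁` with `λ₃` and negates `α₂`; duality exchanges `λ₁` with `λ₂`
and `λ₃` with `λ₄` and keeps `α₂`. One extraction thus covers all four cases. -/
theorem IsRegularPair.quad_div_mem {c d : Quad} (h : IsRegularPair c d) (hc : c.Nonneg)
    (hd : d.Nonneg) :
    c.toRatFunc / d.toRatFunc ∈ impedanceSet 1 1 := by
  obtain ⟨hR, ⟨h₂, hl⟩ | ⟨h₂, hl⟩ | ⟨h₂, hl⟩ | ⟨h₂, hl⟩⟩ := h
  · exact quad_div_mem_one_one_of_lambda₁ hc hd hR h₂ hl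
  · exact quad_div_mem_one_one_of_lambda₃ hc hd hR h₂ hl
  · rw [← dualRat_mem_impedanceSet_iff, Quad.dualRat_toRatFunc_div]
    refine quad_div_mem_one_one_of_lambda₃ hd.reverse hc.reverse (by rwa [quadResultant_dual]) ?_ ?_
    · simp only [alpha₂, Quad.reverse] at *
      linarith
    · simp only [lambda₃, lambda₄, alpha₁, alpha₂, alpha₃, Quad.reverse] at *
      linarith
  · rw [← dualRat_mem_impedanceSet_iff, Quad.dualRat_toRatFunc_div]
    refine quad_div_mem_one_one_of_lambda₁ hd.reverse hc.reverse (by rwa [quadResultant_dual]) ?_ ?_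
    · simp only [alpha₂, Quad.reverse] at *
      linarith
    · simp only [lambda₁, lambda₂, alpha₁, alpha₂, alpha₃, Quad.reverse] at *
      linarith

/-! ### Normal forms of networks with two reactive elements -/

theorem IsParallelSplit.one_one {Z : RatFunc ℝ} (h : IsParallelSplit 1 1 Z) :
    ∃ (r : ℝ) (Z₁ Z₂ : RatFunc ℝ), 0 ≤ r ∧ Z₁ ∈ impedanceSet 0 1 ∧ Z₂ ∈ impedanceSet 1 0 ∧
      Z₁ ≠ 0 ∧ Z₂ ≠ 0 ∧ Z = RatFunc.C r + (Z₁⁻¹ + Z₂⁻¹)⁻¹ := by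
  obtain ⟨m₁, n₁, m₂, n₂, r, Z₁, Z₂, h₁, h₂, h₃, h₄, hr, h₆, h₇, h₈, h₉, rfl⟩ := h
  by_cases hm : m₁ = 0
  · exact ⟨r, Z₁, Z₂, hr, impedanceSet_mono (by lia) (by lia) h₆,
      impedanceSet_mono (by lia) (by lia) h₇, h₈, h₉, rfl⟩
  · exact ⟨r, Z₂, Z₁, hr, impedanceSet_mono (by lia) (by lia) h₇,
      impedanceSet_mono (by lia) (by lia) h₆, h₉, h₈, by rw [add_comm Z₁⁻¹]⟩

theorem IsParallelSplit.zero_two {Z : RatFunc ℝ} (h : IsParallelSplit 0 2 Z) :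
    ∃ (r : ℝ) (Z₁ Z₂ : RatFunc ℝ), 0 ≤ r ∧ Z₁ ∈ impedanceSet 0 1 ∧ Z₂ ∈ impedanceSet 0 1 ∧
      Z₁ ≠ 0 ∧ Z₂ ≠ 0 ∧ Z = RatFunc.C r + (Z₁⁻¹ + Z₂⁻¹)⁻¹ := by
  obtain ⟨m₁, n₁, m₂, n₂, r, Z₁, Z₂, h₁, h₂, h₃, h₄, hr, h₆, h₇, h₈, h₉, rfl⟩ := h
  exact ⟨r, Z₁, Z₂, hr, impedanceSet_mono (by lia) (by lia) h₆,
    impedanceSet_mono (by lia) (by lia) h₇, h₈, h₉, rfl⟩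

theorem IsParallelSplit.one_two {Z : RatFunc ℝ} (h : IsParallelSplit 1 2 Z) :
    ∃ (r : ℝ) (Z₁ Z₂ : RatFunc ℝ), 0 ≤ r ∧
      (Z₁ ∈ impedanceSet 0 1 ∧ Z₂ ∈ impedanceSet 1 1 ∨
        Z₁ ∈ impedanceSet 1 0 ∧ Z₂ ∈ impedanceSet 0 2) ∧
      Z₁ ≠ 0 ∧ Z₂ ≠ 0 ∧ Z = RatFunc.C r + (Z₁⁻¹ + Z₂⁻¹)⁻¹ := by
  obtain ⟨m₁, n₁, m₂, n₂, r, Z₁, Z₂, h₁, h₂, h₃, h₄, hr, h₆, h₇, h₈, h₉, rfl⟩ := h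
  by_cases hA : m₁ = 0 ∧ n₁ ≤ 1
  · exact ⟨r, Z₁, Z₂, hr, Or.inl ⟨impedanceSet_mono (by lia) (by lia) h₆,
      impedanceSet_mono (by lia) (by lia) h₇⟩, h₈, h₉, rfl⟩
  by_cases hB : m₂ = 0 ∧ n₂ ≤ 1
  · exact ⟨r, Z₂, Z₁, hr, Or.inl ⟨impedanceSet_mono (by lia) (by lia) h₇,
      impedanceSet_mono (by lia) (by lia) h₆⟩, h₉, h₈, by rw [add_comm Z₁⁻¹]⟩
  by_cases hC : m₁ = 0
  · exact ⟨r, Z₂, Z₁, hr, Or.inr ⟨impedanceSet_mono (by lia) (by lia) h₇,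
      impedanceSet_mono (by lia) (by lia) h₆⟩, h₉, h₈, by rw [add_comm Z₁⁻¹]⟩
  · exact ⟨r, Z₁, Z₂, hr, Or.inr ⟨impedanceSet_mono (by lia) (by lia) h₆,
      impedanceSet_mono (by lia) (by lia) h₇⟩, h₈, h₉, rfl⟩

theorem IsLower.one_two {Z : RatFunc ℝ} (h : IsLower 1 2 Z) :
    Z ∈ impedanceSet 1 1 ∨ Z ∈ impedanceSet 0 2 := by
  obtain ⟨m, n, h₁, h₂, h₃, h₄⟩ := h
  by_cases hm : m = 0
  · exact Or.inr (impedanceSet_mono (by lia) (by lia) h₄)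
  · exact Or.inl (impedanceSet_mono (by lia) (by lia) h₄)

theorem IsLower.one_one {Z : RatFunc ℝ} (h : IsLower 1 1 Z) :
    Z ∈ impedanceSet 1 0 ∨ Z ∈ impedanceSet 0 1 := by
  obtain ⟨m, n, h₁, h₂, h₃, h₄⟩ := h
  by_cases hm : m = 0
  · exact Or.inr (impedanceSet_mono (by lia) (by lia) h₄)
  · exact Or.inl (impedanceSet_mono (by lia) (by lia) h₄)

theorem IsLower.zero_two {Z : RatFunc ℝ} (h : IsLower 0 2 Z) : Z ∈ impedanceSet 0 1 := by
  obtain ⟨m, n, h₁, h₂, h₃, h₄⟩ := h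
  exact impedanceSet_mono (by lia) (by lia) h₄

theorem IsRegularPair.dual {c d : Quad} (h : IsRegularPair c d) :
    IsRegularPair d.reverse c.reverse := by
  obtain ⟨hR, h⟩ := h
  refine ⟨by rwa [quadResultant_dual], ?_⟩
  have h₂ : alpha₂ d.reverse c.reverse = alpha₂ c d := by
    simp only [alpha₂, Quad.reverse]; ring
  have l₁ : lambda₁ d.reverse c.reverse = lambda₂ c d := by
    simp only [lambda₁, lambda₂, alpha₁, alpha₂, alpha₃, Quad.reverse]; ring
  have l₂ : lambda₂ d.reverse c.reverse = lambda₁ c d := by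
    simp only [lambda₁, lambda₂, alpha₁, alpha₂, alpha₃, Quad.reverse]; ring
  have l₃ : lambda₃ d.reverse c.reverse = lambda₄ c d := by
    simp only [lambda₃, lambda₄, alpha₁, alpha₂, alpha₃, Quad.reverse]; ring
  have l₄ : lambda₄ d.reverse c.reverse = lambda₃ c d := by
    simp only [lambda₃, lambda₄, alpha₁, alpha₂, alpha₃, Quad.reverse]; ring
  rw [h₂, l₁, l₂, l₃, l₄]
  tauto

/-- Here `c / d = r + (g + k / (s + p) + q s / (y s + 1))⁻¹`. The signs of `p q - y k` and `p y - 1`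
decide which of the four alternatives holds. The resistor `r` enters only `λ₂` and `λ₄`, as `-r λ₃`
and `-r λ₁`; in the cases where these are needed, `λ₃` or `λ₁` is non-positive, so `r` only helps.
-/
theorem isRegularPair_of_parallel {r g k q p y : ℝ} (hr : 0 ≤ r) (hg : 0 ≤ g) (hk : 0 < k)
    (hq : 0 < q) (hp : 0 ≤ p) (hy : 0 ≤ y) (hpy : p * y ≠ 1) {c d : Quad}
    (hd : d = ⟨g * y + q, g * (1 + p * y) + k * y + q * p, g * p + k⟩)
    (hc : c = ⟨r * d.c₂ + y, r * d.c₁ + (1 + p * y), r * d.c₀ + p⟩) : IsRegularPair c d := by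
  have e₂ : alpha₂ c d = y * k - p * q := by
    simp only [alpha₂, hc, hd]; ring
  have l₁ : lambda₁ c d = g * (k - p ^ 3 * y * q) + q * p * (2 * k - k * y * p - q * p ^ 2) := by
    simp only [lambda₁, alpha₁, alpha₂, hc, hd]; ring
  have l₃ : lambda₃ c d = g * (q - p * k * y ^ 3) + k * y * (2 * q - k * y ^ 2 - q * p * y) := by
    simp only [lambda₃, alpha₃, alpha₂, hc, hd]; ring
  have l₂ : lambda₂ c d = -r * lambda₃ c d + (p * k * y ^ 3 - q) := by
    simp only [lambda₂, lambda₃, alpha₃, alpha₂, hc, hd]; ring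
  have l₄ : lambda₄ c d = -r * lambda₁ c d + (p ^ 3 * y * q - k) := by
    simp only [lambda₄, lambda₁, alpha₁, alpha₂, hc, hd]; ring
  have eR : quadResultant c d = k * q * (1 - p * y) ^ 2 := by
    simp only [quadResultant, alpha₁, alpha₂, alpha₃, hc, hd]; ring
  have hpy0 := mul_nonneg hp hy
  refine ⟨?_, ?_⟩
  · rw [eR]
    have : 1 - p * y ≠ 0 := sub_ne_zero.2 hpy.symm
    positivity
  rw [l₂, l₄, e₂]
  rcases le_total (p * q) (y * k) with h | h <;> rcases le_total (p * y) 1 with h' | h'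
  · refine Or.inl ⟨by linarith, ?_⟩
    have h1 : p ^ 3 * y * q ≤ k := by
      calc p ^ 3 * y * q = p * (p * y) * (p * q) := by ring
        _ ≤ p * (p * y) * (y * k) := by gcongr
        _ = (p * y) ^ 2 * k := by ring
        _ ≤ 1 ^ 2 * k := by gcongr
        _ = k := by ring
    have h2 : q * p ^ 2 ≤ p * y * k := by nlinarith
    have h3 : p * y * k ≤ k := by nlinarith
    rw [l₁]
    have h4 : 0 ≤ k - p ^ 3 * y * q := by linarith
    have h5 : 0 ≤ 2 * k - k * y * p - q * p ^ 2 := by linarith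
    positivity
  · refine Or.inr (Or.inr (Or.inr ⟨by linarith, ?_⟩))
    have h1 : q ≤ p * k * y ^ 3 := by
      calc q = 1 ^ 2 * q := by ring
        _ ≤ (p * y) ^ 2 * q := by gcongr
        _ = p * y ^ 2 * (p * q) := by ring
        _ ≤ p * y ^ 2 * (y * k) := by gcongr
        _ = p * k * y ^ 3 := by ring
    have h2 : p * y * q ≤ k * y ^ 2 := by nlinarith
    have h3 : q ≤ p * y * q := by nlinarith
    have h4 : lambda₃ c d ≤ 0 := by
      rw [l₃]
      have h4 : g * (q - p * k * y ^ 3) ≤ 0 := mul_nonpos_of_nonneg_of_nonpos hg (by linarith)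
      have h5 : k * y * (2 * q - k * y ^ 2 - q * p * y) ≤ 0 :=
        mul_nonpos_of_nonneg_of_nonpos (by positivity) (by linarith)
      linarith
    nlinarith [mul_nonneg hr (neg_nonneg.2 h4)]
  · refine Or.inr (Or.inl ⟨by linarith, ?_⟩)
    have h1 : p * k * y ^ 3 ≤ q := by
      calc p * k * y ^ 3 = p * y ^ 2 * (y * k) := by ring
        _ ≤ p * y ^ 2 * (p * q) := by gcongr
        _ = (p * y) ^ 2 * q := by ring
        _ ≤ 1 ^ 2 * q := by gcongr
        _ = q := by ring
    have h2 : k * y ^ 2 ≤ p * y * q := by nlinarith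
    have h3 : p * y * q ≤ q := by nlinarith
    rw [l₃]
    have h4 : 0 ≤ q - p * k * y ^ 3 := by linarith
    have h5 : 0 ≤ 2 * q - k * y ^ 2 - q * p * y := by linarith
    positivity
  · refine Or.inr (Or.inr (Or.inl ⟨by linarith, ?_⟩))
    have h1 : k ≤ p ^ 3 * y * q := by
      calc k = 1 ^ 2 * k := by ring
        _ ≤ (p * y) ^ 2 * k := by gcongr
        _ = p * (p * y) * (y * k) := by ring
        _ ≤ p * (p * y) * (p * q) := by gcongr
        _ = p ^ 3 * y * q := by ring
    have h2 : p * y * k ≤ q * p ^ 2 := by nlinarith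
    have h3 : k ≤ p * y * k := by nlinarith
    have h4 : lambda₁ c d ≤ 0 := by
      rw [l₁]
      have h4 : g * (k - p ^ 3 * y * q) ≤ 0 := mul_nonpos_of_nonneg_of_nonpos hg (by linarith)
      have h5 : q * p * (2 * k - k * y * p - q * p ^ 2) ≤ 0 :=
        mul_nonpos_of_nonneg_of_nonpos (by positivity) (by linarith)
      linarith
    nlinarith [mul_nonneg hr (neg_nonneg.2 h4)]

theorem linRat_div_mem {A B C D : ℝ} (hA : 0 ≤ A) (hB : 0 ≤ B) (hC : 0 ≤ C)
    (hD : 0 ≤ D) : linRat A B / linRat C D ∈ impedanceSet 1 0 ∨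
      linRat A B / linRat C D ∈ impedanceSet 0 1 := by
  rcases le_total (A * D) (B * C) with h | h
  · exact Or.inl (linRat_div_mem_one_zero hA hB hC hD h)
  · exact Or.inr (linRat_div_mem_zero_one hA hB hC hD h)

theorem parallel_one_one_eq {K : Type*} [Field K] {r g₁ g₂ k p q y s : K} (h₁ : s + p ≠ 0)
    (h₂ : y * s + 1 ≠ 0) (h : g₁ + k / (s + p) + (g₂ + q * s / (y * s + 1)) ≠ 0) :
    r + (g₁ + k / (s + p) + (g₂ + q * s / (y * s + 1)))⁻¹ =
      ((r * ((g₁ + g₂) * y + q) + y) * s ^ 2 +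
        (r * ((g₁ + g₂) * (1 + p * y) + k * y + q * p) + (1 + p * y)) * s +
        (r * ((g₁ + g₂) * p + k) + p)) /
      (((g₁ + g₂) * y + q) * s ^ 2 + ((g₁ + g₂) * (1 + p * y) + k * y + q * p) * s +
        ((g₁ + g₂) * p + k)) := by
  have e : g₁ + k / (s + p) + (g₂ + q * s / (y * s + 1)) =
      (((g₁ + g₂) * y + q) * s ^ 2 + ((g₁ + g₂) * (1 + p * y) + k * y + q * p) * s +
        ((g₁ + g₂) * p + k)) / ((s + p) * (y * s + 1)) := by
    rw [eq_div_iff (mul_ne_zero h₁ h₂)]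
    have e₁ : k / (s + p) * (s + p) = k := div_mul_cancel₀ _ h₁
    have e₂ : q * s / (y * s + 1) * (y * s + 1) = q * s := div_mul_cancel₀ _ h₂
    linear_combination (y * s + 1) * e₁ + (s + p) * e₂
  rw [e] at h ⊢
  have hN := (div_ne_zero_iff.1 h).1
  rw [inv_div, add_div' _ _ _ hN]
  congr 1
  ring

theorem IsParallelSplit.exists_regular {Z : RatFunc ℝ} (h : IsParallelSplit 1 1 Z) :
    Z ∈ impedanceSet 1 0 ∨ Z ∈ impedanceSet 0 1 ∨
      ∃ c d : Quad, c.Nonneg ∧ d.Nonneg ∧ IsRegularPair c d ∧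
        Z = c.toRatFunc / d.toRatFunc := by
  obtain ⟨r, Z₁, Z₂, hr, h₁, h₂, h0₁, h0₂, rfl⟩ := h.one_one
  obtain ⟨g₁, k, p, hg₁, hk, hp, e₁⟩ := inv_eq_of_mem_zero_one h₁ h0₁
  obtain ⟨g₂, q, y, hg₂, hq, hy, e₂⟩ := inv_eq_of_mem_one_zero h₂ h0₂
  rcases hk.eq_or_lt with rfl | hk
  · rw [map_zero, zero_div, add_zero] at e₁
    rw [e₁, add_comm (RatFunc.C g₁)]
    exact Or.inl (C_add_mem_impedanceSet (parallel_C_mem_impedanceSet h₂ h0₂ hg₁) hr)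
  rcases hq.eq_or_lt with rfl | hq
  · rw [map_zero, zero_mul, zero_div, add_zero] at e₂
    rw [e₂]
    exact Or.inr (Or.inl (C_add_mem_impedanceSet (parallel_C_mem_impedanceSet h₁ h0₁ hg₂) hr))
  have hsp : (RatFunc.X + RatFunc.C p : RatFunc ℝ) = linRat 1 p := by simp [linRat]
  have hys : (RatFunc.C y * RatFunc.X + 1 : RatFunc ℝ) = linRat y 1 := by simp [linRat]
  have hsp0 := linRat_ne_zero zero_le_one hp (Or.inl one_ne_zero)
  have hys0 := linRat_ne_zero hy zero_le_one (Or.inr one_ne_zero)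
  rw [← hsp] at hsp0
  rw [← hys] at hys0
  have hY : Z₁⁻¹ + Z₂⁻¹ ≠ 0 := ((isPosRat_of_mem_impedanceSet h₁ h0₁).inv.add
    (isPosRat_of_mem_impedanceSet h₂ h0₂).inv).ne_zero
  rw [e₁, e₂] at hY
  -- If the poles `-p` and `-1 / y` coincide, the total admittance is bilinear and one element
  -- suffices.
  by_cases hpy : p * y = 1
  · have hy0 : y ≠ 0 := by
      rintro rfl
      simp at hpy
    have hypos := hy.lt_of_ne' hy0
    have e : RatFunc.C r + (Z₁⁻¹ + Z₂⁻¹)⁻¹ =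
        RatFunc.C r + linRat 1 p / linRat (g₁ + g₂ + q / y) ((g₁ + g₂) * p + k) := by
      rw [e₁, e₂]
      congr 1
      have e₃ : (RatFunc.C y * RatFunc.X + 1 : RatFunc ℝ) =
          RatFunc.C y * (RatFunc.X + RatFunc.C p) := by
        rw [mul_add, ← map_mul, mul_comm y p, hpy, map_one]
      have hy0' := RatFunc.C_ne_zero hy0
      rw [e₃, ← inv_div, ← hsp]
      simp only [linRat, map_add, map_mul, map_div₀]
      field_simp
      ring
    rw [e]
    rcases linRat_div_mem zero_le_one hp (by positivity : 0 ≤ g₁ + g₂ + q / y)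
      (by positivity : 0 ≤ (g₁ + g₂) * p + k) with h | h
    · exact Or.inl (C_add_mem_impedanceSet h hr)
    · exact Or.inr (Or.inl (C_add_mem_impedanceSet h hr))
  · refine Or.inr (Or.inr ⟨_, _, ?_, ?_, isRegularPair_of_parallel hr (add_nonneg hg₁ hg₂) hk hq
      hp hy hpy rfl rfl, ?_⟩)
    · refine ⟨?_, ?_, ?_⟩ <;> dsimp only <;> positivity
    · refine ⟨?_, ?_, ?_⟩ <;> dsimp only <;> positivity
    · rw [e₁, e₂, parallel_one_one_eq hsp0 hys0 hY]
      simp only [Quad.toRatFunc, map_add, map_mul, map_one]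

/-- An impedance with one inductor and one capacitor is bilinear or regular. -/
theorem exists_regular_of_mem_one_one {Z : RatFunc ℝ} (hZ : Z ∈ impedanceSet 1 1) :
    Z ∈ impedanceSet 1 0 ∨ Z ∈ impedanceSet 0 1 ∨
      ∃ c d : Quad, c.Nonneg ∧ d.Nonneg ∧ IsRegularPair c d ∧
        Z = c.toRatFunc / d.toRatFunc := by
  rcases isReducible_of_mem_impedanceSet (by norm_num) hZ with h | h | h
  · rcases h.one_one with h | h
    · exact Or.inl h
    · exact Or.inr (Or.inl h)
  · exact h.exists_regular
  · rcases h.exists_regular with h | h | ⟨c, d, hc, hd, h, e⟩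
    · exact Or.inl (dualRat_mem_impedanceSet_iff.1 h)
    · exact Or.inr (Or.inl (dualRat_mem_impedanceSet_iff.1 h))
    · refine Or.inr (Or.inr ⟨_, _, hd.reverse, hc.reverse, h.dual, ?_⟩)
      rw [← Quad.dualRat_toRatFunc_div, ← e, dualRat_dualRat]

/-- The sign conditions that characterize `c / d ∈ 𝒵_{0,2}` for coprime `c` and `d`. -/
def IsInductivePair (c d : Quad) : Prop :=
  quadResultant c d < 0 ∧ 0 ≤ alpha₁ c d ∧ 0 ≤ alpha₂ c d ∧ 0 ≤ alpha₃ c d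

theorem IsInductivePair.dual {c d : Quad} (h : IsInductivePair c d) :
    IsInductivePair d.reverse c.reverse := by
  obtain ⟨hR, h₁, h₂, h₃⟩ := h
  refine ⟨by rwa [quadResultant_dual], ?_, ?_, ?_⟩ <;>
    simp only [alpha₁, alpha₂, alpha₃, Quad.reverse] at * <;> linarith

theorem parallel_zero_two_eq {K : Type*} [Field K] {r g₁ g₂ k p q y s : K} (h₁ : s + p ≠ 0)
    (h₂ : s + y ≠ 0) (h : g₁ + k / (s + p) + (g₂ + q / (s + y)) ≠ 0) :
    r + (g₁ + k / (s + p) + (g₂ + q / (s + y)))⁻¹ =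
      ((r * (g₁ + g₂) + 1) * s ^ 2 +
        (r * ((g₁ + g₂) * (p + y) + k + q) + (p + y)) * s +
        (r * ((g₁ + g₂) * (p * y) + k * y + q * p) + p * y)) /
      ((g₁ + g₂) * s ^ 2 + ((g₁ + g₂) * (p + y) + k + q) * s +
        ((g₁ + g₂) * (p * y) + k * y + q * p)) := by
  have e : g₁ + k / (s + p) + (g₂ + q / (s + y)) =
      ((g₁ + g₂) * s ^ 2 + ((g₁ + g₂) * (p + y) + k + q) * s +
        ((g₁ + g₂) * (p * y) + k * y + q * p)) / ((s + p) * (s + y)) := by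
    rw [eq_div_iff (mul_ne_zero h₁ h₂)]
    have e₁ : k / (s + p) * (s + p) = k := div_mul_cancel₀ _ h₁
    have e₂ : q / (s + y) * (s + y) = q := div_mul_cancel₀ _ h₂
    linear_combination (s + y) * e₁ + (s + p) * e₂
  rw [e] at h ⊢
  have hN := (div_ne_zero_iff.1 h).1
  rw [inv_div, add_div' _ _ _ hN]
  congr 1
  ring

theorem IsParallelSplit.exists_inductive {Z : RatFunc ℝ} (h : IsParallelSplit 0 2 Z) :
    Z ∈ impedanceSet 0 1 ∨ ∃ c d : Quad, c.Nonneg ∧ d.Nonneg ∧ IsInductivePair c d ∧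
      Z = c.toRatFunc / d.toRatFunc := by
  obtain ⟨r, Z₁, Z₂, hr, h₁, h₂, h0₁, h0₂, rfl⟩ := h.zero_two
  obtain ⟨g₁, k, p, hg₁, hk, hp, e₁⟩ := inv_eq_of_mem_zero_one h₁ h0₁
  obtain ⟨g₂, q, y, hg₂, hq, hy, e₂⟩ := inv_eq_of_mem_zero_one h₂ h0₂
  rcases hk.eq_or_lt with rfl | hk
  · rw [map_zero, zero_div, add_zero] at e₁
    rw [e₁, add_comm (RatFunc.C g₁)]
    exact Or.inl (C_add_mem_impedanceSet (parallel_C_mem_impedanceSet h₂ h0₂ hg₁) hr)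
  rcases hq.eq_or_lt with rfl | hq
  · rw [map_zero, zero_div, add_zero] at e₂
    rw [e₂]
    exact Or.inl (C_add_mem_impedanceSet (parallel_C_mem_impedanceSet h₁ h0₁ hg₂) hr)
  have hsp : ∀ p : ℝ, (RatFunc.X + RatFunc.C p : RatFunc ℝ) = linRat 1 p := by simp [linRat]
  have hsp0 := linRat_ne_zero zero_le_one hp (Or.inl one_ne_zero)
  have hsy0 := linRat_ne_zero zero_le_one hy (Or.inl one_ne_zero)
  rw [← hsp] at hsp0 hsy0
  have hY : Z₁⁻¹ + Z₂⁻¹ ≠ 0 := ((isPosRat_of_mem_impedanceSet h₁ h0₁).inv.add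
    (isPosRat_of_mem_impedanceSet h₂ h0₂).inv).ne_zero
  rw [e₁, e₂] at hY
  by_cases hpy : p = y
  · subst hpy
    have e : RatFunc.C r + (Z₁⁻¹ + Z₂⁻¹)⁻¹ =
        RatFunc.C r + linRat 1 p / linRat (g₁ + g₂) ((g₁ + g₂) * p + (k + q)) := by
      rw [e₁, e₂]
      congr 1
      rw [← inv_div, ← hsp]
      simp only [linRat, map_add, map_mul]
      field_simp
      ring
    rw [e]
    exact Or.inl (C_add_mem_impedanceSet (linRat_div_mem_zero_one zero_le_one hp (by positivity)
      (by positivity) (by linarith)) hr)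
  · refine Or.inr ⟨⟨r * (g₁ + g₂) + 1, r * ((g₁ + g₂) * (p + y) + k + q) + (p + y),
      r * ((g₁ + g₂) * (p * y) + k * y + q * p) + p * y⟩,
      ⟨g₁ + g₂, (g₁ + g₂) * (p + y) + k + q, (g₁ + g₂) * (p * y) + k * y + q * p⟩, ?_, ?_,
      ⟨?_, ?_, ?_, ?_⟩, ?_⟩
    · refine ⟨?_, ?_, ?_⟩ <;> dsimp only <;> positivity
    · refine ⟨?_, ?_, ?_⟩ <;> dsimp only <;> positivity
    · have hne : p - y ≠ 0 := sub_ne_zero.2 hpy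
      have : 0 < k * q * (p - y) ^ 2 := by positivity
      simp only [quadResultant, alpha₁, alpha₂, alpha₃]
      linarith
    · have : 0 ≤ k * y ^ 2 + q * p ^ 2 := by positivity
      simp only [alpha₁]
      linarith
    · have : 0 ≤ k * y + q * p := by positivity
      simp only [alpha₂]
      linarith
    · have : 0 ≤ k + q := by positivity
      simp only [alpha₃]
      linarith
    · rw [e₁, e₂, parallel_zero_two_eq hsp0 hsy0 hY]
      simp only [Quad.toRatFunc, map_add, map_mul, map_one]

/-- An impedance with two inductors is bilinear or an inductive pair. -/
theorem exists_inductive_of_mem_zero_two {Z : RatFunc ℝ} (hZ : Z ∈ impedanceSet 0 2) :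
    Z ∈ impedanceSet 0 1 ∨ ∃ c d : Quad, c.Nonneg ∧ d.Nonneg ∧ IsInductivePair c d ∧
      Z = c.toRatFunc / d.toRatFunc := by
  rcases isReducible_of_mem_impedanceSet (by norm_num) hZ with h | h | h
  · exact Or.inl h.zero_two
  · exact h.exists_inductive
  · rcases h.exists_inductive with h | ⟨c, d, hc, hd, h, e⟩
    · exact Or.inl (dualRat_mem_impedanceSet_iff.1 h)
    · refine Or.inr ⟨_, _, hd.reverse, hc.reverse, h.dual, ?_⟩
      rw [← Quad.dualRat_toRatFunc_div, ← e, dualRat_dualRat]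

/-! ### The deformation `d + t (f₁ s + f₀)` -/

/-- The polynomial `(f₁ s + f₀) (s + x)`. -/
def poleQuad (x f₁ f₀ : ℝ) : Quad := ⟨f₁, f₀ + x * f₁, x * f₀⟩

/-- The polynomial `d(s) + t (f₁ s + f₀)`. -/
def Quad.addLin (d : Quad) (t f₁ f₀ : ℝ) : Quad := ⟨d.c₂, d.c₁ + t * f₁, d.c₀ + t * f₀⟩

theorem Quad.addLin_addLin (d : Quad) (t u f₁ f₀ : ℝ) :
    (d.addLin t f₁ f₀).addLin u f₁ f₀ = d.addLin (t + u) f₁ f₀ := by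
  simp only [addLin, Quad.mk.injEq, true_and]
  constructor <;> ring

@[simp]
theorem Quad.addLin_zero (d : Quad) (f₁ f₀ : ℝ) : d.addLin 0 f₁ f₀ = d := by
  simp [addLin]

theorem Quad.Nonneg.addLin {d : Quad} (hd : d.Nonneg) {t f₁ f₀ : ℝ} (ht : 0 ≤ t) (h₁ : 0 ≤ f₁)
    (h₀ : 0 ≤ f₀) : (d.addLin t f₁ f₀).Nonneg :=
  ⟨add_nonneg hd.1 (mul_nonneg ht h₀), add_nonneg hd.2.1 (mul_nonneg ht h₁), hd.2.2⟩

theorem Quad.eval_addLin (d : Quad) (t f₁ f₀ s : ℝ) :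
    (d.addLin t f₁ f₀).eval s = d.eval s + t * (f₁ * s + f₀) := by
  simp only [addLin, eval]
  ring

theorem Quad.toRatFunc_addLin (d : Quad) (t f₁ f₀ : ℝ) :
    (d.addLin t f₁ f₀).toRatFunc = d.toRatFunc + RatFunc.C t * linRat f₁ f₀ := by
  simp only [addLin, toRatFunc, linRat, map_add, map_mul]
  ring

theorem poleQuad_nonneg {x f₁ f₀ : ℝ} (hx : 0 ≤ x) (h₁ : 0 ≤ f₁) (h₀ : 0 ≤ f₀) :
    (poleQuad x f₁ f₀).Nonneg :=
  ⟨mul_nonneg hx h₀, add_nonneg h₀ (mul_nonneg hx h₁), h₁⟩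

theorem toRatFunc_poleQuad (x f₁ f₀ : ℝ) :
    (poleQuad x f₁ f₀).toRatFunc = linRat 1 x * linRat f₁ f₀ := by
  simp only [poleQuad, Quad.toRatFunc, linRat, map_add, map_mul, map_one]
  ring

/-- The second factor is `f₁² d(-f₀ / f₁)` when `f₁ ≠ 0`, and adding a multiple of `f₁ s + f₀` to
`d` does not alter it. Along the deformation the sign of the resultant therefore follows that of
`d(-x)`. -/
theorem quadResultant_poleQuad (x f₁ f₀ : ℝ) (d : Quad) :
    quadResultant (poleQuad x f₁ f₀) d =
      d.eval (-x) * (d.c₂ * f₀ ^ 2 - d.c₁ * f₀ * f₁ + d.c₀ * f₁ ^ 2) := by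
  simp only [quadResultant, alpha₁, alpha₂, alpha₃, poleQuad, Quad.eval]
  ring

theorem quadResultant_poleQuad_addLin (x f₁ f₀ t : ℝ) (d : Quad) :
    d.eval (-x) ^ 2 * quadResultant (poleQuad x f₁ f₀) (d.addLin t f₁ f₀) =
      (d.eval (-x) * (d.addLin t f₁ f₀).eval (-x)) * quadResultant (poleQuad x f₁ f₀) d := by
  rw [quadResultant_poleQuad, quadResultant_poleQuad]
  simp only [Quad.addLin]
  ring

theorem quadResultant_addLin_pos {x f₁ f₀ t : ℝ} {d : Quad}
    (h : 0 < quadResultant (poleQuad x f₁ f₀) d)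
    (hs : 0 < d.eval (-x) * (d.addLin t f₁ f₀).eval (-x)) :
    0 < quadResultant (poleQuad x f₁ f₀) (d.addLin t f₁ f₀) := by
  have h' := mul_pos hs h
  rw [← quadResultant_poleQuad_addLin] at h'
  exact pos_of_mul_pos_right h' (sq_nonneg _)

theorem quadResultant_addLin_neg {x f₁ f₀ t : ℝ} {d : Quad}
    (h : quadResultant (poleQuad x f₁ f₀) d < 0)
    (hs : 0 < d.eval (-x) * (d.addLin t f₁ f₀).eval (-x)) :
    quadResultant (poleQuad x f₁ f₀) (d.addLin t f₁ f₀) < 0 := by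
  have h' := mul_neg_of_pos_of_neg hs h
  rw [← quadResultant_poleQuad_addLin] at h'
  by_contra! h''
  exact absurd h' (not_lt.2 (mul_nonneg (sq_nonneg _) h''))

theorem exists_zero_of_mul_nonpos {g : ℝ → ℝ} (hg : Continuous g) {u v : ℝ} (huv : u ≤ v)
    (h : g u * g v ≤ 0) : ∃ t, u ≤ t ∧ t ≤ v ∧ g t = 0 := by
  rcases le_total (g u) 0 with hu | hu
  · by_cases h0 : g u = 0
    · exact ⟨u, le_rfl, huv, h0⟩
    have hv : 0 ≤ g v := nonneg_of_mul_nonpos_right h (lt_of_le_of_ne hu h0)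
    obtain ⟨t, ht, e⟩ := intermediate_value_Icc huv hg.continuousOn ⟨hu, hv⟩
    exact ⟨t, ht.1, ht.2, e⟩
  · by_cases h0 : g u = 0
    · exact ⟨u, le_rfl, huv, h0⟩
    have hv : g v ≤ 0 := by
      by_contra! hv
      exact absurd h (not_le.2 (mul_pos (lt_of_le_of_ne' hu h0) hv))
    obtain ⟨t, ht, e⟩ := intermediate_value_Icc' huv hg.continuousOn ⟨hv, hu⟩
    exact ⟨t, ht.1, ht.2, e⟩

theorem continuous_eval_addLin (d : Quad) (f₁ f₀ s : ℝ) :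
    Continuous fun t => (d.addLin t f₁ f₀).eval s := by
  simp only [Quad.addLin, Quad.eval]
  fun_prop

/-- A common factor `s + x` leaves a bilinear function in parallel with the inductive branch. -/
theorem mem_of_eval_eq_zero {r k x f₁ f₀ : ℝ} {d : Quad} {m n : ℕ} (hr : 0 ≤ r) (hk : 0 < k)
    (hx : 0 ≤ x) (h₁ : 0 ≤ f₁) (h₀ : 0 ≤ f₀) (hf : f₁ ≠ 0 ∨ f₀ ≠ 0) (hd : d.Nonneg)
    (hroot : d.eval (-x) = 0)
    (hmem : 0 ≤ d.c₁ - x * d.c₂ →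
      linRat f₁ f₀ / linRat d.c₂ (d.c₁ - x * d.c₂) ∈ impedanceSet m n) :
    RatFunc.C r + (poleQuad x f₁ f₀).toRatFunc / (d.addLin k f₁ f₀).toRatFunc ∈
      impedanceSet m (n + 1) := by
  obtain ⟨d₂, d₁, d₀⟩ := d
  obtain ⟨hd₀, hd₁, hd₂⟩ := hd
  simp only [Quad.eval] at hroot hd₀ hd₁ hd₂ hmem
  -- The cofactor of `s + x` in `d` is `d₂ s + (d₁ - x d₂)`; its constant term is controlled by `d₀`
  -- if `x > 0` and equals `d₁` if `x = 0`.
  have he : 0 ≤ d₁ - x * d₂ := by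
    rcases hx.eq_or_lt with rfl | hx
    · simpa using hd₁
    · have : d₀ = x * (d₁ - x * d₂) := by linarith
      rw [this] at hd₀
      exact nonneg_of_mul_nonneg_right hd₀ hx
  have hmem := hmem he
  refine C_add_mem_impedanceSet ?_ hr
  have hf0 := linRat_ne_zero h₁ h₀ hf
  have hx0 := linRat_ne_zero zero_le_one hx (Or.inl one_ne_zero)
  have hk0 := RatFunc.C_ne_zero hk.ne'
  have ed : Quad.toRatFunc ⟨d₂, d₁, d₀⟩ = linRat 1 x * linRat d₂ (d₁ - x * d₂) := by
    obtain rfl : d₀ = x * (d₁ - x * d₂) := by linarith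
    simp only [Quad.toRatFunc, linRat, map_sub, map_mul, map_one]
    ring
  have hL : linRat 1 x / RatFunc.C k ∈ impedanceSet 0 1 := by
    have := linRat_div_mem_zero_one zero_le_one hx le_rfl hk.le (by simpa using hk.le)
    simpa [linRat] using this
  rw [Quad.toRatFunc_addLin, toRatFunc_poleQuad, ed]
  by_cases he0 : linRat d₂ (d₁ - x * d₂) = 0
  · rw [he0, mul_zero, zero_add, mul_div_mul_right _ _ hf0]
    exact impedanceSet_mono (Nat.zero_le _) (Nat.le_add_left _ _) hL
  · have := parallel_mem_impedanceSet hmem hL (div_ne_zero hf0 he0) (div_ne_zero hx0 hk0)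
    rw [add_zero] at this
    convert this using 1
    rw [inv_div, inv_div, div_add_div _ _ hf0 hx0, inv_div]
    ring

/-- The boundary form of regularity. -/
def IsBoundaryPair (c d : Quad) : Prop :=
  0 < quadResultant c d ∧
    ((0 ≤ alpha₂ c d ∧ lambda₁ c d = 0) ∨ (alpha₂ c d ≤ 0 ∧ lambda₃ c d = 0) ∨
      (alpha₂ c d ≤ 0 ∧ 0 ≤ lambda₄ c d ∧ (lambda₄ c d = 0 ∨ d.c₀ = 0)))

/-- For non-negative `x, f₁, f₀` the `αᵢ` and `λ₂` do not decrease with `t`, and `λ₄` does not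
increase. These laws fix the direction in which each case is deformed; `λ₁` and `λ₃` are followed by
continuity only. -/
theorem alpha₂_addLin (x f₁ f₀ t : ℝ) (d : Quad) :
    alpha₂ (poleQuad x f₁ f₀) (d.addLin t f₁ f₀) = alpha₂ (poleQuad x f₁ f₀) d + t * (f₁ * f₀) := by
  simp only [alpha₂, poleQuad, Quad.addLin]
  ring

theorem alpha₁_addLin (x f₁ f₀ t : ℝ) (d : Quad) :
    alpha₁ (poleQuad x f₁ f₀) (d.addLin t f₁ f₀) = alpha₁ (poleQuad x f₁ f₀) d + t * f₀ ^ 2 := by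
  simp only [alpha₁, poleQuad, Quad.addLin]
  ring

theorem alpha₃_addLin (x f₁ f₀ t : ℝ) (d : Quad) :
    alpha₃ (poleQuad x f₁ f₀) (d.addLin t f₁ f₀) = alpha₃ (poleQuad x f₁ f₀) d + t * f₁ ^ 2 := by
  simp only [alpha₃, poleQuad, Quad.addLin]
  ring

theorem lambda₂_addLin (x f₁ f₀ t : ℝ) (d : Quad) :
    lambda₂ (poleQuad x f₁ f₀) (d.addLin t f₁ f₀) =
      lambda₂ (poleQuad x f₁ f₀) d + t * (x * f₁ ^ 3) := by
  simp only [lambda₂, alpha₂, alpha₃, poleQuad, Quad.addLin]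
  ring

theorem lambda₄_addLin (x f₁ f₀ t : ℝ) (d : Quad) :
    lambda₄ (poleQuad x f₁ f₀) (d.addLin t f₁ f₀) =
      lambda₄ (poleQuad x f₁ f₀) d - t * f₀ ^ 3 := by
  simp only [lambda₄, alpha₂, alpha₁, poleQuad, Quad.addLin]
  ring

theorem continuous_lambda₁_addLin (c d : Quad) (f₁ f₀ : ℝ) :
    Continuous fun t => lambda₁ c (d.addLin t f₁ f₀) := by
  simp only [lambda₁, alpha₁, alpha₂, Quad.addLin]
  fun_prop

theorem continuous_lambda₃_addLin (c d : Quad) (f₁ f₀ : ℝ) :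
    Continuous fun t => lambda₃ c (d.addLin t f₁ f₀) := by
  simp only [lambda₃, alpha₃, alpha₂, Quad.addLin]
  fun_prop

theorem mem_of_eval_eq_zero_of_addLin {r k t x f₁ f₀ : ℝ} {d : Quad} (hr : 0 ≤ r) (htk : t < k)
    (hx : 0 ≤ x) (h₁ : 0 ≤ f₁) (h₀ : 0 ≤ f₀) (hf : f₁ ≠ 0 ∨ f₀ ≠ 0)
    (hd : (d.addLin t f₁ f₀).Nonneg) (hroot : (d.addLin t f₁ f₀).eval (-x) = 0) :
    RatFunc.C r + (poleQuad x f₁ f₀).toRatFunc / (d.addLin k f₁ f₀).toRatFunc ∈ impedanceSet 1 1 ∨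
    RatFunc.C r + (poleQuad x f₁ f₀).toRatFunc / (d.addLin k f₁ f₀).toRatFunc ∈
      impedanceSet 0 2 := by
  have e : d.addLin k f₁ f₀ = (d.addLin t f₁ f₀).addLin (k - t) f₁ f₀ := by
    rw [Quad.addLin_addLin, add_sub_cancel]
  rw [e]
  set T := d.addLin t f₁ f₀
  have hkt := sub_pos.2 htk
  rcases le_total (f₁ * (T.c₁ - x * T.c₂)) (f₀ * T.c₂) with h | h
  · exact Or.inl (mem_of_eval_eq_zero (n := 0) hr hkt hx h₁ h₀ hf hd hroot
      fun he => linRat_div_mem_one_zero h₁ h₀ hd.2.2 he h)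
  · exact Or.inr (mem_of_eval_eq_zero (n := 1) hr hkt hx h₁ h₀ hf hd hroot
      fun he => linRat_div_mem_zero_one h₁ h₀ hd.2.2 he h)

section Deformation

variable {r k x f₁ f₀ : ℝ} {d : Quad}

/-- The product is affine in `t` and positive at both ends of `[0, k]`. -/
theorem eval_mul_eval_addLin_pos {t s : ℝ} (h : 0 < d.eval s * (d.addLin k f₁ f₀).eval s)
    (ht : 0 ≤ t) (htk : t ≤ k) : 0 < d.eval s * (d.addLin t f₁ f₀).eval s := by
  rw [Quad.eval_addLin] at h ⊢
  have hu : 0 < d.eval s ^ 2 := by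
    have : d.eval s ≠ 0 := by
      intro h0
      simp [h0] at h
    positivity
  rw [mul_add] at h ⊢
  rcases le_total 0 (d.eval s * (f₁ * s + f₀)) with hv | hv
  · nlinarith [mul_nonneg ht hv]
  · nlinarith [mul_nonneg (sub_nonneg.2 htk) (neg_nonneg.2 hv)]

/-- As `t` grows, `α₂ ≥ 0` persists. Either `λ₁` is still non-negative at `t = k`, so that the whole
inductive branch is absorbed, or it vanishes before. -/
theorem deform_of_lambda₁ (hr : 0 ≤ r) (hk : 0 < k) (hx : 0 ≤ x) (h₁ : 0 ≤ f₁) (h₀ : 0 ≤ f₀)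
    (hd : d.Nonneg)
    (hR : 0 < quadResultant (poleQuad x f₁ f₀) d) (h₂ : 0 ≤ alpha₂ (poleQuad x f₁ f₀) d)
    (hl : 0 ≤ lambda₁ (poleQuad x f₁ f₀) d) (hs : 0 < d.eval (-x) * (d.addLin k f₁ f₀).eval (-x)) :
    RatFunc.C r + (poleQuad x f₁ f₀).toRatFunc / (d.addLin k f₁ f₀).toRatFunc ∈ impedanceSet 1 1 ∨
    ∃ t < k, (d.addLin t f₁ f₀).Nonneg ∧
      IsBoundaryPair (poleQuad x f₁ f₀) (d.addLin t f₁ f₀) := by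
  have hα : ∀ t, 0 ≤ t → 0 ≤ alpha₂ (poleQuad x f₁ f₀) (d.addLin t f₁ f₀) := by
    intro t ht
    rw [alpha₂_addLin]
    positivity
  by_cases hl' : 0 ≤ lambda₁ (poleQuad x f₁ f₀) (d.addLin k f₁ f₀)
  · exact Or.inl (C_add_mem_impedanceSet (quad_div_mem_one_one_of_lambda₁
      (poleQuad_nonneg hx h₁ h₀) (hd.addLin hk.le h₁ h₀) (quadResultant_addLin_pos hR hs)
      (hα k hk.le) hl') hr)
  · push Not at hl'
    obtain ⟨t, ht, htk, e⟩ := exists_zero_of_mul_nonpos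
      (continuous_lambda₁_addLin (poleQuad x f₁ f₀) d f₁ f₀) hk.le (by
        rw [Quad.addLin_zero]
        exact mul_nonpos_of_nonneg_of_nonpos hl hl'.le)
    have htk' : t ≠ k := by
      rintro rfl
      exact hl'.ne e
    exact Or.inr ⟨t, lt_of_le_of_ne htk htk', hd.addLin ht h₁ h₀,
      quadResultant_addLin_pos hR (eval_mul_eval_addLin_pos hs ht htk), Or.inl ⟨hα t ht, e⟩⟩

/-- For `α₂ = 0` the resultant is `-α₁ α₃`, so `α₁` and `α₃` have opposite signs, while `λ₁ = d₁ α₁`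
and `λ₃ = -d₁ α₃`. This lets `λ₁` take over from `λ₃` where `α₂` changes sign. -/
theorem lambda₁_nonneg_of_lambda₃ {c : Quad} (hc : c.Nonneg) (hd : d.Nonneg)
    (hR : 0 < quadResultant c d) (h₂ : alpha₂ c d = 0) (hl : 0 ≤ lambda₃ c d) :
    0 ≤ lambda₁ c d := by
  obtain ⟨c₂, c₁, c₀⟩ := c
  obtain ⟨d₂, d₁, d₀⟩ := d
  obtain ⟨hc₀, hc₁, hc₂⟩ := hc
  obtain ⟨hd₀, hd₁, hd₂⟩ := hd
  simp only [quadResultant, lambda₃, lambda₁] at *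
  rw [h₂] at hR hl ⊢
  have h : 0 < -(alpha₁ ⟨c₂, c₁, c₀⟩ ⟨d₂, d₁, d₀⟩ * alpha₃ ⟨c₂, c₁, c₀⟩ ⟨d₂, d₁, d₀⟩) := by
    linarith
  have hl' : d₁ * alpha₃ ⟨c₂, c₁, c₀⟩ ⟨d₂, d₁, d₀⟩ ≤ 0 := by linarith
  set A := alpha₁ ⟨c₂, c₁, c₀⟩ ⟨d₂, d₁, d₀⟩
  set B := alpha₃ ⟨c₂, c₁, c₀⟩ ⟨d₂, d₁, d₀⟩
  rw [mul_zero, sub_zero]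
  rcases le_or_gt 0 A with hA | hA
  · exact mul_nonneg hd₁ hA
  · have hB : 0 < B := by nlinarith
    have : d₁ = 0 := le_antisymm (by nlinarith) hd₁
    rw [this, zero_mul]

/-- As `t` grows, `α₂` may reach zero before `t = k`. If `λ₃` is still non-negative there, the
deformation is restarted from that point under the condition on `λ₁`; if not, `λ₃` has vanished on
the way. -/
theorem deform_of_lambda₃ (hr : 0 ≤ r) (hk : 0 < k) (hx : 0 ≤ x) (h₁ : 0 ≤ f₁) (h₀ : 0 ≤ f₀)
    (hd : d.Nonneg)
    (hR : 0 < quadResultant (poleQuad x f₁ f₀) d) (h₂ : alpha₂ (poleQuad x f₁ f₀) d ≤ 0)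
    (hl : 0 ≤ lambda₃ (poleQuad x f₁ f₀) d) (hs : 0 < d.eval (-x) * (d.addLin k f₁ f₀).eval (-x)) :
    RatFunc.C r + (poleQuad x f₁ f₀).toRatFunc / (d.addLin k f₁ f₀).toRatFunc ∈ impedanceSet 1 1 ∨
    ∃ t < k, (d.addLin t f₁ f₀).Nonneg ∧
      IsBoundaryPair (poleQuad x f₁ f₀) (d.addLin t f₁ f₀) := by
  have hα : ∀ t u, t ≤ u → alpha₂ (poleQuad x f₁ f₀) (d.addLin t f₁ f₀) ≤
      alpha₂ (poleQuad x f₁ f₀) (d.addLin u f₁ f₀) := by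
    intro t u htu
    rw [alpha₂_addLin, alpha₂_addLin]
    have := mul_le_mul_of_nonneg_right htu (mul_nonneg h₁ h₀)
    linarith
  have key : ∀ u, 0 ≤ u → u ≤ k → alpha₂ (poleQuad x f₁ f₀) (d.addLin u f₁ f₀) ≤ 0 →
      lambda₃ (poleQuad x f₁ f₀) (d.addLin u f₁ f₀) < 0 → ∃ t < k, (d.addLin t f₁ f₀).Nonneg ∧
      IsBoundaryPair (poleQuad x f₁ f₀) (d.addLin t f₁ f₀) := by
    intro u hu huk hαu hlu
    obtain ⟨t, ht, htu, e⟩ := exists_zero_of_mul_nonpos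
      (continuous_lambda₃_addLin (poleQuad x f₁ f₀) d f₁ f₀) hu (by
        rw [Quad.addLin_zero]
        exact mul_nonpos_of_nonneg_of_nonpos hl hlu.le)
    have htu' : t ≠ u := by
      rintro rfl
      exact hlu.ne e
    exact ⟨t, (lt_of_le_of_ne htu htu').trans_le huk, hd.addLin ht h₁ h₀,
      quadResultant_addLin_pos hR (eval_mul_eval_addLin_pos hs ht (htu.trans huk)),
      Or.inr (Or.inl ⟨(hα t u htu).trans hαu, e⟩)⟩
  rcases le_or_gt (alpha₂ (poleQuad x f₁ f₀) (d.addLin k f₁ f₀)) 0 with hαk | hαk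
  · rcases le_or_gt 0 (lambda₃ (poleQuad x f₁ f₀) (d.addLin k f₁ f₀)) with hlk | hlk
    · exact Or.inl (C_add_mem_impedanceSet (quad_div_mem_one_one_of_lambda₃
        (poleQuad_nonneg hx h₁ h₀) (hd.addLin hk.le h₁ h₀) (quadResultant_addLin_pos hR hs)
        hαk hlk) hr)
    · exact Or.inr (key k hk.le le_rfl hαk hlk)
  · obtain ⟨u, hu, huk, e⟩ := exists_zero_of_mul_nonpos
      (g := fun t => alpha₂ (poleQuad x f₁ f₀) (d.addLin t f₁ f₀))
      (by simp only [alpha₂, Quad.addLin]; fun_prop) hk.le (by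
        rw [Quad.addLin_zero]
        exact mul_nonpos_of_nonpos_of_nonneg h₂ hαk.le)
    have huk' : u ≠ k := by
      rintro rfl
      exact hαk.ne' e
    have huk' := lt_of_le_of_ne huk huk'
    rcases le_or_gt 0 (lambda₃ (poleQuad x f₁ f₀) (d.addLin u f₁ f₀)) with hlu | hlu
    · have hsu := eval_mul_eval_addLin_pos hs hu huk
      have hRu := quadResultant_addLin_pos hR hsu
      have hdu := hd.addLin hu h₁ h₀
      have ek : (d.addLin u f₁ f₀).addLin (k - u) f₁ f₀ = d.addLin k f₁ f₀ := by
        rw [Quad.addLin_addLin, add_sub_cancel]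
      have hsu' : 0 < (d.addLin u f₁ f₀).eval (-x) * (d.addLin k f₁ f₀).eval (-x) := by
        have h := mul_pos hsu hs
        have e' : d.eval (-x) * (d.addLin u f₁ f₀).eval (-x) *
            (d.eval (-x) * (d.addLin k f₁ f₀).eval (-x)) =
            d.eval (-x) ^ 2 * ((d.addLin u f₁ f₀).eval (-x) * (d.addLin k f₁ f₀).eval (-x)) := by
          ring
        rw [e'] at h
        exact pos_of_mul_pos_right h (sq_nonneg _)
      have := deform_of_lambda₁ hr (sub_pos.2 huk') hx h₁ h₀ hdu hRu e.ge
        (lambda₁_nonneg_of_lambda₃ (poleQuad_nonneg hx h₁ h₀) hdu hRu e hlu) (by rwa [ek])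
      rw [ek] at this
      rcases this with h | ⟨t, htk, h, h'⟩
      · exact Or.inl h
      · rw [Quad.addLin_addLin] at h h'
        exact Or.inr ⟨u + t, by linarith, h, h'⟩
    · exact Or.inr (key u hu huk e.le hlu)

/-- Lowering `t` affects only the two lower coefficients. The stopping point is minus the smaller of
the ratios `dᵢ / fᵢ`, taken over the positive `fᵢ`. -/
theorem exists_addLin_coeff_eq_zero (h₁ : 0 ≤ f₁) (h₀ : 0 ≤ f₀) (hf : f₁ ≠ 0 ∨ f₀ ≠ 0)
    (hd : d.Nonneg) : ∃ s, s ≤ 0 ∧ (∀ t, s ≤ t → (d.addLin t f₁ f₀).Nonneg) ∧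
      ((d.addLin s f₁ f₀).c₀ = 0 ∨ (d.addLin s f₁ f₀).c₁ = 0) := by
  obtain ⟨d₂, d₁, d₀⟩ := d
  obtain ⟨hd₀, hd₁, hd₂⟩ := hd
  simp only [Quad.addLin, Quad.Nonneg] at *
  rcases h₁.eq_or_lt with rfl | h₁'
  · have h₀' := h₀.lt_of_ne' (hf.resolve_left (not_not.2 rfl))
    refine ⟨-(d₀ / f₀), by simp only [Left.neg_nonpos_iff]; positivity,
      fun t ht => ⟨?_, by simpa using hd₁, hd₂⟩,
      Or.inl (by field_simp; ring)⟩
    rw [neg_le, le_div_iff₀ h₀'] at ht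
    linarith
  rcases h₀.eq_or_lt with rfl | h₀'
  · refine ⟨-(d₁ / f₁), by simp only [Left.neg_nonpos_iff]; positivity,
      fun t ht => ⟨by simpa using hd₀, ?_, hd₂⟩,
      Or.inr (by field_simp; ring)⟩
    rw [neg_le, le_div_iff₀ h₁'] at ht
    linarith
  have e₀ : d₀ = d₀ / f₀ * f₀ := by field_simp
  have e₁ : d₁ = d₁ / f₁ * f₁ := by field_simp
  have p₀ : 0 ≤ d₀ / f₀ := by positivity
  have p₁ : 0 ≤ d₁ / f₁ := by positivity
  rcases le_total (d₀ / f₀) (d₁ / f₁) with h | h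
  · refine ⟨-(d₀ / f₀), by linarith, fun t ht => ⟨?_, ?_, hd₂⟩, Or.inl (by linarith)⟩ <;> nlinarith
  · refine ⟨-(d₁ / f₁), by linarith, fun t ht => ⟨?_, ?_, hd₂⟩, Or.inr (by linarith)⟩ <;> nlinarith

/-- Both inequalities improve as `t` decreases, so the inductive branch is enlarged until a
coefficient of `d` vanishes. If it is the linear one, then `λ₄ = c₀ α₂ - c₁² d₀ ≤ 0`, so `λ₄ = 0`.
-/
theorem deform_of_lambda₄ (hr : 0 ≤ r) (hk : 0 < k) (hx : 0 ≤ x) (h₁ : 0 ≤ f₁) (h₀ : 0 ≤ f₀)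
    (hf : f₁ ≠ 0 ∨ f₀ ≠ 0) (hd : d.Nonneg)
    (hR : 0 < quadResultant (poleQuad x f₁ f₀) d) (h₂ : alpha₂ (poleQuad x f₁ f₀) d ≤ 0)
    (hl : 0 ≤ lambda₄ (poleQuad x f₁ f₀) d) :
    RatFunc.C r + (poleQuad x f₁ f₀).toRatFunc / (d.addLin k f₁ f₀).toRatFunc ∈ impedanceSet 1 1 ∨
    RatFunc.C r + (poleQuad x f₁ f₀).toRatFunc / (d.addLin k f₁ f₀).toRatFunc ∈ impedanceSet 0 2 ∨
    ∃ t < k, (d.addLin t f₁ f₀).Nonneg ∧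
      IsBoundaryPair (poleQuad x f₁ f₀) (d.addLin t f₁ f₀) := by
  obtain ⟨s, hs, hn, hz⟩ := exists_addLin_coeff_eq_zero h₁ h₀ hf hd
  rcases le_or_gt (d.eval (-x) * (d.addLin s f₁ f₀).eval (-x)) 0 with hsgn | hsgn
  · obtain ⟨t, hst, ht, e⟩ := exists_zero_of_mul_nonpos (continuous_eval_addLin d f₁ f₀ (-x)) hs (by
      rw [Quad.addLin_zero, mul_comm]
      exact hsgn)
    rcases mem_of_eval_eq_zero_of_addLin hr (ht.trans_lt hk) hx h₁ h₀ hf (hn t hst) e with h | h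
    · exact Or.inl h
    · exact Or.inr (Or.inl h)
  · have hα : alpha₂ (poleQuad x f₁ f₀) (d.addLin s f₁ f₀) ≤ 0 := by
      rw [alpha₂_addLin]
      have := mul_nonpos_of_nonpos_of_nonneg hs (mul_nonneg h₁ h₀)
      linarith
    have hls : 0 ≤ lambda₄ (poleQuad x f₁ f₀) (d.addLin s f₁ f₀) := by
      rw [lambda₄_addLin]
      have := mul_nonpos_of_nonpos_of_nonneg hs (pow_nonneg h₀ 3)
      linarith
    refine Or.inr (Or.inr ⟨s, hs.trans_lt hk, hn s le_rfl, quadResultant_addLin_pos hR hsgn,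
      Or.inr (Or.inr ⟨hα, hls, ?_⟩)⟩)
    rcases hz with hz | hz
    · exact Or.inr hz
    · refine Or.inl (le_antisymm ?_ hls)
      have hc := poleQuad_nonneg hx h₁ h₀
      have hns := hn s le_rfl
      simp only [lambda₄]
      have e₁ : alpha₁ (poleQuad x f₁ f₀) (d.addLin s f₁ f₀) =
          (poleQuad x f₁ f₀).c₁ * (d.addLin s f₁ f₀).c₀ := by
        rw [alpha₁, hz, mul_zero, sub_zero]
      rw [e₁]
      have := mul_nonneg hc.2.1 (mul_nonneg hc.2.1 hns.1)
      have := mul_nonpos_of_nonneg_of_nonpos hc.1 hα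
      linarith

/-- The deformation that moves part of the inductive branch into a regular network or back leads to
a boundary pair or saves an element. -/
theorem IsRegularPair.deform (hr : 0 ≤ r) (hk : 0 < k) (hx : 0 ≤ x) (h₁ : 0 ≤ f₁) (h₀ : 0 ≤ f₀)
    (hd : d.Nonneg) (hb : (d.addLin k f₁ f₀).eval (-x) ≠ 0)
    (h : IsRegularPair (poleQuad x f₁ f₀) d) :
    RatFunc.C r + (poleQuad x f₁ f₀).toRatFunc / (d.addLin k f₁ f₀).toRatFunc ∈ impedanceSet 1 1 ∨
    RatFunc.C r + (poleQuad x f₁ f₀).toRatFunc / (d.addLin k f₁ f₀).toRatFunc ∈ impedanceSet 0 2 ∨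
    ∃ t < k, (d.addLin t f₁ f₀).Nonneg ∧
      IsBoundaryPair (poleQuad x f₁ f₀) (d.addLin t f₁ f₀) := by
  obtain ⟨hR, h⟩ := h
  have hf : f₁ ≠ 0 ∨ f₀ ≠ 0 := by
    by_contra! hf
    exact hR.ne' (by rw [quadResultant_poleQuad, hf.1, hf.2]; ring)
  -- If `d + t F` acquires the root `-x` on the way, the factor `s + x` cancels against `c`, and a
  -- bilinear network beside the inductive branch remains.
  rcases le_or_gt (d.eval (-x) * (d.addLin k f₁ f₀).eval (-x)) 0 with hs | hs
  · obtain ⟨t, ht, htk, e⟩ := exists_zero_of_mul_nonpos (continuous_eval_addLin d f₁ f₀ (-x)) hk.le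
      (by rwa [Quad.addLin_zero])
    have htk' : t ≠ k := by
      rintro rfl
      exact hb e
    rcases mem_of_eval_eq_zero_of_addLin hr (lt_of_le_of_ne htk htk') hx h₁ h₀ hf
      (hd.addLin ht h₁ h₀) e with h | h
    · exact Or.inl h
    · exact Or.inr (Or.inl h)
  rcases h with ⟨h₂, hl⟩ | ⟨h₂, hl⟩ | ⟨h₂, hl⟩ | ⟨h₂, hl⟩
  · rcases deform_of_lambda₁ hr hk hx h₁ h₀ hd hR h₂ hl hs with h | h
    · exact Or.inl h
    · exact Or.inr (Or.inr h)
  · rcases deform_of_lambda₃ hr hk hx h₁ h₀ hd hR h₂ hl hs with h | h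
    · exact Or.inl h
    · exact Or.inr (Or.inr h)
  · exact deform_of_lambda₄ hr hk hx h₁ h₀ hf hd hR h₂ hl
  -- Both `α₂` and `λ₂` only grow, so the whole branch is absorbed. Hence no boundary pair with `λ₂`
  -- is needed.
  · refine Or.inl (C_add_mem_impedanceSet (IsRegularPair.quad_div_mem
      ⟨quadResultant_addLin_pos hR hs, Or.inr (Or.inr (Or.inr ⟨?_, ?_⟩))⟩
      (poleQuad_nonneg hx h₁ h₀) (hd.addLin hk.le h₁ h₀)) hr)
    · rw [alpha₂_addLin]
      positivity
    · rw [lambda₂_addLin]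
      positivity

/-- The same deformation for a network that the frequency inversion makes inductive. -/
theorem IsInductivePair.deform (hr : 0 ≤ r) (hk : 0 < k) (hx : 0 ≤ x) (h₁ : 0 ≤ f₁) (h₀ : 0 ≤ f₀)
    (hd : d.Nonneg) (h : IsInductivePair (poleQuad x f₁ f₀).reverse d.reverse) :
    RatFunc.C r + (poleQuad x f₁ f₀).toRatFunc / (d.addLin k f₁ f₀).toRatFunc ∈ impedanceSet 1 1 ∨
    ∃ t < k, (d.addLin t f₁ f₀).Nonneg ∧
      IsInductivePair (poleQuad x f₁ f₀).reverse (d.addLin t f₁ f₀).reverse ∧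
      (d.addLin t f₁ f₀).c₀ = 0 := by
  obtain ⟨hR, h⟩ := h
  -- Reversal negates the `αᵢ` and swaps `α₁` with `α₃`, so all three are non-positive for the
  -- unreversed pair. This persists as `t` decreases.
  have ea : ∀ c d : Quad, alpha₁ c.reverse d.reverse = -alpha₃ c d ∧
      alpha₂ c.reverse d.reverse = -alpha₂ c d ∧ alpha₃ c.reverse d.reverse = -alpha₁ c d := by
    intro c d
    refine ⟨?_, ?_, ?_⟩ <;> simp only [alpha₁, alpha₂, alpha₃, Quad.reverse] <;> ring
  obtain ⟨e₁, e₂, e₃⟩ := ea (poleQuad x f₁ f₀) d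
  rw [e₁, e₂, e₃] at h
  rw [quadResultant_reverse] at hR
  have hf : f₁ ≠ 0 ∨ f₀ ≠ 0 := by
    by_contra! hf
    exact hR.ne (by rw [quadResultant_poleQuad, hf.1, hf.2]; ring)
  obtain ⟨s, hs, hn, hz⟩ := exists_addLin_coeff_eq_zero h₁ h₀ hf hd
  have hα₃ : ∀ t, t ≤ 0 → alpha₃ (poleQuad x f₁ f₀) (d.addLin t f₁ f₀) ≤ 0 := by
    intro t ht
    rw [alpha₃_addLin]
    have := mul_nonpos_of_nonpos_of_nonneg ht (sq_nonneg f₁)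
    linarith [h.1]
  rcases le_or_gt (d.eval (-x) * (d.addLin s f₁ f₀).eval (-x)) 0 with hsgn | hsgn
  · obtain ⟨t, hst, ht, e⟩ := exists_zero_of_mul_nonpos (continuous_eval_addLin d f₁ f₀ (-x)) hs (by
      rw [Quad.addLin_zero, mul_comm]
      exact hsgn)
    have ek : d.addLin k f₁ f₀ = (d.addLin t f₁ f₀).addLin (k - t) f₁ f₀ := by
      rw [Quad.addLin_addLin, add_sub_cancel]
    rw [ek]
    refine Or.inl (mem_of_eval_eq_zero (n := 0) hr (by linarith) hx h₁ h₀ hf (hn t hst) e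
      fun he => linRat_div_mem_one_zero h₁ h₀ (hn t hst).2.2 he ?_)
    have := hα₃ t ht
    simp only [alpha₃, poleQuad] at this
    linarith
  · have hα₁ : alpha₁ (poleQuad x f₁ f₀) (d.addLin s f₁ f₀) ≤ 0 := by
      rw [alpha₁_addLin]
      have := mul_nonpos_of_nonpos_of_nonneg hs (sq_nonneg f₀)
      linarith [h.2.2]
    have hα₂ : alpha₂ (poleQuad x f₁ f₀) (d.addLin s f₁ f₀) ≤ 0 := by
      rw [alpha₂_addLin]
      have := mul_nonpos_of_nonpos_of_nonneg hs (mul_nonneg h₁ h₀)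
      linarith [h.2.1]
    have hRs := quadResultant_addLin_neg hR hsgn
    obtain ⟨e₁, e₂, e₃⟩ := ea (poleQuad x f₁ f₀) (d.addLin s f₁ f₀)
    refine Or.inr ⟨s, hs.trans_lt hk, hn s le_rfl, ⟨by rwa [quadResultant_reverse], ?_, ?_, ?_⟩, ?_⟩
    · rw [e₁]
      linarith [hα₃ s hs]
    · rw [e₂]
      linarith
    · rw [e₃]
      linarith
    -- A vanishing linear coefficient would give `α₁ ≥ 0`, hence `α₁ = 0`, and the resultant `α₂²`
    -- could not be negative.
    · refine hz.resolve_right fun hz => ?_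
      have hpos : 0 ≤ alpha₁ (poleQuad x f₁ f₀) (d.addLin s f₁ f₀) := by
        rw [alpha₁, hz, mul_zero, sub_zero]
        exact mul_nonneg (poleQuad_nonneg hx h₁ h₀).2.1 (hn s le_rfl).1
      have h0 := le_antisymm hα₁ hpos
      rw [quadResultant, h0] at hRs
      nlinarith [sq_nonneg (alpha₂ (poleQuad x f₁ f₀) (d.addLin s f₁ f₀))]

end Deformation

/-! ### Algebra of the derived data -/

namespace Quad

/-- The polynomial `t p(s)`. -/
def smul (t : ℝ) (p : Quad) : Quad := ⟨t * p.c₂, t * p.c₁, t * p.c₀⟩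

theorem reverse_smul (t : ℝ) (p : Quad) : (smul t p).reverse = smul t p.reverse := rfl

theorem toRatFunc_smul (t : ℝ) (p : Quad) :
    (smul t p).toRatFunc = RatFunc.C t * p.toRatFunc := by
  simp only [smul, toRatFunc, map_mul]
  ring

theorem toRatFunc_smul_div_smul {t : ℝ} (ht : t ≠ 0) (p q : Quad) :
    (smul t p).toRatFunc / (smul t q).toRatFunc = p.toRatFunc / q.toRatFunc := by
  rw [toRatFunc_smul, toRatFunc_smul, mul_div_mul_left _ _ (RatFunc.C_ne_zero ht)]

/-- The polynomial `r p(s) + q(s)`. -/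
def mulAdd (r : ℝ) (p q : Quad) : Quad := ⟨r * p.c₂ + q.c₂, r * p.c₁ + q.c₁, r * p.c₀ + q.c₀⟩

theorem toRatFunc_mulAdd (r : ℝ) (p q : Quad) :
    (mulAdd r p q).toRatFunc = RatFunc.C r * p.toRatFunc + q.toRatFunc := by
  simp only [mulAdd, toRatFunc, map_mul, map_add]
  ring

theorem Nonneg.mulAdd {r : ℝ} {p q : Quad} (hr : 0 ≤ r) (hp : p.Nonneg) (hq : q.Nonneg) :
    (mulAdd r p q).Nonneg :=
  ⟨add_nonneg (mul_nonneg hr hp.1) hq.1, add_nonneg (mul_nonneg hr hp.2.1) hq.2.1,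
    add_nonneg (mul_nonneg hr hp.2.2) hq.2.2⟩

end Quad

section Homogeneity

variable (t : ℝ) (c d : Quad)

theorem alpha₂_smul : alpha₂ (c.smul t) (d.smul t) = t ^ 2 * alpha₂ c d := by
  simp only [alpha₂, Quad.smul]; ring

theorem lambda₁_smul : lambda₁ (c.smul t) (d.smul t) = t ^ 3 * lambda₁ c d := by
  simp only [lambda₁, alpha₁, alpha₂, Quad.smul]; ring

theorem lambda₂_smul : lambda₂ (c.smul t) (d.smul t) = t ^ 3 * lambda₂ c d := by
  simp only [lambda₂, alpha₃, alpha₂, Quad.smul]; ring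

theorem lambda₃_smul : lambda₃ (c.smul t) (d.smul t) = t ^ 3 * lambda₃ c d := by
  simp only [lambda₃, alpha₃, alpha₂, Quad.smul]; ring

theorem lambda₄_smul : lambda₄ (c.smul t) (d.smul t) = t ^ 3 * lambda₄ c d := by
  simp only [lambda₄, alpha₁, alpha₂, Quad.smul]; ring

theorem quadResultant_smul :
    quadResultant (c.smul t) (d.smul t) = t ^ 4 * quadResultant c d := by
  simp only [quadResultant, alpha₁, alpha₂, alpha₃, Quad.smul]; ring

theorem quadResultant_mulAdd : quadResultant (Quad.mulAdd t d c) d = quadResultant c d := by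
  simp only [quadResultant, alpha₁, alpha₂, alpha₃, Quad.mulAdd]; ring

end Homogeneity

/-- These are the coefficients of `(s + x) (f₁ s + f₀) = b̃ a(s) - ã b(s)`. The right side vanishes
at `-x`, and the Bezoutian at `-x` supplies the quotient. -/
theorem derivedA_f (a b : Quad) (x z : ℝ) :
    (derivedA a b x z).f₁ = (derivedA a b x z).tb * a.c₂ - (derivedA a b x z).ta * b.c₂ ∧
    (derivedA a b x z).f₀ + x * (derivedA a b x z).f₁ =
      (derivedA a b x z).tb * a.c₁ - (derivedA a b x z).ta * b.c₁ ∧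
    x * (derivedA a b x z).f₀ =
      (derivedA a b x z).tb * a.c₀ - (derivedA a b x z).ta * b.c₀ := by
  simp only [derivedA, bezoutian, Quad.eval, Matrix.vecMul, dotProduct, Fin.sum_univ_two,
    Matrix.of_apply, Matrix.cons_val_zero, Matrix.cons_val_one, Matrix.cons_val',
    Matrix.cons_val_fin_one]
  refine ⟨?_, ?_, ?_⟩ <;> ring

theorem derivedA_c (a b : Quad) (x z : ℝ) :
    (derivedA a b x z).c = poleQuad x (derivedA a b x z).f₁ (derivedA a b x z).f₀ := rfl

theorem derivedA_d (a b : Quad) (x z : ℝ) :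
    (derivedA a b x z).d = Quad.smul (derivedA a b x z).tb
      (b.addLin (-z) (derivedA a b x z).f₁ (derivedA a b x z).f₀) := by
  simp only [derivedA, Quad.smul, Quad.addLin, Quad.mk.injEq]
  refine ⟨trivial, ?_, ?_⟩ <;> ring

theorem derivedA_th (a b : Quad) (x z : ℝ) :
    (derivedA a b x z).th =
      (b.addLin (-z) (derivedA a b x z).f₁ (derivedA a b x z).f₀).eval (-x) := by
  simp only [derivedA, Quad.eval, Quad.addLin]
  ring

/-- The data (B) are the data (A) after `s ↦ 1 / s`, so condition (V) can be treated through (A). -/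
theorem derivedB_eq (a b : Quad) (x z : ℝ) :
    derivedB a b x z =
      { ta := (derivedA a.reverse b.reverse x z).ta
        tb := (derivedA a.reverse b.reverse x z).tb
        th := (derivedA a.reverse b.reverse x z).th
        f₀ := (derivedA a.reverse b.reverse x z).f₁
        f₁ := (derivedA a.reverse b.reverse x z).f₀
        c := (derivedA a.reverse b.reverse x z).c.reverse
        d := (derivedA a.reverse b.reverse x z).d.reverse } := by
  simp only [derivedA, derivedB, bezoutian, Quad.eval, Quad.reverse, Matrix.vecMul, dotProduct,
    Fin.sum_univ_two, Matrix.of_apply, Matrix.cons_val_zero, Matrix.cons_val_one,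
    Matrix.cons_val', Matrix.cons_val_fin_one, Pi.neg_apply, DerivedData.mk.injEq, Quad.mk.injEq]
  refine ⟨?_, ?_, ?_, ?_, ?_, ⟨?_, ?_, ?_⟩, ⟨?_, ?_, ?_⟩⟩ <;> ring

/-- Passing from `a` to `c = b̃ a - ã b` multiplies the resultant with `b` by `b̃²`; passing from
`b` to `h` replaces its factor `b(-x)` by `h(-x)`. The sign condition on `b̃ h̃ R₀` is thus a
condition on the resultant of `c` and `d`. -/
theorem quadResultant_derivedA {a b : Quad} {x z : ℝ} (hb : (derivedA a b x z).tb ≠ 0) :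
    quadResultant (derivedA a b x z).c (derivedA a b x z).d = -((derivedA a b x z).tb ^ 2 *
      ((derivedA a b x z).tb * (derivedA a b x z).th * sylvesterR0 a b)) := by
  obtain ⟨h₁, h₂, h₃⟩ := derivedA_f a b x z
  have htb : (derivedA a b x z).tb = b.eval (-x) := rfl
  rw [derivedA_c, derivedA_d, derivedA_th, sylvesterR0_eq]
  generalize (derivedA a b x z).tb = tb at *
  generalize (derivedA a b x z).ta = ta at *
  generalize (derivedA a b x z).f₁ = f₁ at *
  generalize (derivedA a b x z).f₀ = f₀ at *
  have e₁ : quadResultant (poleQuad x f₁ f₀) b = tb ^ 2 * quadResultant a b := by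
    simp only [quadResultant, alpha₁, alpha₂, alpha₃, poleQuad]
    rw [h₂, h₃, h₁]
    ring
  rw [quadResultant_poleQuad, ← htb] at e₁
  have e₂ : b.c₂ * f₀ ^ 2 - b.c₁ * f₀ * f₁ + b.c₀ * f₁ ^ 2 = tb * quadResultant a b := by
    apply mul_left_cancel₀ hb
    rw [e₁]
    ring
  have e₃ : quadResultant (poleQuad x f₁ f₀) ((b.addLin (-z) f₁ f₀).smul tb) =
      tb ^ 2 * quadResultant (poleQuad x f₁ f₀) (b.addLin (-z) f₁ f₀) := by
    simp only [quadResultant, alpha₁, alpha₂, alpha₃, Quad.smul]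
    ring
  have e₄ : (b.addLin (-z) f₁ f₀).c₂ * f₀ ^ 2 - (b.addLin (-z) f₁ f₀).c₁ * f₀ * f₁ +
      (b.addLin (-z) f₁ f₀).c₀ * f₁ ^ 2 = tb * quadResultant a b := by
    rw [← e₂]
    simp only [Quad.addLin]
    ring
  rw [e₃, quadResultant_poleQuad, e₄]
  ring

theorem quadResultant_eq_zero_of_eval {a b : Quad} {x : ℝ} (ha : a.eval x = 0)
    (hb : b.eval x = 0) : quadResultant a b = 0 := by
  have e : quadResultant a b =
      ((alpha₃ a b * x - alpha₂ a b) * b.c₂ + alpha₃ a b * b.c₁) * a.eval x -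
      ((alpha₃ a b * x - alpha₂ a b) * a.c₂ + alpha₃ a b * a.c₁) * b.eval x := by
    simp only [quadResultant, alpha₁, alpha₂, alpha₃, Quad.eval]
    ring
  rw [e, ha, hb]
  ring

theorem quad_zero_of_common {x ta f₁ f₀ : ℝ} {b : Quad} (hx : 0 ≤ x) (hb : b.Nonneg) (hta : 0 < ta)
    (hf₁ : 0 ≤ f₁) (hf₀ : 0 ≤ f₀) (e₁ : f₁ = -ta * b.c₂) (e₂ : f₀ + x * f₁ = -ta * b.c₁)
    (e₃ : b.eval (-x) = 0) : b.c₂ = 0 ∧ b.c₁ = 0 ∧ b.c₀ = 0 := by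
  have h₂ : b.c₂ = 0 := le_antisymm (by nlinarith) hb.2.2
  have h₁ : b.c₁ = 0 := le_antisymm (by nlinarith [mul_nonneg hx hf₁]) hb.2.1
  refine ⟨h₂, h₁, ?_⟩
  simpa [Quad.eval, h₁, h₂] using e₃

/-! ### Sufficiency: from the conditions to a network -/

theorem SameSign.exists_sign {t : ℝ} {l : List ℝ} (h : SameSign l) (ht : t ∈ l) (ht0 : t ≠ 0) :
    ∃ ε : ℝ, (ε = 1 ∨ ε = -1) ∧ 0 < ε * t ∧ ∀ u ∈ l, 0 ≤ ε * u := by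
  rcases h with h | h
  · refine ⟨1, Or.inl rfl, ?_, fun u hu => by simpa using h u hu⟩
    simpa using (h t ht).lt_of_ne' ht0
  · refine ⟨-1, Or.inr rfl, ?_, fun u hu => by simpa using h u hu⟩
    simpa using (h t ht).lt_of_ne ht0

/-- If `b(-x) = 0`, coprimality gives `ã ≠ 0`, and `f₁ = -ã b₂`, `f₀ + x f₁ = -ã b₁`. Since `f₀, f₁`
share the sign of `ã` while the coefficients of `b` are non-negative, `b` would be zero. -/
theorem CommonCond.tb_ne_zero {a b : Quad} {x z l : ℝ}
    (h : CommonCond a b z (derivedA a b x z) l) (hx : 0 ≤ x) : (derivedA a b x z).tb ≠ 0 := by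
  obtain ⟨ha, hb, hS, -, hR⟩ := h
  rw [sylvesterR0_eq, neg_ne_zero] at hR
  intro h0
  obtain ⟨h₁, h₂, -⟩ := derivedA_f a b x z
  rw [h0, zero_mul, zero_sub] at h₁ h₂
  have hbe : b.eval (-x) = 0 := h0
  have hta : (derivedA a b x z).ta ≠ 0 := by
    intro h
    exact hR (quadResultant_eq_zero_of_eval h hbe)
  obtain ⟨ε, -, hε, hl⟩ := SameSign.exists_sign hS (by simp) hta
  refine absurd (right_ne_zero_of_quadResultant hR) ?_
  have h₃ := hl (derivedA a b x z).f₁ (by simp)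
  have h₄ := hl (derivedA a b x z).f₀ (by simp)
  have := quad_zero_of_common hx hb hε h₃ h₄ (by rw [h₁]; ring)
    (by linear_combination ε * h₂) hbe
  simp [this]

theorem CommonCond.exists_sign {a b : Quad} {x z l : ℝ}
    (h : CommonCond a b z (derivedA a b x z) l) (hx : 0 ≤ x) (hz : z ≠ 0) :
    ∃ ε : ℝ, (ε = 1 ∨ ε = -1) ∧ 0 < ε * (derivedA a b x z).tb ∧ 0 ≤ ε * (derivedA a b x z).ta ∧
      0 < ε * z ∧ 0 ≤ ε * l ∧ ((derivedA a b x z).c.smul ε).Nonneg ∧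
      ((derivedA a b x z).d.smul ε).Nonneg := by
  have htb := h.tb_ne_zero hx
  obtain ⟨ha, hb, hS, -, -⟩ := h
  obtain ⟨ε, hε, htb', hl⟩ := SameSign.exists_sign hS (by simp) htb
  have hε0 : ε ≠ 0 := by rcases hε with rfl | rfl <;> norm_num
  have hf₁ := hl (derivedA a b x z).f₁ (by simp)
  have hf₀ := hl (derivedA a b x z).f₀ (by simp)
  refine ⟨ε, hε, htb', hl _ (by simp), (hl z (by simp)).lt_of_ne' (mul_ne_zero hε0 hz),
    hl _ (by simp), ?_, hl _ (by simp), hl _ (by simp), hl _ (by simp)⟩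
  rw [derivedA_c]
  refine ⟨?_, ?_, hf₁⟩
  · simp only [Quad.smul, poleQuad]
    rw [mul_left_comm]
    exact mul_nonneg hx hf₀
  · simp only [Quad.smul, poleQuad]
    rw [mul_add, mul_left_comm]
    exact add_nonneg hf₀ (mul_nonneg hx hf₁)

theorem parallel_decomposition {K : Type*} [Field K] {A B F L ta tb z : K} (hB : B ≠ 0)
    (hL : L ≠ 0) (hF : F ≠ 0) (htb : tb ≠ 0) (h : L * F = tb * A - ta * B) :
    A / B = ta / tb + ((L * F / (tb * (B - z * F)))⁻¹ + (L / (tb * z))⁻¹)⁻¹ := by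
  have e : (L * F / (tb * (B - z * F)))⁻¹ + (L / (tb * z))⁻¹ = tb * B / (L * F) := by
    rw [inv_div, inv_div]
    field_simp
    ring
  rw [e, inv_div, h, div_add_div _ _ htb (mul_ne_zero htb hB), div_eq_div_iff hB
    (mul_ne_zero htb (mul_ne_zero htb hB))]
  ring

theorem linRat_one_div_C_mem {x k : ℝ} (hx : 0 ≤ x) (hk : 0 < k) :
    linRat 1 x / RatFunc.C k ∈ impedanceSet 0 1 := by
  have := linRat_div_mem_zero_one zero_le_one hx le_rfl hk.le (by simpa using hk.le)
  simpa [linRat] using this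

/-- By `parallel_decomposition`, `a / b` is the resistor `ã / b̃` in series with the parallel
connection of `c / d` and the inductive branch `(s + x) / (b̃ z)`. The common sign makes `ã / b̃ ≥
0` and `b̃ z > 0`. -/
theorem mem_of_derivedA {a b : Quad} {x z l : ℝ} {m n : ℕ}
    (h : CommonCond a b z (derivedA a b x z) l) (hx : 0 ≤ x) (hz : z ≠ 0)
    (hmem : (derivedA a b x z).c.toRatFunc / (derivedA a b x z).d.toRatFunc ∈ impedanceSet m n) :
    a.toRatFunc / b.toRatFunc ∈ impedanceSet m (n + 1) := by
  have htb := h.tb_ne_zero hx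
  obtain ⟨ε, hε, hε₁, hε₂, hε₃, -, hc, hd⟩ := h.exists_sign hx hz
  obtain ⟨ha, hb, -, hth, hR⟩ := h
  have hR' := quadResultant_derivedA (a := a) (b := b) (x := x) (z := z) htb
  have hR₀ : quadResultant (derivedA a b x z).c (derivedA a b x z).d ≠ 0 := by
    rw [hR']
    exact neg_ne_zero.2 (mul_ne_zero (pow_ne_zero _ htb) (mul_ne_zero (mul_ne_zero htb hth) hR))
  rw [sylvesterR0_eq, neg_ne_zero] at hR
  have hε0 : ε ≠ 0 := by rcases hε with rfl | rfl <;> norm_num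
  have hεε : ε * ε = 1 := by rcases hε with rfl | rfl <;> norm_num
  have hRε : quadResultant ((derivedA a b x z).c.smul ε) ((derivedA a b x z).d.smul ε) ≠ 0 := by
    rw [quadResultant_smul]
    exact mul_ne_zero (pow_ne_zero _ hε0) hR₀
  have hc0 := (Quad.isPosRat_toRatFunc hc (left_ne_zero_of_quadResultant hRε)).ne_zero
  have hd0 := (Quad.isPosRat_toRatFunc hd (right_ne_zero_of_quadResultant hRε)).ne_zero
  rw [Quad.toRatFunc_smul] at hc0 hd0
  have hc0 := right_ne_zero_of_mul hc0
  have hd0 := right_ne_zero_of_mul hd0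
  have hB := (Quad.isPosRat_toRatFunc hb (right_ne_zero_of_quadResultant hR)).ne_zero
  have hL := linRat_ne_zero zero_le_one hx (Or.inl one_ne_zero)
  have hk : 0 < (derivedA a b x z).tb * z := by
    have := mul_pos hε₁ hε₃
    have e : ε * (derivedA a b x z).tb * (ε * z) = ε * ε * ((derivedA a b x z).tb * z) := by ring
    rwa [e, hεε, one_mul] at this
  have hr : 0 ≤ (derivedA a b x z).ta / (derivedA a b x z).tb := by
    have := div_nonneg hε₂ hε₁.le
    rwa [mul_div_mul_left _ _ hε0] at this
  have eL : linRat 1 x * linRat (derivedA a b x z).f₁ (derivedA a b x z).f₀ =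
      RatFunc.C (derivedA a b x z).tb * a.toRatFunc -
      RatFunc.C (derivedA a b x z).ta * b.toRatFunc := by
    obtain ⟨h₁, h₂, h₃⟩ := derivedA_f a b x z
    rw [← toRatFunc_poleQuad]
    simp only [poleQuad, Quad.toRatFunc]
    rw [h₂, h₃, h₁]
    simp only [map_sub, map_mul]
    ring
  have hLF : linRat 1 x * linRat (derivedA a b x z).f₁ (derivedA a b x z).f₀ ≠ 0 := by
    rw [← toRatFunc_poleQuad, ← derivedA_c]
    exact hc0
  have e := parallel_decomposition (z := RatFunc.C z) hB hL (right_ne_zero_of_mul hLF)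
    (RatFunc.C_ne_zero htb) eL
  rw [e, ← map_div₀, ← map_mul]
  refine C_add_mem_impedanceSet ?_ hr
  have ed : RatFunc.C (derivedA a b x z).tb * (b.toRatFunc - RatFunc.C z *
      linRat (derivedA a b x z).f₁ (derivedA a b x z).f₀) = (derivedA a b x z).d.toRatFunc := by
    rw [derivedA_d, Quad.toRatFunc_smul, Quad.toRatFunc_addLin, map_neg]
    ring
  rw [ed, ← toRatFunc_poleQuad, ← derivedA_c]
  have := parallel_mem_impedanceSet hmem (linRat_one_div_C_mem hx hk) (div_ne_zero hc0 hd0)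
    (div_ne_zero hL (RatFunc.C_ne_zero hk.ne'))
  rwa [add_zero] at this

/-- Scaling `c` and `d` by the common sign `ε` keeps the quotient and makes the coefficients
non-negative. The resultant has even degree, so its sign is kept as well. -/
theorem derivedA_mem_one_one {a b : Quad} {x z l : ℝ}
    (h : CommonCond a b z (derivedA a b x z) l) (hx : 0 ≤ x) (hz : z ≠ 0)
    (hsgn : (derivedA a b x z).tb * (derivedA a b x z).th * sylvesterR0 a b ≤ 0)
    (hreg : ∀ ε : ℝ, 0 ≤ ε * l → (ε = 1 ∨ ε = -1) →
      let c := (derivedA a b x z).c.smul ε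
      let d := (derivedA a b x z).d.smul ε
      (0 ≤ alpha₂ c d ∧ 0 ≤ lambda₁ c d) ∨ (alpha₂ c d ≤ 0 ∧ 0 ≤ lambda₃ c d) ∨
      (alpha₂ c d ≤ 0 ∧ 0 ≤ lambda₄ c d) ∨ (0 ≤ alpha₂ c d ∧ 0 ≤ lambda₂ c d)) :
    a.toRatFunc / b.toRatFunc ∈ impedanceSet 1 2 := by
  have htb := h.tb_ne_zero hx
  refine mem_of_derivedA h hx hz ?_
  obtain ⟨ε, hε, hε₁, hε₂, hε₃, hl, hc, hd⟩ := h.exists_sign hx hz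
  have hε0 : ε ≠ 0 := by rcases hε with rfl | rfl <;> norm_num
  have hne := mul_ne_zero (mul_ne_zero htb h.2.2.2.1) h.2.2.2.2
  rw [← Quad.toRatFunc_smul_div_smul hε0]
  refine IsRegularPair.quad_div_mem ⟨?_, hreg ε hl hε⟩ hc hd
  rw [quadResultant_smul, quadResultant_derivedA htb]
  have : 0 < -((derivedA a b x z).tb * (derivedA a b x z).th * sylvesterR0 a b) :=
    neg_pos.2 (lt_of_le_of_ne hsgn hne)
  have : 0 < ε ^ 4 * ((derivedA a b x z).tb ^ 2 *
      -((derivedA a b x z).tb * (derivedA a b x z).th * sylvesterR0 a b)) := by positivity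
  linarith

theorem cube_of_sign {ε : ℝ} (h : ε = 1 ∨ ε = -1) : ε ^ 3 = ε := by
  rcases h with rfl | rfl <;> norm_num

theorem CondI.mem {a b : Quad} {x z : ℝ} (h : CondI a b x z) (hx : 0 ≤ x) (hz : z ≠ 0) :
    a.toRatFunc / b.toRatFunc ∈ impedanceSet 1 2 := by
  obtain ⟨h, h₂, hsgn⟩ := h
  refine derivedA_mem_one_one h hx hz (by linarith) fun ε hl hε => Or.inl ⟨?_, ?_⟩
  · rw [alpha₂_smul]
    exact mul_nonneg (sq_nonneg _) h₂
  · rwa [lambda₁_smul, cube_of_sign hε]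

theorem CondII.mem {a b : Quad} {x z : ℝ} (h : CondII a b x z) (hx : 0 ≤ x) (hz : z ≠ 0) :
    a.toRatFunc / b.toRatFunc ∈ impedanceSet 1 2 := by
  obtain ⟨h, h₂, hsgn⟩ := h
  refine derivedA_mem_one_one h hx hz hsgn fun ε hl hε => Or.inr (Or.inl ⟨?_, ?_⟩)
  · rw [alpha₂_smul]
    exact mul_nonpos_of_nonneg_of_nonpos (sq_nonneg _) h₂
  · rwa [lambda₃_smul, cube_of_sign hε]

theorem CondIII.mem {a b : Quad} {x z : ℝ} (h : CondIII a b x z) (hx : 0 ≤ x) (hz : z ≠ 0) :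
    a.toRatFunc / b.toRatFunc ∈ impedanceSet 1 2 := by
  obtain ⟨h, h₂, hsgn⟩ := h
  refine derivedA_mem_one_one h hx hz hsgn fun ε hl hε => Or.inr (Or.inr (Or.inl ⟨?_, ?_⟩))
  · rw [alpha₂_smul]
    exact mul_nonpos_of_nonneg_of_nonpos (sq_nonneg _) h₂
  · rwa [lambda₄_smul, cube_of_sign hε]

theorem CondIV.mem {a b : Quad} {x z : ℝ} (h : CondIV a b x z) (hx : 0 ≤ x) (hz : z ≠ 0) :
    a.toRatFunc / b.toRatFunc ∈ impedanceSet 1 2 := by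
  obtain ⟨h, h₂, hsgn⟩ := h
  refine derivedA_mem_one_one h hx hz (by linarith) fun ε hl hε => Or.inr (Or.inr (Or.inr ⟨?_, ?_⟩))
  · rw [alpha₂_smul]
    exact mul_nonneg (sq_nonneg _) h₂
  · rwa [lambda₂_smul, cube_of_sign hε]

theorem sylvesterR0_reverse (a b : Quad) :
    sylvesterR0 a.reverse b.reverse = sylvesterR0 a b := by
  rw [sylvesterR0_eq, sylvesterR0_eq, quadResultant_reverse]

theorem sameSign_of_subset {l l' : List ℝ} (h : SameSign l) (hl : l' ⊆ l) : SameSign l' :=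
  h.imp (fun h t ht => h t (hl ht)) (fun h t ht => h t (hl ht))

theorem CondV.mem {a b : Quad} {x z : ℝ} (h : CondV a b x z) (hx : 0 ≤ x) (hz : z ≠ 0) :
    a.toRatFunc / b.toRatFunc ∈ impedanceSet 1 2 := by
  simp only [CondV, derivedB_eq] at h
  obtain ⟨⟨ha, hb, hS, hth, hR⟩, h₂, hsgn⟩ := h
  rw [← sylvesterR0_reverse] at hsgn
  have hC : CommonCond a.reverse b.reverse z (derivedA a.reverse b.reverse x z)
      (lambda₁ (derivedA a.reverse b.reverse x z).c.reverse
        (derivedA a.reverse b.reverse x z).d.reverse) := by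
    refine ⟨ha.reverse, hb.reverse, sameSign_of_subset hS ?_, hth, by rwa [sylvesterR0_reverse]⟩
    simp [Quad.reverse]
  rw [← Quad.reverse_reverse a, ← Quad.reverse_reverse b, ← Quad.frequencyInversion_toRatFunc_div,
    frequencyInversion_mem_impedanceSet_iff]
  have htb := hC.tb_ne_zero hx
  refine mem_of_derivedA hC hx hz ?_
  obtain ⟨ε, hε, hε₁, hε₂, hε₃, hl, hc, hd⟩ := hC.exists_sign hx hz
  have hε0 : ε ≠ 0 := by rcases hε with rfl | rfl <;> norm_num
  have hne := mul_ne_zero (mul_ne_zero htb hC.2.2.2.1) hC.2.2.2.2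
  rw [← Quad.toRatFunc_smul_div_smul hε0, ← frequencyInversion_mem_impedanceSet_iff,
    Quad.frequencyInversion_toRatFunc_div]
  -- The resultant now has the opposite sign to that in (I)-(IV), so the extraction leaves a second
  -- inductor and no capacitor.
  refine quad_div_mem_zero_two_of_lambda₁ hc.reverse hd.reverse ?_ ?_ ?_
  · rw [quadResultant_reverse, quadResultant_smul, quadResultant_derivedA htb]
    have h₁ := lt_of_le_of_ne' hsgn hne
    have : 0 < ε ^ 4 * ((derivedA a.reverse b.reverse x z).tb ^ 2 *
        ((derivedA a.reverse b.reverse x z).tb * (derivedA a.reverse b.reverse x z).th *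
          sylvesterR0 a.reverse b.reverse)) :=
      mul_pos (by positivity) (mul_pos (by positivity) h₁)
    linarith
  · rw [Quad.reverse_smul, Quad.reverse_smul, alpha₂_smul]
    exact mul_nonneg (sq_nonneg _) h₂
  · rw [Quad.reverse_smul, Quad.reverse_smul, lambda₁_smul, cube_of_sign hε]
    exact hl

theorem BoundaryCond.mem {a b : Quad} {x z : ℝ} (h : BoundaryCond a b x z) (hx : 0 ≤ x)
    (hz : z ≠ 0) : a.toRatFunc / b.toRatFunc ∈ impedanceSet 1 2 := by
  rcases h with ⟨h, -⟩ | ⟨h, -⟩ | ⟨h, -⟩ | ⟨h, -⟩ | ⟨h, -⟩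
  · exact h.mem hx hz
  · exact h.mem hx hz
  · exact h.mem hx hz
  · exact h.mem hx hz
  · exact h.mem hx hz

/-! ### Degree two forces a shared pole -/

/-- A quotient of two quadratic polynomials that is not bilinear. -/
def IsDegreeTwo (Z : RatFunc ℝ) : Prop :=
  (∃ a b : Quad, Z = a.toRatFunc / b.toRatFunc) ∧
    ∀ A B C D : ℝ, Z ≠ linRat A B / linRat C D

theorem IsDegreeTwo.frequencyInversion {Z : RatFunc ℝ} (h : IsDegreeTwo Z) :
    IsDegreeTwo (frequencyInversion Z) := by
  obtain ⟨⟨a, b, rfl⟩, h⟩ := h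
  refine ⟨⟨_, _, Quad.frequencyInversion_toRatFunc_div a b⟩, fun A B C D e => h B A D C ?_⟩
  rw [← frequencyInversion_linRat_div, ← e, frequencyInversion_frequencyInversion]

theorem IsDegreeTwo.inv {Z : RatFunc ℝ} (h : IsDegreeTwo Z) : IsDegreeTwo Z⁻¹ := by
  obtain ⟨⟨a, b, rfl⟩, h⟩ := h
  refine ⟨⟨b, a, inv_div _ _⟩, fun A B C D e => h C D A B ?_⟩
  rw [← inv_div (linRat A B), ← e, inv_inv]

theorem IsDegreeTwo.dualRat {Z : RatFunc ℝ} (h : IsDegreeTwo Z) : IsDegreeTwo (dualRat Z) :=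
  h.frequencyInversion.inv

theorem IsDegreeTwo.ne_zero {Z : RatFunc ℝ} (h : IsDegreeTwo Z) : Z ≠ 0 := by
  rintro rfl
  exact h.2 0 0 0 0 (by simp [linRat])

/-- A quadratic polynomial as an element of `ℝ[s]`. -/
noncomputable def Quad.toPoly (p : Quad) : Polynomial ℝ :=
  Polynomial.C p.c₂ * Polynomial.X ^ 2 + Polynomial.C p.c₁ * Polynomial.X + Polynomial.C p.c₀

theorem Quad.algebraMap_toPoly (p : Quad) : algebraMap _ (RatFunc ℝ) p.toPoly = p.toRatFunc := by
  simp [toPoly, toRatFunc]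

theorem Quad.eval_toPoly (p : Quad) (s : ℝ) : p.toPoly.eval s = p.eval s := by
  simp [toPoly, eval]

theorem Quad.natDegree_toPoly_le (p : Quad) : p.toPoly.natDegree ≤ 2 :=
  Polynomial.natDegree_quadratic_le

theorem exists_quad_of_natDegree_le {p : Polynomial ℝ} (h : p.natDegree ≤ 2) :
    ∃ q : Quad, algebraMap _ (RatFunc ℝ) p = q.toRatFunc := by
  refine ⟨⟨p.coeff 2, p.coeff 1, p.coeff 0⟩, ?_⟩
  rw [← Quad.algebraMap_toPoly]
  congr 1
  exact Polynomial.eq_quadratic_of_degree_le_two (Polynomial.natDegree_le_iff_degree_le.1 h)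

theorem linRat_eq_algebraMap (A B : ℝ) : linRat A B =
    algebraMap _ (RatFunc ℝ) (Polynomial.C A * Polynomial.X + Polynomial.C B) := by
  simp [linRat]

theorem IsBiquadratic.isDegreeTwo {Z : RatFunc ℝ} (h : IsBiquadratic Z) : IsDegreeTwo Z := by
  unfold IsBiquadratic at h
  constructor
  · obtain ⟨a, ha⟩ := exists_quad_of_natDegree_le ((le_max_left _ _).trans h.le)
    obtain ⟨b, hb⟩ := exists_quad_of_natDegree_le ((le_max_right _ _).trans h.le)
    exact ⟨a, b, by rw [← ha, ← hb, RatFunc.num_div_denom]⟩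
  · rintro A B C D rfl
    rw [linRat_eq_algebraMap, linRat_eq_algebraMap] at h
    have hp : (Polynomial.C A * Polynomial.X + Polynomial.C B).natDegree ≤ 1 :=
      Polynomial.natDegree_linear_le
    have hq : (Polynomial.C C * Polynomial.X + Polynomial.C D).natDegree ≤ 1 :=
      Polynomial.natDegree_linear_le
    generalize Polynomial.C A * Polynomial.X + Polynomial.C B = p at *
    generalize Polynomial.C C * Polynomial.X + Polynomial.C D = q at *
    by_cases hp0 : p = 0
    · simp [hp0] at h
    by_cases hq0 : q = 0
    · simp [hq0] at h
    have h₁ := Polynomial.natDegree_le_of_dvd (RatFunc.num_div_dvd p hq0) hp0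
    have h₂ := Polynomial.natDegree_le_of_dvd (RatFunc.denom_div_dvd p q) hq0
    rcases max_choice (algebraMap _ (RatFunc ℝ) p / algebraMap _ (RatFunc ℝ) q).num.natDegree
      (algebraMap _ (RatFunc ℝ) p / algebraMap _ (RatFunc ℝ) q).denom.natDegree with h' | h' <;> lia

theorem isCoprime_toPoly {c d : Quad} (h : quadResultant c d ≠ 0) :
    IsCoprime c.toPoly d.toPoly := by
  have e : (Polynomial.C (alpha₃ c d) * Polynomial.X - Polynomial.C (alpha₂ c d)) *
        (Polynomial.C d.c₂ * c.toPoly - Polynomial.C c.c₂ * d.toPoly) +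
      Polynomial.C (alpha₃ c d) *
        (Polynomial.C d.c₁ * c.toPoly - Polynomial.C c.c₁ * d.toPoly) =
      Polynomial.C (quadResultant c d) := by
    simp only [Quad.toPoly, quadResultant, alpha₁, alpha₂, alpha₃, map_sub, map_mul, map_pow]
    ring
  have e' : Polynomial.C (quadResultant c d)⁻¹ * Polynomial.C (quadResultant c d) = 1 := by
    rw [← Polynomial.C_mul, inv_mul_cancel₀ h, Polynomial.C_1]
  refine ⟨Polynomial.C (quadResultant c d)⁻¹ *
    ((Polynomial.C (alpha₃ c d) * Polynomial.X - Polynomial.C (alpha₂ c d)) *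
      Polynomial.C d.c₂ + Polynomial.C (alpha₃ c d) * Polynomial.C d.c₁),
    -Polynomial.C (quadResultant c d)⁻¹ *
    ((Polynomial.C (alpha₃ c d) * Polynomial.X - Polynomial.C (alpha₂ c d)) *
      Polynomial.C c.c₂ + Polynomial.C (alpha₃ c d) * Polynomial.C c.c₁), ?_⟩
  rw [← e', ← e]
  ring

/-- If a degree-two impedance is an inductive branch in parallel with `c / d`, then the branch
shares its pole with `d / c`. -/
theorem eval_eq_zero_of_isDegreeTwo {r k x : ℝ} {c d : Quad}
    (h : IsDegreeTwo (RatFunc.C r + c.toRatFunc * linRat 1 x /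
      (d.toRatFunc * linRat 1 x + RatFunc.C k * c.toRatFunc)))
    (hk : k ≠ 0) (hR : quadResultant c d ≠ 0) : c.eval (-x) = 0 := by
  by_contra hc
  have h0 := h.ne_zero
  have hnl := h.2 0 r 0 1
  obtain ⟨⟨a, b, e⟩, -⟩ := h
  set l : Polynomial ℝ := Polynomial.X + Polynomial.C x with hl
  clear_value l
  have hl' : linRat 1 x = algebraMap _ (RatFunc ℝ) l := by simp [linRat, hl]
  have hkC : IsUnit (Polynomial.C k) := Polynomial.isUnit_C.2 (isUnit_iff_ne_zero.2 hk)
  have cop_cl : IsCoprime l c.toPoly := by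
    have hirr : Irreducible l := by
      have := Polynomial.irreducible_X_sub_C (-x)
      rwa [map_neg, sub_neg_eq_add, ← hl] at this
    refine (hirr.coprime_iff_not_dvd).2 fun hdvd => hc ?_
    have hdvd' : Polynomial.X - Polynomial.C (-x) ∣ c.toPoly := by
      rwa [map_neg, sub_neg_eq_add, ← hl]
    have := Polynomial.dvd_iff_isRoot.1 hdvd'
    rwa [Polynomial.IsRoot, Quad.eval_toPoly] at this
  have cop_cd := isCoprime_toPoly hR
  set Q : Polynomial ℝ := d.toPoly * l + Polynomial.C k * c.toPoly with hQ
  clear_value Q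
  have cop_Qc : IsCoprime Q c.toPoly := by
    rw [hQ]
    exact (IsCoprime.mul_left cop_cd.symm cop_cl).add_mul_right_left _
  have cop_Ql : IsCoprime Q l := by
    rw [hQ, add_comm]
    refine IsCoprime.add_mul_right_left ?_ _
    exact (isCoprime_mul_unit_left_left hkC _ _).2 cop_cl.symm
  -- If `c(-x) ≠ 0`, the fraction `P / Q` is in lowest terms. Degree two then kills the cubic
  -- coefficients `d₂` of `Q` and `c₂` of `P`, and `c₂ = d₂ = 0` makes the resultant vanish.
  have cop : IsCoprime Q (Polynomial.C r * Q + c.toPoly * l) :=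
    IsCoprime.mul_add_right_right (cop_Qc.mul_right cop_Ql) _
  set P : Polynomial ℝ := Polynomial.C r * Q + c.toPoly * l with hP
  clear_value P
  have hQ' : d.toRatFunc * linRat 1 x + RatFunc.C k * c.toRatFunc = algebraMap _ _ Q := by
    rw [hQ, map_add, map_mul, map_mul, Quad.algebraMap_toPoly, Quad.algebraMap_toPoly, hl',
      RatFunc.algebraMap_C]
  rw [hQ'] at e h0 hnl
  have hQ0 : algebraMap _ (RatFunc ℝ) Q ≠ 0 := by
    intro hQ0
    rw [hQ0, div_zero, add_zero] at hnl
    exact hnl (by simp [linRat])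
  have ePQ : RatFunc.C r + c.toRatFunc * linRat 1 x / algebraMap _ _ Q =
      algebraMap _ _ P / algebraMap _ _ Q := by
    rw [add_div' _ _ _ hQ0, hP, map_add, map_mul, map_mul, Quad.algebraMap_toPoly, hl',
      RatFunc.algebraMap_C]
  rw [ePQ] at e h0
  have hab : a.toRatFunc ≠ 0 ∧ b.toRatFunc ≠ 0 := by
    rw [e] at h0
    exact div_ne_zero_iff.1 h0
  rw [div_eq_div_iff hQ0 hab.2, ← Quad.algebraMap_toPoly, ← Quad.algebraMap_toPoly, ← map_mul,
    ← map_mul] at e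
  have e := RatFunc.algebraMap_injective ℝ e
  have ha0 : a.toPoly ≠ 0 := by
    intro h
    exact hab.1 (by rw [← Quad.algebraMap_toPoly, h, map_zero])
  have hb0 : b.toPoly ≠ 0 := by
    intro h
    exact hab.2 (by rw [← Quad.algebraMap_toPoly, h, map_zero])
  have dQ : Q ∣ b.toPoly := cop.dvd_of_dvd_mul_left ⟨a.toPoly, by rw [e]; ring⟩
  have dP : P ∣ a.toPoly := cop.symm.dvd_of_dvd_mul_right ⟨b.toPoly, by rw [e]⟩
  have degQ := (Polynomial.natDegree_le_of_dvd dQ hb0).trans b.natDegree_toPoly_le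
  have degP := (Polynomial.natDegree_le_of_dvd dP ha0).trans a.natDegree_toPoly_le
  have q3 : Q.coeff 3 = 0 := Polynomial.coeff_eq_zero_of_natDegree_lt (by lia)
  have p3 : P.coeff 3 = 0 := Polynomial.coeff_eq_zero_of_natDegree_lt (by lia)
  have hcl : ∀ p : Quad, (p.toPoly * l).coeff 3 = p.c₂ := by
    intro p
    have : p.toPoly * l = Polynomial.C p.c₂ * Polynomial.X ^ 3 +
        Polynomial.C (p.c₁ + x * p.c₂) * Polynomial.X ^ 2 +
        Polynomial.C (p.c₀ + x * p.c₁) * Polynomial.X + Polynomial.C (x * p.c₀) := by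
      simp only [Quad.toPoly, hl, map_add, map_mul]
      ring
    rw [this]
    simp only [Polynomial.coeff_add, Polynomial.coeff_C_mul, Polynomial.coeff_X_pow,
      Polynomial.coeff_X, Polynomial.coeff_C]
    norm_num
  have hc3 : c.toPoly.coeff 3 = 0 :=
    Polynomial.coeff_eq_zero_of_natDegree_lt (by have := c.natDegree_toPoly_le; lia)
  rw [hP, Polynomial.coeff_add, Polynomial.coeff_C_mul, q3, hcl] at p3
  rw [hQ, Polynomial.coeff_add, Polynomial.coeff_C_mul, hcl, hc3] at q3
  apply hR
  have c2 : c.c₂ = 0 := by linarith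
  have d2 : d.c₂ = 0 := by linarith
  simp [quadResultant, alpha₁, alpha₂, alpha₃, c2, d2]

theorem Quad.toRatFunc_of_eval_eq_zero {p : Quad} {x : ℝ} (h : p.eval (-x) = 0) :
    p.toRatFunc = linRat 1 x * linRat p.c₂ (p.c₁ - x * p.c₂) := by
  have e : p.c₀ = x * (p.c₁ - x * p.c₂) := by
    simp only [eval] at h
    linarith
  simp only [toRatFunc, linRat]
  rw [e]
  simp only [map_sub, map_mul, map_one]
  ring

theorem exists_poleQuad {c : Quad} {x : ℝ} (hx : 0 ≤ x) (hc : c.Nonneg) (h : c.eval (-x) = 0) :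
    ∃ f₁ f₀ : ℝ, 0 ≤ f₁ ∧ 0 ≤ f₀ ∧ c = poleQuad x f₁ f₀ := by
  obtain ⟨c₂, c₁, c₀⟩ := c
  obtain ⟨hc₀, hc₁, hc₂⟩ := hc
  simp only [Quad.eval] at *
  have e : c₀ = x * (c₁ - x * c₂) := by linarith
  refine ⟨c₂, c₁ - x * c₂, hc₂, ?_, ?_⟩
  · rcases hx.eq_or_lt with rfl | hx
    · simpa using hc₁
    · rw [e] at hc₀
      exact nonneg_of_mul_nonneg_right hc₀ hx
  · simp only [poleQuad, Quad.mk.injEq, true_and]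
    exact ⟨by ring, e⟩

/-- The shared pole lets `s + x` cancel once. A further common factor `s + x`, that is, a root `-x`
of `d + k F`, would make `Z` bilinear. -/
theorem exists_addLin_form {r k x : ℝ} {c d : Quad} {Z : RatFunc ℝ} (hZ : IsDegreeTwo Z)
    (hk : 0 < k) (hx : 0 ≤ x) (hc : c.Nonneg) (hd : d.Nonneg) (hR : quadResultant c d ≠ 0)
    (e : Z = RatFunc.C r + ((linRat 1 x / RatFunc.C k)⁻¹ + (c.toRatFunc / d.toRatFunc)⁻¹)⁻¹) :
    ∃ f₁ f₀ : ℝ, 0 ≤ f₁ ∧ 0 ≤ f₀ ∧ c = poleQuad x f₁ f₀ ∧ (d.addLin k f₁ f₀).eval (-x) ≠ 0 ∧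
      Z = RatFunc.C r + (poleQuad x f₁ f₀).toRatFunc / (d.addLin k f₁ f₀).toRatFunc := by
  have hl0 := linRat_ne_zero zero_le_one hx (Or.inl one_ne_zero)
  have hc0 := (c.isPosRat_toRatFunc hc (left_ne_zero_of_quadResultant hR)).ne_zero
  have e₁ : Z = RatFunc.C r + c.toRatFunc * linRat 1 x /
      (d.toRatFunc * linRat 1 x + RatFunc.C k * c.toRatFunc) := by
    rw [e, inv_div, inv_div, div_add_div _ _ hl0 hc0, inv_div]
    ring
  obtain ⟨f₁, f₀, h₁, h₀, rfl⟩ := exists_poleQuad hx hc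
    (eval_eq_zero_of_isDegreeTwo (by rwa [e₁] at hZ) hk.ne' hR)
  have e₂ : Z = RatFunc.C r + (poleQuad x f₁ f₀).toRatFunc / (d.addLin k f₁ f₀).toRatFunc := by
    rw [e₁, Quad.toRatFunc_addLin, toRatFunc_poleQuad]
    congr 1
    have : d.toRatFunc * linRat 1 x + RatFunc.C k * (linRat 1 x * linRat f₁ f₀) =
        (d.toRatFunc + RatFunc.C k * linRat f₁ f₀) * linRat 1 x := by ring
    rw [this, mul_div_mul_right _ _ hl0]
  refine ⟨f₁, f₀, h₁, h₀, rfl, fun hb => ?_, e₂⟩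
  have hb0 := ((d.addLin k f₁ f₀).isPosRat_toRatFunc (hd.addLin hk.le h₁ h₀) (by
    by_contra! hz
    rw [e₂] at hZ
    refine hZ.2 0 r 0 1 ?_
    have : (d.addLin k f₁ f₀).toRatFunc = 0 := by simp [Quad.toRatFunc, hz]
    rw [this]
    simp [linRat])).ne_zero
  rw [Quad.toRatFunc_of_eval_eq_zero hb] at hb0 e₂
  rw [toRatFunc_poleQuad, mul_div_mul_left _ _ hl0, add_div' _ _ _ (right_ne_zero_of_mul hb0)] at e₂
  refine hZ.2 (r * (d.addLin k f₁ f₀).c₂ + f₁)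
    (r * ((d.addLin k f₁ f₀).c₁ - x * (d.addLin k f₁ f₀).c₂) + f₀)
    (d.addLin k f₁ f₀).c₂ ((d.addLin k f₁ f₀).c₁ - x * (d.addLin k f₁ f₀).c₂) (e₂.trans ?_)
  congr 1
  simp only [linRat, map_add, map_mul]
  ring

/-! ### Necessity: from the parameters of a network to the conditions -/

/-- For `b = d + k F` and `a = r b + (s + x) F` one has `ã = r b̃`, so the Bezoutian row returns `b̃
F`. The choice `z = k / b̃` then gives `h = b - k F = d`. -/
theorem derivedA_of_addLin {r k x f₁ f₀ : ℝ} {d : Quad}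
    (hb : (d.addLin k f₁ f₀).eval (-x) ≠ 0) :
    derivedA (Quad.mulAdd r (d.addLin k f₁ f₀) (poleQuad x f₁ f₀)) (d.addLin k f₁ f₀) x
      (k / (d.addLin k f₁ f₀).eval (-x)) =
      { ta := r * (d.addLin k f₁ f₀).eval (-x)
        tb := (d.addLin k f₁ f₀).eval (-x)
        th := d.eval (-x)
        f₀ := (d.addLin k f₁ f₀).eval (-x) * f₀
        f₁ := (d.addLin k f₁ f₀).eval (-x) * f₁
        c := (poleQuad x f₁ f₀).smul ((d.addLin k f₁ f₀).eval (-x))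
        d := d.smul ((d.addLin k f₁ f₀).eval (-x)) } := by
  set b := d.addLin k f₁ f₀ with hbdef
  set a := Quad.mulAdd r b (poleQuad x f₁ f₀) with hadef
  set z := k / b.eval (-x) with hz
  have htb : (derivedA a b x z).tb = b.eval (-x) := rfl
  have hta : (derivedA a b x z).ta = r * b.eval (-x) := by
    change a.eval (-x) = _
    simp only [hadef, Quad.mulAdd, Quad.eval, poleQuad]
    ring
  obtain ⟨e₁, e₂, -⟩ := derivedA_f a b x z
  have hf₁ : (derivedA a b x z).f₁ = b.eval (-x) * f₁ := by
    rw [e₁, htb, hta]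
    simp only [hadef, Quad.mulAdd, poleQuad]
    ring
  have hf₀ : (derivedA a b x z).f₀ = b.eval (-x) * f₀ := by
    rw [hf₁, htb, hta] at e₂
    have : (derivedA a b x z).f₀ = b.eval (-x) * a.c₁ - r * b.eval (-x) * b.c₁ -
        x * (b.eval (-x) * f₁) := by linarith
    rw [this]
    simp only [hadef, Quad.mulAdd, poleQuad]
    ring
  have hh : b.addLin (-z) (derivedA a b x z).f₁ (derivedA a b x z).f₀ = d := by
    have hzk : z * b.eval (-x) = k := div_mul_cancel₀ _ hb
    rw [hf₁, hf₀]
    have h₁ : -z * (b.eval (-x) * f₁) = -k * f₁ := by rw [← hzk]; ring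
    have h₀ : -z * (b.eval (-x) * f₀) = -k * f₀ := by rw [← hzk]; ring
    simp only [Quad.addLin]
    rw [h₁, h₀]
    simp [hbdef, Quad.addLin]
  have hth := derivedA_th a b x z
  have hd := derivedA_d a b x z
  have hc := derivedA_c a b x z
  rw [hh] at hth hd
  rw [htb] at hd
  rw [hf₁, hf₀] at hc
  have hc' : (derivedA a b x z).c = (poleQuad x f₁ f₀).smul (b.eval (-x)) := by
    rw [hc]
    simp only [poleQuad, Quad.smul, Quad.mk.injEq, true_and]
    constructor <;> ring
  rw [← hta, ← hth, ← hf₁, ← hf₀, ← hc', ← hd]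
  rfl

theorem sameSign_of_mul {t : ℝ} (l : List ℝ) (h : ∀ u ∈ l, 0 ≤ t * u) (ht : t ≠ 0) :
    SameSign l := by
  rcases lt_or_gt_of_ne ht with ht | ht
  · exact Or.inr fun u hu => nonpos_of_mul_nonneg_right (h u hu) ht
  · exact Or.inl fun u hu => nonneg_of_mul_nonneg_right (h u hu) ht

section Parametrization

variable {r k x f₁ f₀ : ℝ} {d : Quad}

theorem sylvesterR0_of_addLin : (d.addLin k f₁ f₀).eval (-x) ^ 2 *
      quadResultant (poleQuad x f₁ f₀) d = -((d.addLin k f₁ f₀).eval (-x) * d.eval (-x) *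
      sylvesterR0 (Quad.mulAdd r (d.addLin k f₁ f₀) (poleQuad x f₁ f₀)) (d.addLin k f₁ f₀)) := by
  rw [sylvesterR0_eq, quadResultant_mulAdd, quadResultant_poleQuad, quadResultant_poleQuad]
  simp only [Quad.addLin]
  ring

theorem sylvesterR0_of_addLin_ne_zero (hb : (d.addLin k f₁ f₀).eval (-x) ≠ 0)
    (hR : quadResultant (poleQuad x f₁ f₀) d ≠ 0) :
    d.eval (-x) ≠ 0 ∧
    sylvesterR0 (Quad.mulAdd r (d.addLin k f₁ f₀) (poleQuad x f₁ f₀)) (d.addLin k f₁ f₀) ≠ 0 := by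
  have h := mul_ne_zero (pow_ne_zero 2 hb) hR
  rw [sylvesterR0_of_addLin (r := r), neg_ne_zero] at h
  exact ⟨right_ne_zero_of_mul (left_ne_zero_of_mul h), right_ne_zero_of_mul h⟩

theorem commonCond_of_addLin (hr : 0 ≤ r) (hk : 0 < k) (hx : 0 ≤ x) (h₁ : 0 ≤ f₁) (h₀ : 0 ≤ f₀)
    (hd : d.Nonneg) (hb : (d.addLin k f₁ f₀).eval (-x) ≠ 0)
    (hR : quadResultant (poleQuad x f₁ f₀) d ≠ 0) {l : ℝ} (hl : 0 ≤ l) :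
    CommonCond (Quad.mulAdd r (d.addLin k f₁ f₀) (poleQuad x f₁ f₀)) (d.addLin k f₁ f₀)
      (k / (d.addLin k f₁ f₀).eval (-x))
      { ta := r * (d.addLin k f₁ f₀).eval (-x)
        tb := (d.addLin k f₁ f₀).eval (-x)
        th := d.eval (-x)
        f₀ := (d.addLin k f₁ f₀).eval (-x) * f₀
        f₁ := (d.addLin k f₁ f₀).eval (-x) * f₁
        c := (poleQuad x f₁ f₀).smul ((d.addLin k f₁ f₀).eval (-x))
        d := d.smul ((d.addLin k f₁ f₀).eval (-x)) }
      ((d.addLin k f₁ f₀).eval (-x) ^ 3 * l) := by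
  obtain ⟨hth, hS⟩ := sylvesterR0_of_addLin_ne_zero (r := r) hb hR
  have hbn := hd.addLin hk.le h₁ h₀
  refine ⟨.mulAdd hr hbn (poleQuad_nonneg hx h₁ h₀), hbn, sameSign_of_mul _ ?_ hb, hth, hS⟩
  -- Each listed quantity becomes non-negative when multiplied by `t = b(-x)`. The common sign is
  -- that of `b(-x)`, which may be negative.
  generalize (d.addLin k f₁ f₀).eval (-x) = t at *
  have ht : 0 ≤ t * t := mul_self_nonneg t
  have key : ∀ u, 0 ≤ u → 0 ≤ t * (t * u) := fun u hu => by
    rw [← mul_assoc]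
    exact mul_nonneg ht hu
  simp only [List.forall_mem_cons, List.not_mem_nil, false_imp_iff, implies_true, and_true,
    Quad.smul]
  refine ⟨by rw [mul_comm r]; exact key _ hr, ht, ?_, key _ hd.1, key _ hd.2.1, key _ hd.2.2,
    key _ h₀, key _ h₁, ?_⟩
  · rw [mul_div_cancel₀ _ hb]
    exact hk.le
  · have : t * (t ^ 3 * l) = (t * t) * (t * t) * l := by ring
    rw [this]
    positivity

theorem boundaryCond_of_isBoundaryPair (hr : 0 ≤ r) (hk : 0 < k) (hx : 0 ≤ x) (h₁ : 0 ≤ f₁)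
    (h₀ : 0 ≤ f₀) (hd : d.Nonneg) (hb : (d.addLin k f₁ f₀).eval (-x) ≠ 0)
    (h : IsBoundaryPair (poleQuad x f₁ f₀) d) :
    BoundaryCond (Quad.mulAdd r (d.addLin k f₁ f₀) (poleQuad x f₁ f₀)) (d.addLin k f₁ f₀) x
      (k / (d.addLin k f₁ f₀).eval (-x)) := by
  obtain ⟨hR, h⟩ := h
  have hS := sylvesterR0_of_addLin (r := r) (k := k) (x := x) (f₁ := f₁) (f₀ := f₀) (d := d)
  have hpos := mul_nonneg (sq_nonneg ((d.addLin k f₁ f₀).eval (-x))) hR.le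
  have hα := fun (u : ℝ) (h : 0 ≤ u) => mul_nonneg (sq_nonneg ((d.addLin k f₁ f₀).eval (-x))) h
  have hα' := fun (u : ℝ) (h : u ≤ 0) => mul_nonpos_of_nonneg_of_nonpos
    (sq_nonneg ((d.addLin k f₁ f₀).eval (-x))) h
  have hC := fun l (hl : 0 ≤ l) => commonCond_of_addLin hr hk hx h₁ h₀ hd hb hR.ne' hl
  rw [hS] at hpos
  simp only [BoundaryCond, CondI, CondII, CondIII, CondIV, CondV, derivedA_of_addLin hb,
    alpha₂_smul, lambda₁_smul, lambda₂_smul, lambda₃_smul, lambda₄_smul]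
  rcases h with ⟨h₂, hl⟩ | ⟨h₂, hl⟩ | ⟨h₂, hl, hl'⟩
  · exact Or.inl ⟨⟨hC _ hl.ge, hα _ h₂, hpos⟩, by rw [hl, mul_zero]⟩
  · exact Or.inr (Or.inl ⟨⟨hC _ hl.ge, hα' _ h₂, by linarith⟩, by rw [hl, mul_zero]⟩)
  · refine Or.inr (Or.inr (Or.inl ⟨⟨hC _ hl, hα' _ h₂, by linarith⟩, ?_⟩))
    exact hl'.imp (fun h => by rw [h, mul_zero]) (fun h => by simp only [Quad.smul, h, mul_zero])

/-- The sign is read off from `λ₁ α₂ = α₁² d₂ - d₀ R`, with `R` the negative resultant, if `α₂ > 0`,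
and from `λ₁ = d₁ α₁` if `α₂ = 0`. -/
theorem IsInductivePair.lambda₁_nonneg {c d : Quad} (h : IsInductivePair c d) (hd : d.Nonneg) :
    0 ≤ lambda₁ c d := by
  obtain ⟨hR, h₁, h₂, -⟩ := h
  rcases h₂.eq_or_lt with h₂ | h₂
  · rw [lambda₁, ← h₂, mul_zero, sub_zero]
    exact mul_nonneg hd.2.1 h₁
  · have e : lambda₁ c d * alpha₂ c d = alpha₁ c d ^ 2 * d.c₂ + d.c₀ * -quadResultant c d := by
      simp only [lambda₁, quadResultant, alpha₁, alpha₂, alpha₃]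
      ring
    have : 0 ≤ lambda₁ c d * alpha₂ c d := by
      rw [e]
      exact add_nonneg (mul_nonneg (sq_nonneg _) hd.2.2) (mul_nonneg hd.1 (by linarith))
    exact nonneg_of_mul_nonneg_left this h₂

theorem boundaryCond_of_isInductivePair (hr : 0 ≤ r) (hk : 0 < k) (hx : 0 ≤ x) (h₁ : 0 ≤ f₁)
    (h₀ : 0 ≤ f₀) (hd : d.Nonneg) (hb : (d.addLin k f₁ f₀).eval (-x) ≠ 0)
    (h : IsInductivePair (poleQuad x f₁ f₀).reverse d.reverse) (hd₀ : d.c₀ = 0) :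
    BoundaryCond (Quad.mulAdd r (d.addLin k f₁ f₀) (poleQuad x f₁ f₀)).reverse
      (d.addLin k f₁ f₀).reverse x (k / (d.addLin k f₁ f₀).eval (-x)) := by
  have hl := h.lambda₁_nonneg hd.reverse
  obtain ⟨hR, -, h₂, -⟩ := h
  rw [quadResultant_reverse] at hR
  have hS := sylvesterR0_of_addLin (r := r) (k := k) (x := x) (f₁ := f₁) (f₀ := f₀) (d := d)
  have hpos := mul_nonneg (sq_nonneg ((d.addLin k f₁ f₀).eval (-x))) (neg_nonneg.2 hR.le)
  rw [mul_neg, hS, neg_neg] at hpos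
  obtain ⟨ha, hb', hSS, hth, hR'⟩ := commonCond_of_addLin hr hk hx h₁ h₀ hd hb hR.ne hl
  refine Or.inr (Or.inr (Or.inr (Or.inr ?_)))
  simp only [CondV, derivedB_eq, Quad.reverse_reverse, derivedA_of_addLin hb, Quad.reverse_smul,
    alpha₂_smul, lambda₁_smul]
  refine ⟨⟨⟨ha.reverse, hb'.reverse, sameSign_of_subset hSS ?_, hth,
    by rwa [sylvesterR0_reverse]⟩, mul_nonneg (sq_nonneg _) h₂, by rwa [sylvesterR0_reverse]⟩, ?_⟩
  · simp [Quad.smul, Quad.reverse]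
  · simp only [Quad.smul, Quad.reverse, hd₀, mul_zero]

end Parametrization

/-! ### Assembly of the two directions -/

/-- `Z` has a representation `a / b` that satisfies the boundary conditions. -/
def HasBoundaryForm (Z : RatFunc ℝ) : Prop :=
  ∃ x z : ℝ, 0 ≤ x ∧ z ≠ 0 ∧ ∃ a b : Quad, Z = a.toRatFunc / b.toRatFunc ∧ BoundaryCond a b x z

theorem linRat_one_div_C_inv {k x : ℝ} :
    (linRat 1 x / RatFunc.C k)⁻¹ = RatFunc.C k / (RatFunc.X + RatFunc.C x) := by
  rw [inv_div]
  simp [linRat]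

theorem IsPosRat.inv_add_C {Z : RatFunc ℝ} (hZ : IsPosRat Z) {g : ℝ} (hg : 0 ≤ g) :
    IsPosRat (Z⁻¹ + RatFunc.C g)⁻¹ := by
  rw [add_comm]
  exact ((IsNonnegRat.C hg).add_pos hZ.inv).inv

theorem addLin_ne_zero_of_eval {k x f₁ f₀ : ℝ} {d : Quad}
    (hb : (d.addLin k f₁ f₀).eval (-x) ≠ 0) (hd : (d.addLin k f₁ f₀).Nonneg) :
    (d.addLin k f₁ f₀).toRatFunc ≠ 0 := by
  refine (Quad.isPosRat_toRatFunc hd ?_).ne_zero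
  by_contra! h
  exact hb (by simp [Quad.eval, h])

theorem hasBoundaryForm_of_parallel_inductor {r : ℝ} {Z Z₁ Z₂ : RatFunc ℝ} (hZ : IsDegreeTwo Z)
    (hr : 0 ≤ r)
    (h₁ : Z₁ ∈ impedanceSet 0 1) (h₂ : Z₂ ∈ impedanceSet 1 1) (h0₁ : Z₁ ≠ 0) (h0₂ : Z₂ ≠ 0)
    (e : Z = RatFunc.C r + (Z₁⁻¹ + Z₂⁻¹)⁻¹) :
    Z ∈ impedanceSet 1 1 ∨ Z ∈ impedanceSet 0 2 ∨ HasBoundaryForm Z := by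
  obtain ⟨g, k, x, hg, hk, hx, e₁⟩ := inv_eq_of_mem_zero_one h₁ h0₁
  have hW := parallel_C_mem_impedanceSet h₂ h0₂ hg
  have hW0 := ((isPosRat_of_mem_impedanceSet h₂ h0₂).inv_add_C hg).ne_zero
  -- The conductance `g` of the inductive branch is moved into the other network, leaving the pure
  -- term `k / (s + x)`.
  have e' : Z = RatFunc.C r +
      ((linRat 1 x / RatFunc.C k)⁻¹ + ((Z₂⁻¹ + RatFunc.C g)⁻¹)⁻¹)⁻¹ := by
    rw [e, e₁, linRat_one_div_C_inv, inv_inv]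
    congr 2
    ring
  generalize (Z₂⁻¹ + RatFunc.C g)⁻¹ = W at hW hW0 e'
  rcases hk.eq_or_lt with rfl | hk
  · rw [map_zero, div_zero, inv_zero, zero_add, inv_inv] at e'
    rw [e']
    exact Or.inl (C_add_mem_impedanceSet hW hr)
  have hL := linRat_one_div_C_mem hx hk
  have hL0 : linRat 1 x / RatFunc.C k ≠ 0 := div_ne_zero
    (linRat_ne_zero zero_le_one hx (Or.inl one_ne_zero)) (RatFunc.C_ne_zero hk.ne')
  rcases exists_regular_of_mem_one_one hW with hW | hW | ⟨c, d, hc, hd, hreg, rfl⟩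
  · rw [e']
    exact Or.inl (C_add_mem_impedanceSet (parallel_mem_impedanceSet hL hW hL0 hW0) hr)
  · rw [e']
    exact Or.inr (Or.inl (C_add_mem_impedanceSet (parallel_mem_impedanceSet hL hW hL0 hW0) hr))
  obtain ⟨f₁, f₀, hf₁, hf₀, rfl, hb, eZ⟩ := exists_addLin_form hZ hk hx hc hd hreg.1.ne' e'
  have hbn := addLin_ne_zero_of_eval hb (hd.addLin hk.le hf₁ hf₀)
  rcases hreg.deform hr hk hx hf₁ hf₀ hd hb with h | h | ⟨t, ht, hdt, hB⟩
  · rw [eZ]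
    exact Or.inl h
  · rw [eZ]
    exact Or.inr (Or.inl h)
  -- Replacing `(d, k)` by `(d + t F, k - t)` leaves `b = d + k F`, and with it `a`, unchanged; only
  -- `z` changes.
  · have ek : (d.addLin t f₁ f₀).addLin (k - t) f₁ f₀ = d.addLin k f₁ f₀ := by
      rw [Quad.addLin_addLin, add_sub_cancel]
    have := boundaryCond_of_isBoundaryPair hr (sub_pos.2 ht) hx hf₁ hf₀ hdt (by rwa [ek]) hB
    rw [ek] at this
    refine Or.inr (Or.inr ⟨x, _, hx, div_ne_zero (sub_pos.2 ht).ne' hb, _, _, ?_, this⟩)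
    rw [eZ, Quad.toRatFunc_mulAdd, add_div' _ _ _ hbn]

theorem hasBoundaryForm_of_parallel_capacitor {r : ℝ} {Z Z₁ Z₂ : RatFunc ℝ} (hZ : IsDegreeTwo Z)
    (hr : 0 ≤ r)
    (h₁ : Z₁ ∈ impedanceSet 1 0) (h₂ : Z₂ ∈ impedanceSet 0 2) (h0₁ : Z₁ ≠ 0) (h0₂ : Z₂ ≠ 0)
    (e : Z = RatFunc.C r + (Z₁⁻¹ + Z₂⁻¹)⁻¹) :
    Z ∈ impedanceSet 1 1 ∨ Z ∈ impedanceSet 0 2 ∨ HasBoundaryForm Z := by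
  obtain ⟨g, k, x, hg, hk, hx, e₁⟩ := inv_eq_of_mem_zero_one
    (frequencyInversion_mem_impedanceSet h₁) (frequencyInversion_ne_zero h0₁)
  have hW := parallel_C_mem_impedanceSet h₂ h0₂ hg
  have hW0 := ((isPosRat_of_mem_impedanceSet h₂ h0₂).inv_add_C hg).ne_zero
  have e' : frequencyInversion Z = RatFunc.C r + ((linRat 1 x / RatFunc.C k)⁻¹ +
      (frequencyInversion (Z₂⁻¹ + RatFunc.C g)⁻¹)⁻¹)⁻¹ := by
    rw [linRat_one_div_C_inv]
    simp only [e, map_add, map_inv₀, frequencyInversion_C, inv_inv] at e₁ ⊢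
    rw [e₁]
    congr 2
    ring
  generalize (Z₂⁻¹ + RatFunc.C g)⁻¹ = W at hW hW0 e'
  have eZ : Z = frequencyInversion (frequencyInversion Z) := by simp
  rcases hk.eq_or_lt with rfl | hk
  · rw [map_zero, div_zero, inv_zero, zero_add, inv_inv] at e'
    rw [eZ, e']
    simp only [map_add, frequencyInversion_C, frequencyInversion_frequencyInversion]
    exact Or.inr (Or.inl (C_add_mem_impedanceSet hW hr))
  have hL := linRat_one_div_C_mem hx hk
  have hL0 : linRat 1 x / RatFunc.C k ≠ 0 := div_ne_zero
    (linRat_ne_zero zero_le_one hx (Or.inl one_ne_zero)) (RatFunc.C_ne_zero hk.ne')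
  -- Frequency inversion maps `𝒵_{1,1}` to itself, so that alternative can be checked after the
  -- inversion.
  rw [← frequencyInversion_mem_impedanceSet_iff (Z := Z)]
  rcases exists_inductive_of_mem_zero_two hW with hW | ⟨c, d, hc, hd, hind, rfl⟩
  · rw [e']
    exact Or.inl (C_add_mem_impedanceSet (parallel_mem_impedanceSet hL
      (frequencyInversion_mem_impedanceSet hW) hL0 (frequencyInversion_ne_zero hW0)) hr)
  rw [Quad.frequencyInversion_toRatFunc_div] at e'
  obtain ⟨f₁, f₀, hf₁, hf₀, ec, hb, eZ'⟩ := exists_addLin_form hZ.frequencyInversion hk hx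
    hc.reverse hd.reverse (by rw [quadResultant_reverse]; exact hind.1.ne) e'
  rw [← Quad.reverse_reverse c, ← Quad.reverse_reverse d, ec] at hind
  have hd' := hd.reverse
  generalize d.reverse = D at hb eZ' hind hd'
  have hbn := addLin_ne_zero_of_eval hb (hd'.addLin hk.le hf₁ hf₀)
  rcases hind.deform hr hk hx hf₁ hf₀ hd' with h | ⟨t, ht, hdt, hB, h0⟩
  · rw [eZ']
    exact Or.inl h
  · have ek : (D.addLin t f₁ f₀).addLin (k - t) f₁ f₀ = D.addLin k f₁ f₀ := by
      rw [Quad.addLin_addLin, add_sub_cancel]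
    have := boundaryCond_of_isInductivePair hr (sub_pos.2 ht) hx hf₁ hf₀ hdt (by rwa [ek]) hB h0
    rw [ek] at this
    refine Or.inr (Or.inr ⟨x, _, hx, div_ne_zero (sub_pos.2 ht).ne' hb, _, _, ?_, this⟩)
    rw [eZ, ← Quad.frequencyInversion_toRatFunc_div, eZ', Quad.toRatFunc_mulAdd,
      add_div' _ _ _ hbn]

theorem IsParallelSplit.hasBoundaryForm {Z : RatFunc ℝ} (h : IsParallelSplit 1 2 Z)
    (hZ : IsDegreeTwo Z) :
    Z ∈ impedanceSet 1 1 ∨ Z ∈ impedanceSet 0 2 ∨ HasBoundaryForm Z := by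
  obtain ⟨r, Z₁, Z₂, hr, ⟨h₁, h₂⟩ | ⟨h₁, h₂⟩, h0₁, h0₂, e⟩ := h.one_two
  · exact hasBoundaryForm_of_parallel_inductor hZ hr h₁ h₂ h0₁ h0₂ e
  · exact hasBoundaryForm_of_parallel_capacitor hZ hr h₁ h₂ h0₁ h0₂ e

theorem theorem33 (Z : RatFunc ℝ) (hZ : IsBiquadratic Z) :
    Z ∈ impedanceSet 1 2 ↔
      Z ∈ impedanceSet 1 1 ∨
      Z ∈ impedanceSet 0 2 ∨
      ∃ x z : ℝ, 0 ≤ x ∧ z ≠ 0 ∧ ∃ a b : Quad,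
        (Z = a.toRatFunc / b.toRatFunc ∨ Z = b.reverse.toRatFunc / a.reverse.toRatFunc) ∧
        BoundaryCond a b x z := by
  constructor
  · intro h
    rcases isReducible_of_mem_impedanceSet (by norm_num) h with h | h | h
    · rcases h.one_two with h | h
      · exact Or.inl h
      · exact Or.inr (Or.inl h)
    · rcases h.hasBoundaryForm hZ.isDegreeTwo with h | h | ⟨x, z, hx, hz, a, b, e, h⟩
      · exact Or.inl h
      · exact Or.inr (Or.inl h)
      · exact Or.inr (Or.inr ⟨x, z, hx, hz, a, b, Or.inl e, h⟩)
    -- A split of the dual accounts for the second representation, with reversed and exchanged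
    -- polynomials.
    · rcases h.hasBoundaryForm hZ.isDegreeTwo.dualRat with h | h | ⟨x, z, hx, hz, a, b, e, h⟩
      · exact Or.inl (dualRat_mem_impedanceSet_iff.1 h)
      · exact Or.inr (Or.inl (dualRat_mem_impedanceSet_iff.1 h))
      · refine Or.inr (Or.inr ⟨x, z, hx, hz, a, b, Or.inr ?_, h⟩)
        rw [← Quad.dualRat_toRatFunc_div, ← e, dualRat_dualRat]
  · rintro (h | h | ⟨x, z, hx, hz, a, b, rfl | rfl, h⟩)
    · exact impedanceSet_mono le_rfl one_le_two h
    · exact impedanceSet_mono zero_le_one le_rfl h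
    · exact h.mem hx hz
    · rw [← Quad.dualRat_toRatFunc_div]
      exact dualRat_mem_impedanceSet (h.mem hx hz)
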